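/- **Document exchange.** Alice holds $s\in\{0,1\}^n$ and Bob holds $t\in\{0,1\}^n$; both know $n$ and a threshold $K$. Alice computes from $s$ a message and sends it to Bob, who computes an output from the message and $t$. Let $\mathrm{ed}(s,t)$ be the minimum number of insertions, deletions and substitutions that convert $s$ to $t$. Bob must output $s$ if $\mathrm{ed}(s,t)\le K$, and "error" otherwise; the protocol succeeds if his output is the required one. Both parties are given by fixed programs (not depending on $n$, $K$, $s$, $t$) of a random access machine, where every operation costs one unit plus the bit lengths of the numbers and addresses involved (logarithmic cost), and each party has its own private fair coins. Logarithms are to base $2$. **Theorem.** For every $d\in\mathbb N$ there are constants $c\in\mathbb N$, $C\in\mathbb R$, $e\in\mathbb N$ and programs $A$ (for Alice) and $B$ (for Bob), all depending only on $d$, such that for all integers $n\ge 3$ and $K\ge 1$ with $K^{c}\le n$ and all $s,t\in\{0,1\}^n$ the following hold. 1. (Communication and time.) Whatever the coins show, Alice's message has at most $C\,K(\log K+\log\log n)\log n$ bits, and Alice's program and Bob's program each halt in time at most $C\,n(\log n)^{e}$, Bob's with either a string in $\{0,1\}^n$ or "error" as output. 2. (Success.) The protocol succeeds on $(s,t)$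 with probability at least $1-\dfrac{1}{(K\log n)^{d}}$ over the coins of both parties. -/

import Mathlib

/-!
# One-way document exchange on a random access machine

The model of computation is a random access machine with natural-number registers and arrays,
programmed by finite structured programs and charged by the logarithmic cost criterion: every
operation costs one unit plus the bit lengths of the numbers and of the addresses involved.
-/

namespace DocExchange

/-- Arithmetic operations of the machine. -/
inductive BinOp where
  | add | sub | mul | div | mod | xor | eq | lt

/-- Subtraction is truncated, division by `0` gives `0`, comparisons give `1` or `0`. -/
def BinOp.eval : BinOp → ℕ → ℕ → ℕ
  | .add, x, y => x + y
  | .sub, x, y => x - y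
  | .mul, x, y => x * y
  | .div, x, y => x / y
  | .mod, x, y => x % y
  | .xor, x, y => x ^^^ y
  | .eq, x, y => if x = y then 1 else 0
  | .lt, x, y => if x < y then 1 else 0

/-- Expressions: constants, registers, array cells `a[i]`, and arithmetic operations. A program
refers to finitely many registers and arrays, by fixed names; array indices are computed. -/
inductive Expr where
  | const (c : ℕ)
  | var (x : ℕ)
  | get (a : ℕ) (i : Expr)
  | op (o : BinOp) (e₁ e₂ : Expr)

/-- A configuration: registers, arrays, and the fair coins that have not been tossed yet. -/
structure State where
  var : ℕ → ℕ
  arr : ℕ → ℕ → ℕ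
  coins : List Bool

/-- The value of an expression. -/
def Expr.eval (σ : State) : Expr → ℕ
  | .const c => c
  | .var x => σ.var x
  | .get a i => σ.arr a (i.eval σ)
  | .op o e₁ e₂ => o.eval (e₁.eval σ) (e₂.eval σ)

/-- The logarithmic cost of evaluating an expression (`Nat.size` is the bit length). -/
def Expr.cost (σ : State) : Expr → ℕ
  | .const c => 1 + c.size
  | .var x => 1 + (σ.var x).size
  | .get a i => i.cost σ + 1 + (i.eval σ).size + (σ.arr a (i.eval σ)).size
  | .op o e₁ e₂ =>
      e₁.cost σ + e₂.cost σ + 1 + (e₁.eval σ).size + (e₂.eval σ).size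
        + (o.eval (e₁.eval σ) (e₂.eval σ)).size

/-- Programs: `x := e`, `a[i] := e`, tossing a fair coin into register `x`, sequencing,
branching and loops (a condition holds if its value is not `0`). -/
inductive Prog where
  | skip
  | assign (x : ℕ) (e : Expr)
  | store (a : ℕ) (i e : Expr)
  | flip (x : ℕ)
  | seq (p q : Prog)
  | ite (e : Expr) (p q : Prog)
  | loop (e : Expr) (p : Prog)

/-- `Exec p σ τ T`: started in `σ`, the program `p` halts in `τ` after time exactly `T`. A program
that tosses more coins than there are does not halt. -/
inductive Exec : Prog → State → State → ℕ → Prop where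
  | skip (σ : State) : Exec .skip σ σ 1
  | assign (σ : State) (x : ℕ) (e : Expr) :
      Exec (.assign x e) σ { σ with var := Function.update σ.var x (e.eval σ) } (e.cost σ + 1)
  | store (σ : State) (a : ℕ) (i e : Expr) :
      Exec (.store a i e) σ
        { σ with
          arr := Function.update σ.arr a
            (Function.update (σ.arr a) (i.eval σ) (e.eval σ)) }
        (i.cost σ + e.cost σ + (i.eval σ).size + 1)
  | flip (v : ℕ → ℕ) (m : ℕ → ℕ → ℕ) (b : Bool) (r : List Bool) (x : ℕ) :
      Exec (.flip x) ⟨v, m, b :: r⟩ ⟨Function.update v x b.toNat, m, r⟩ 1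
  | seq {p q : Prog} {σ τ υ : State} {T U : ℕ} (hp : Exec p σ τ T) (hq : Exec q τ υ U) :
      Exec (.seq p q) σ υ (T + U)
  | iteTrue {e : Expr} {p q : Prog} {σ τ : State} {T : ℕ} (he : e.eval σ ≠ 0)
      (hp : Exec p σ τ T) : Exec (.ite e p q) σ τ (e.cost σ + 1 + T)
  | iteFalse {e : Expr} {p q : Prog} {σ τ : State} {T : ℕ} (he : e.eval σ = 0)
      (hq : Exec q σ τ T) : Exec (.ite e p q) σ τ (e.cost σ + 1 + T)
  | loopTrue {e : Expr} {p : Prog} {σ τ υ : State} {T U : ℕ} (he : e.eval σ ≠ 0)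
      (hp : Exec p σ τ T) (hl : Exec (.loop e p) τ υ U) :
      Exec (.loop e p) σ υ (e.cost σ + 1 + T + U)
  | loopFalse {e : Expr} {p : Prog} {σ : State} (he : e.eval σ = 0) :
      Exec (.loop e p) σ σ (e.cost σ + 1)

/-- The machine is deterministic once the coins are fixed. -/
theorem Exec.det {p : Prog} {σ τ τ' : State} {T T' : ℕ} (h : Exec p σ τ T)
    (h' : Exec p σ τ' T') : τ = τ' ∧ T = T' := by
  induction h generalizing τ' T' with
  | skip | assign | store | flip => cases h'; exact ⟨rfl, rfl⟩
  | seq _ _ ihp ihq =>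
    cases h' with
    | seq hp hq =>
      obtain ⟨rfl, rfl⟩ := ihp hp
      obtain ⟨rfl, rfl⟩ := ihq hq
      exact ⟨rfl, rfl⟩
  | iteTrue he _ ih =>
    cases h' with
    | iteTrue _ hp => obtain ⟨rfl, rfl⟩ := ih hp; exact ⟨rfl, rfl⟩
    | iteFalse he' _ => exact absurd he' he
  | iteFalse he _ ih =>
    cases h' with
    | iteTrue he' _ => exact absurd he he'
    | iteFalse _ hp => obtain ⟨rfl, rfl⟩ := ih hp; exact ⟨rfl, rfl⟩
  | loopTrue he _ _ ihp ihl =>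
    cases h' with
    | loopTrue _ hp hl =>
      obtain ⟨rfl, rfl⟩ := ihp hp
      obtain ⟨rfl, rfl⟩ := ihl hl
      exact ⟨rfl, rfl⟩
    | loopFalse he' => exact absurd he' he
  | loopFalse he =>
    cases h' with
    | loopTrue he' _ _ => exact absurd he he'
    | loopFalse _ => exact ⟨rfl, rfl⟩

/-- One edit operation on a binary string: an insertion, a deletion or a substitution. -/
inductive Edit : List Bool → List Bool → Prop where
  | ins (u v : List Bool) (b : Bool) : Edit (u ++ v) (u ++ b :: v)
  | del (u v : List Bool) (b : Bool) : Edit (u ++ b :: v) (u ++ v)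
  | subst (u v : List Bool) (a b : Bool) : Edit (u ++ a :: v) (u ++ b :: v)

/-- `EditsTo k s t`: some sequence of exactly `k` edit operations converts `s` to `t`. -/
inductive EditsTo : ℕ → List Bool → List Bool → Prop where
  | refl (s : List Bool) : EditsTo 0 s s
  | step {k : ℕ} {s t u : List Bool} (h : Edit s t) (hk : EditsTo k t u) : EditsTo (k + 1) s u

/-- The edit distance: the minimum number of insertions, deletions and substitutions that convert
`s` to `t`. -/
noncomputable def editDist (s t : List Bool) : ℕ := sInf {k | EditsTo k s t}

/-- The minimum is over a nonempty set. -/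
theorem exists_editsTo (s t : List Bool) : ∃ k, EditsTo k s t := by
  have h : ∀ v : List Bool, ∃ k, EditsTo k v t := by
    intro v
    induction v with
    | nil =>
      have hi : ∀ w u : List Bool, w ++ u = t → ∃ k, EditsTo k u t := by
        intro w
        induction w using List.reverseRecOn with
        | nil => rintro u rfl; exact ⟨0, .refl _⟩
        | append_singleton w b ih =>
          intro u hu
          obtain ⟨k, hk⟩ := ih (b :: u) (by simpa using hu)
          exact ⟨k + 1, .step (.ins [] u b) hk⟩
      exact hi t [] (by simp)
    | cons b v ih =>
      obtain ⟨k, hk⟩ := ih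
      exact ⟨k + 1, .step (.del [] v b) hk⟩
  exact h s

/-- The `i`-th symbol of a string as a number; `0` beyond its end. -/
def bitAt (l : List Bool) (i : ℕ) : ℕ := (l.getD i false).toNat

/-- Start of Alice's computation: register `0` holds the length of her string `s`, register `1`
holds `K`, array `0` holds `s`, and everything else is `0`. -/
def aliceInit (s : List Bool) (K : ℕ) (r : List Bool) : State where
  var x := if x = 0 then s.length else if x = 1 then K else 0
  arr a i := if a = 0 then bitAt s i else 0
  coins := r

/-- Start of Bob's computation: register `0` holds the length of his string `t`, register `1`
holds `K`, register `2` holds the length of the message, array `0` holds `t`, array `1` holds the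
message, and everything else is `0`. -/
def bobInit (t : List Bool) (K : ℕ) (msg r : List Bool) : State where
  var x := if x = 0 then t.length else if x = 1 then K else if x = 2 then msg.length else 0
  arr a i := if a = 0 then bitAt t i else if a = 1 then bitAt msg i else 0
  coins := r

/-- With coins `r`, the encoding program `A` computes from `s` and `K` the message `msg` in time
`T`: on halting, register `0` holds the number of bits of the message and array `1` its bits. -/
def Encodes (A : Prog) (s : List Bool) (K : ℕ) (r msg : List Bool) (T : ℕ) : Prop :=
  ∃ τ : State, Exec A (aliceInit s K r) τ T ∧ τ.var 0 = msg.length ∧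
    ∀ i < msg.length, τ.arr 1 i = bitAt msg i

/-- With coins `r`, the decoding program `B` computes from `t`, `K` and `msg` the output `o` in time
`T`. On halting, register `0` is `0` for the output "error" (`none`), and is `1` for the output of
a string `x` as long as `t`, whose bits are then in array `2`. -/
def Decodes (B : Prog) (t : List Bool) (K : ℕ) (msg r : List Bool) (o : Option (List Bool))
    (T : ℕ) : Prop :=
  ∃ τ : State, Exec B (bobInit t K msg r) τ T ∧
    match o with
    | none => τ.var 0 = 0
    | some x => τ.var 0 = 1 ∧ x.length = t.length ∧ ∀ i < t.length, τ.arr 2 i = bitAt x i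

/-- What Bob has to output: Alice's string if the edit distance is at most `K`, and "error"
otherwise. -/
noncomputable def answer (K : ℕ) (s t : List Bool) : Option (List Bool) :=
  if editDist s t ≤ K then some s else none

/-- A run of the protocol in which Alice uses the coins `rA` and Bob the coins `rB` succeeds. -/
def Succeeds (A B : Prog) (K : ℕ) (s t rA rB : List Bool) : Prop :=
  ∃ (msg : List Bool) (T U : ℕ),
    Encodes A s K rA msg T ∧ Decodes B t K msg rB (answer K s t) U

/-- The probability that the protocol succeeds on `(s, t)`, where Alice and Bob have `R`
independent private fair coins each. -/
noncomputable def successProb (A B : Prog) (K R : ℕ) (s t : List Bool) : ℝ :=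
  ({r : (Fin R → Bool) × (Fin R → Bool) |
      Succeeds A B K s t (List.ofFn r.1) (List.ofFn r.2)}.ncard : ℝ) / (2 ^ R * 2 ^ R)

/-- With `R` coins per party, on the inputs `s` and `t`: whatever the coins show, both programs
halt within time `time`, the message has at most `comm` bits, and Bob outputs a string or
"error". -/
def RunsWithin (A B : Prog) (K R : ℕ) (s t : List Bool) (comm time : ℝ) : Prop :=
  ∀ rA : Fin R → Bool, ∃ (msg : List Bool) (T : ℕ),
    Encodes A s K (List.ofFn rA) msg T ∧ (msg.length : ℝ) ≤ comm ∧ (T : ℝ) ≤ time ∧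
    ∀ rB : Fin R → Bool, ∃ (o : Option (List Bool)) (U : ℕ),
      Decodes B t K msg (List.ofFn rB) o U ∧ (U : ℝ) ≤ time

end DocExchange

namespace DocExchange

/-! The protocol is a hierarchy of block hashes in which Alice sends only a few power sums per
level. Pad `s` with zeros to length N = 2^L, where L is the bit length of n, and cut it at every
level j ≤ L into blocks of length 2^j. If the edit distance is at most K, then at every level all
but K blocks occur in `t` at most K positions from their place, because a block that no edit touches
is moved rigidly (`EditsTo.count_unmatched_le`). Bob descends from the single block of level L to
the symbols at level 0 and keeps, for each block, a nearby occurrence in `t` if there is one. The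
halves of a matched block are matched, so the blocks he knows nothing about are halves of unmatched
blocks, at most 2K per level (`count_unknown_le`).

Per level Alice sends 2K + 1 elements of ZMod p: the sums over all blocks i of h_i x_i^r for r ≤ 2K,
where h_i is a `windowHash` of the block and x_i an `indexHash` of its index. The random seeds are
part of the message. Bob computes the terms of the known blocks from `t` and subtracts them. What
remains are power sums of at most 2K unknown hashes with distinct nodes, and applying E_r ↦ E_(r+1)
- x_l E_r for all unknown l ≠ k isolates the k-th hash times a known nonzero product
(`eliminate_all`). He compares it with the hashes of the 2K + 1 nearby windows of `t`. At level 0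
the hash is the symbol itself, so symbols without an occurrence are solved for.

The modulus need only be polynomial in K log n, and this gives the communication bound: about K log
n field elements of O(log K + log log n) bits. The reason is that the comparisons that can mislead
are few and are determined by the two strings, not by the coins: as long as none has misled, Bob's
unknown blocks are the truly unknown ones. `Good` lists these comparisons, `ncard_not_good_mul_le`
is a union bound built on `windowHash_collision` and `indexHash_collision`, and `LevelStep.good` is
the induction over levels.

More than 2K unknown blocks prove that the strings are far apart. Otherwise Bob has recovered `s`,
but must still decide whether the distance is at most K. He computes furthest reaching points on the
2K + 1 middle diagonals for up to K edits (`lt_lv_iff`), finding each slide by descending powers of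
two, with hashes in place of window comparisons. The pairs compared in the exact computation are
again few and fixed by the strings, and agreement on these suffices (`lv_congr`).

For the running time, index hashes take only p values, so blocks are grouped into p buckets before
powers enter; a level's power sums then cost (2K + 1) p steps instead of (2K + 1) N. Every loop is
thus bounded by about N L or by a polynomial in K log n, and the latter is n times a power of log n
once K^c ≤ n. Loop lengths and stored numbers are bounded whatever the hashes do, so time and output
format hold for all coins; only correctness needs `Good`. -/

/-! ### Time and size accounting -/

/-- All registers and array cells hold numbers below `2 ^ W`. -/
def Bdd (W : ℕ) (σ : State) : Prop := (∀ x, σ.var x < 2 ^ W) ∧ ∀ a i, σ.arr a i < 2 ^ W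

/-- `p` takes `σ` to `τ` in time at most `T`. -/
def Runs (p : Prog) (σ τ : State) (T : ℕ) : Prop := ∃ U ≤ T, Exec p σ τ U

/-- In a state with values below `2 ^ W`, the value of `e` is below `2 ^ (W * e.deg)`. -/
def Expr.deg : Expr → ℕ
  | .const c => c + 1
  | .var _ => 1
  | .get _ _ => 1
  | .op _ e₁ e₂ => e₁.deg + e₂.deg

/-- In a state with values below `2 ^ W`, evaluating `e` costs at most `W * e.wt`. -/
def Expr.wt : Expr → ℕ
  | .const c => c + 2
  | .var _ => 2
  | .get _ i => i.wt + i.deg + 2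
  | .op _ e₁ e₂ => e₁.wt + e₂.wt + 1 + 2 * (e₁.deg + e₂.deg)

theorem Expr.deg_pos (e : Expr) : 1 ≤ e.deg := by
  induction e with
  | const c => simp [deg]
  | var x => simp [deg]
  | get a i _ => simp [deg]
  | op o e₁ e₂ h₁ h₂ => simp only [deg]; omega

/-- Multiplication is the worst case: bit lengths add. Both exponents are at least 1, so that 2^a +
2^b ≤ 2^a 2^b covers sums and the value 1 of a comparison fits. -/
theorem BinOp.eval_lt (o : BinOp) {x y a b : ℕ} (ha : 1 ≤ a) (hb : 1 ≤ b) (hx : x < 2 ^ a)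
    (hy : y < 2 ^ b) : o.eval x y < 2 ^ (a + b) := by
  have h1 : 2 ≤ 2 ^ a := by simpa using Nat.pow_le_pow_right (n := 2) (by norm_num) ha
  have h2 : 2 ≤ 2 ^ b := by simpa using Nat.pow_le_pow_right (n := 2) (by norm_num) hb
  have hxa : 2 ^ a ≤ 2 ^ (a + b) := Nat.pow_le_pow_right (by norm_num) (by omega)
  have hyb : 2 ^ b ≤ 2 ^ (a + b) := Nat.pow_le_pow_right (by norm_num) (by omega)
  cases o with
  | add => simp only [eval]; rw [pow_add] at *; nlinarith
  | sub => simp only [eval]; omega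
  | mul =>
    simp only [eval]; rw [pow_add]
    exact Nat.mul_lt_mul'' hx hy
  | div => exact (Nat.div_le_self x y).trans_lt (hx.trans_le hxa)
  | mod => exact (Nat.mod_le x y).trans_lt (hx.trans_le hxa)
  | xor => exact Nat.xor_lt_two_pow (hx.trans_le hxa) (hy.trans_le hyb)
  | eq => simp only [eval]; split <;> omega
  | lt => simp only [eval]; split <;> omega

theorem Expr.eval_lt {W : ℕ} (hW : 1 ≤ W) {σ : State} (h : Bdd W σ) (e : Expr) :
    e.eval σ < 2 ^ (W * e.deg) := by
  induction e with
  | const c =>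
    calc c < 2 ^ c := Nat.lt_two_pow_self
      _ ≤ 2 ^ (W * (c + 1)) := Nat.pow_le_pow_right (by norm_num) (by nlinarith)
  | var x => simpa [deg, eval] using h.1 x
  | get a i _ => simpa [deg, eval] using h.2 a _
  | op o e₁ e₂ h₁ h₂ =>
    simp only [deg, mul_add]
    exact o.eval_lt (Nat.mul_pos hW e₁.deg_pos) (Nat.mul_pos hW e₂.deg_pos) h₁ h₂

theorem Expr.cost_le {W : ℕ} (hW : 1 ≤ W) {σ : State} (h : Bdd W σ) (e : Expr) :
    e.cost σ ≤ W * e.wt := by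
  induction e with
  | const c =>
    have : c.size ≤ c := Nat.size_le.2 Nat.lt_two_pow_self
    simp only [cost, wt]; nlinarith
  | var x =>
    have := Nat.size_le.2 (h.1 x)
    simp only [cost, wt]; omega
  | get a i ih =>
    have h1 := Nat.size_le.2 (Expr.eval_lt hW h i)
    have h2 := Nat.size_le.2 (h.2 a (i.eval σ))
    simp only [cost, wt]
    nlinarith
  | op o e₁ e₂ h₁ h₂ =>
    have h3 := Nat.size_le.2 (Expr.eval_lt hW h e₁)
    have h4 := Nat.size_le.2 (Expr.eval_lt hW h e₂)
    have h5 := Nat.size_le.2 (Expr.eval_lt hW h (.op o e₁ e₂))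
    simp only [cost, wt, deg, eval] at *
    nlinarith

theorem Runs.mono {p : Prog} {σ τ : State} {T T' : ℕ} (h : Runs p σ τ T) (hT : T ≤ T') :
    Runs p σ τ T' := let ⟨U, hU, e⟩ := h; ⟨U, hU.trans hT, e⟩

theorem Runs.seq {p q : Prog} {σ τ υ : State} {T U : ℕ} (hp : Runs p σ τ T)
    (hq : Runs q τ υ U) : Runs (.seq p q) σ υ (T + U) :=
  let ⟨_, h₁, e₁⟩ := hp; let ⟨_, h₂, e₂⟩ := hq; ⟨_, Nat.add_le_add h₁ h₂, .seq e₁ e₂⟩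

/-- The state after `x := k`. -/
def State.setVar (σ : State) (x k : ℕ) : State := { σ with var := Function.update σ.var x k }

/-- The state with array `a` replaced by `h`. -/
def State.setArr (σ : State) (a : ℕ) (h : ℕ → ℕ) : State :=
  { σ with arr := Function.update σ.arr a h }

@[simp] theorem State.setVar_var (σ : State) (x k y : ℕ) :
    (σ.setVar x k).var y = if y = x then k else σ.var y := by
  simp [State.setVar, Function.update_apply]

@[simp] theorem State.setVar_arr (σ : State) (x k : ℕ) : (σ.setVar x k).arr = σ.arr := rfl

@[simp] theorem State.setVar_coins (σ : State) (x k : ℕ) : (σ.setVar x k).coins = σ.coins := rfl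

@[simp] theorem State.setArr_arr (σ : State) (a : ℕ) (h : ℕ → ℕ) (b : ℕ) :
    (σ.setArr a h).arr b = if b = a then h else σ.arr b := by
  simp [State.setArr, Function.update_apply]

@[simp] theorem State.setArr_var (σ : State) (a : ℕ) (h : ℕ → ℕ) :
    (σ.setArr a h).var = σ.var := rfl

theorem Bdd.setVar {W : ℕ} {σ : State} (h : Bdd W σ) {x k : ℕ} (hk : k < 2 ^ W) :
    Bdd W (σ.setVar x k) := by
  refine ⟨fun y => ?_, h.2⟩
  rw [State.setVar_var]; split
  · exact hk
  · exact h.1 y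

theorem Bdd.setArr {W : ℕ} {σ : State} (h : Bdd W σ) {a : ℕ} {f : ℕ → ℕ}
    (hf : ∀ i, f i < 2 ^ W) : Bdd W (σ.setArr a f) := by
  refine ⟨h.1, fun b i => ?_⟩
  rw [State.setArr_arr]; split
  · exact hf i
  · exact h.2 b i

theorem Runs.assign {W : ℕ} (hW : 1 ≤ W) {σ : State} (h : Bdd W σ) (x : ℕ) (e : Expr) :
    Runs (.assign x e) σ (σ.setVar x (e.eval σ)) (W * (e.wt + 1)) :=
  ⟨_, by have := e.cost_le hW h; nlinarith, .assign σ x e⟩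

theorem Runs.store {W : ℕ} (hW : 1 ≤ W) {σ : State} (h : Bdd W σ) (a : ℕ) (i e : Expr) :
    Runs (.store a i e) σ (σ.setArr a (Function.update (σ.arr a) (i.eval σ) (e.eval σ)))
      (W * (i.wt + e.wt + i.deg + 1)) := by
  refine ⟨_, ?_, .store σ a i e⟩
  have h1 := i.cost_le hW h
  have h2 := e.cost_le hW h
  have h3 := Nat.size_le.2 (Expr.eval_lt hW h i)
  nlinarith

/-- Total correctness of loops with a decreasing measure. -/
theorem Runs.loop {W : ℕ} (hW : 1 ≤ W) {e : Expr} {p : Prog} {t : ℕ} (Inv : State → Prop)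
    (μ : State → ℕ) (hB : ∀ σ, Inv σ → Bdd W σ)
    (hstep : ∀ σ, Inv σ → e.eval σ ≠ 0 → ∃ τ, Runs p σ τ t ∧ Inv τ ∧ μ τ < μ σ)
    (σ : State) (hσ : Inv σ) :
    ∃ τ, Runs (.loop e p) σ τ ((μ σ + 1) * (W * (e.wt + 1) + t)) ∧ Inv τ ∧ e.eval τ = 0 := by
  induction hm : μ σ using Nat.strong_induction_on generalizing σ with
  | _ m ih =>
    have hc := e.cost_le hW (hB σ hσ)
    by_cases he : e.eval σ = 0
    · exact ⟨σ, ⟨_, by nlinarith [Nat.zero_le (m * (W * (e.wt + 1) + t))], .loopFalse he⟩, hσ, he⟩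
    · obtain ⟨τ, ⟨T, hT, hp⟩, hτ, hlt⟩ := hstep σ hσ he
      obtain ⟨υ, ⟨U, hU, hl⟩, hυ, h0⟩ := ih (μ τ) (hm ▸ hlt) τ hτ rfl
      refine ⟨υ, ⟨_, ?_, .loopTrue he hp hl⟩, hυ, h0⟩
      have : (μ τ + 1) * (W * (e.wt + 1) + t) ≤ m * (W * (e.wt + 1) + t) :=
        Nat.mul_le_mul_right _ (by omega)
      nlinarith

/-! ### Expression notation -/

instance : Add Expr := ⟨.op .add⟩
instance : Sub Expr := ⟨.op .sub⟩
instance : Mul Expr := ⟨.op .mul⟩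
instance : Div Expr := ⟨.op .div⟩
instance : Mod Expr := ⟨.op .mod⟩
instance (n : ℕ) : OfNat Expr n := ⟨.const n⟩

/-- The value `1` if the two values agree, else `0`. -/
def Expr.eqE (a b : Expr) : Expr := .op .eq a b

/-- The value `1` if the first value is smaller, else `0`. -/
def Expr.ltE (a b : Expr) : Expr := .op .lt a b

/-- The value of `x` if `c` has value `1`, and of `y` if `c` has value `0`. -/
def Expr.sel (c x y : Expr) : Expr := c * x + (1 - c) * y

namespace Expr

variable (σ : State) (a b c : Expr)

@[simp] theorem eval_ofNat (k : ℕ) : (ofNat(k) : Expr).eval σ = OfNat.ofNat k := rfl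
@[simp] theorem eval_var (x : ℕ) : (Expr.var x).eval σ = σ.var x := rfl
@[simp] theorem eval_get (k : ℕ) : (Expr.get k a).eval σ = σ.arr k (a.eval σ) := rfl
@[simp] theorem eval_add : (a + b).eval σ = a.eval σ + b.eval σ := rfl
@[simp] theorem eval_sub : (a - b).eval σ = a.eval σ - b.eval σ := rfl
@[simp] theorem eval_mul : (a * b).eval σ = a.eval σ * b.eval σ := rfl
@[simp] theorem eval_div : (a / b).eval σ = a.eval σ / b.eval σ := rfl
@[simp] theorem eval_mod : (a % b).eval σ = a.eval σ % b.eval σ := rfl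
@[simp] theorem eval_eqE : (a.eqE b).eval σ = if a.eval σ = b.eval σ then 1 else 0 := rfl
@[simp] theorem eval_ltE : (a.ltE b).eval σ = if a.eval σ < b.eval σ then 1 else 0 := rfl

end Expr

-- The machine's expressions have no conditional; selection and conjunction are done by arithmetic
-- with 0 and 1. This rule and the next turn that arithmetic back into `if`.
@[simp] theorem sel_arith {P : Prop} [Decidable P] (x y : ℕ) :
    (if P then 1 else 0) * x + (1 - if P then 1 else 0) * y = if P then x else y := by
  split <;> simp

@[simp] theorem ite_mul_ite_one {P Q : Prop} [Decidable P] [Decidable Q] :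
    ((if P then 1 else 0) * (if Q then 1 else 0) : ℕ) = if P ∧ Q then 1 else 0 := by
  split <;> split <;> simp_all

/-! ### Scans -/

/-- The state in the `k`-th round of a scan that has filled array `a` with `h`. -/
def scanSt (σ : State) (a k : ℕ) (h : ℕ → ℕ) : State := (σ.setVar 9 k).setArr a h

@[simp] theorem scanSt_var (σ : State) (a k : ℕ) (h : ℕ → ℕ) (y : ℕ) :
    (scanSt σ a k h).var y = if y = 9 then k else σ.var y := by simp [scanSt]

@[simp] theorem scanSt_arr (σ : State) (a k : ℕ) (h : ℕ → ℕ) (b : ℕ) :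
    (scanSt σ a k h).arr b = if b = a then h else σ.arr b := by simp [scanSt]

/-- The contents of array `a` after `k` rounds of a scan. -/
def scanF (σ : State) (a : ℕ) (I E : Expr) : ℕ → ℕ → ℕ
  | 0 => σ.arr a
  | k + 1 => Function.update (scanF σ a I E k) (I.eval (scanSt σ a k (scanF σ a I E k)))
      (E.eval (scanSt σ a k (scanF σ a I E k)))

/-- `for c < bnd do a[I] := E`, where `c` is register `9`. -/
def scan (bnd : Expr) (a : ℕ) (I E : Expr) : Prog :=
  .seq (.assign 9 0) (.loop ((Expr.var 9).ltE bnd) (.seq (.store a I E) (.assign 9 (.var 9 + 1))))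

/-- The time of one round of a scan, in units of the word length. -/
def scanWt (bnd I E : Expr) : ℕ := bnd.wt + 2 * bnd.deg + I.wt + E.wt + I.deg + 40

/-- The bound on the written values is demanded for arbitrary contents of the array being filled, so
it can be checked without knowing what the earlier rounds wrote. The loop bound must be unaffected
by the counter and by that array. -/
theorem scan_runs {W : ℕ} (hW : 1 ≤ W) {σ : State} (hσ : Bdd W σ) {bnd I E : Expr} {a b : ℕ}
    (hb : ∀ k h, bnd.eval (scanSt σ a k h) = b) (hbW : b < 2 ^ W)
    (hE : ∀ k h, k < b → E.eval (scanSt σ a k h) < 2 ^ W) :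
    Runs (scan bnd a I E) σ (scanSt σ a b (scanF σ a I E b)) ((b + 1) * (W * scanWt bnd I E)) ∧
      Bdd W (scanSt σ a b (scanF σ a I E b)) := by
  have hF : ∀ k ≤ b, ∀ i, scanF σ a I E k i < 2 ^ W := by
    intro k
    induction k with
    | zero => intro _ i; exact hσ.2 a i
    | succ k ih =>
      intro hk i
      rw [scanF, Function.update_apply]
      split
      · exact hE k _ (by omega)
      · exact ih (by omega) i
  have hS : ∀ k ≤ b, Bdd W (scanSt σ a k (scanF σ a I E k)) := fun k hk =>
    (hσ.setVar (hk.trans_lt hbW)).setArr (hF k hk)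
  refine ⟨?_, hS b le_rfl⟩
  have hs0 : scanSt σ a 0 (scanF σ a I E 0) = σ.setVar 9 0 := by
    simp [scanSt, scanF, State.setArr, State.setVar]
  -- Induction on the number `j` of rounds still to come, since a loop execution unfolds from its
  -- front.
  have key : ∀ j ≤ b, Runs (.loop ((Expr.var 9).ltE bnd)
      (.seq (.store a I E) (.assign 9 (.var 9 + 1)))) (scanSt σ a (b - j) (scanF σ a I E (b - j)))
      (scanSt σ a b (scanF σ a I E b))
      (j * (W * (bnd.wt + 2 * bnd.deg + I.wt + E.wt + I.deg + 20)) +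
        W * (bnd.wt + 2 * bnd.deg + 6)) := by
    intro j
    induction j with
    | zero =>
      intro _
      have hc := ((Expr.var 9).ltE bnd).cost_le hW (hS b le_rfl)
      refine ⟨_, ?_, .loopFalse ?_⟩
      · simp only [Expr.ltE, Expr.wt, Expr.deg, Nat.sub_zero] at hc ⊢
        nlinarith
      · simp [hb]
    | succ j ih =>
      intro hj
      obtain ⟨U, hU, hl⟩ := ih (by omega)
      have hB := hS (b - (j + 1)) (by omega)
      set s := scanSt σ a (b - (j + 1)) (scanF σ a I E (b - (j + 1))) with hs
      have hc := ((Expr.var 9).ltE bnd).cost_le hW hB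
      obtain ⟨T₁, hT₁, h₁⟩ := Runs.store hW hB a I E
      have hB' : Bdd W (s.setArr a (Function.update (s.arr a) (I.eval s) (E.eval s))) := by
        refine hB.setArr fun i => ?_
        rw [Function.update_apply]; split
        · exact hE _ _ (by omega)
        · exact hB.2 a i
      obtain ⟨T₂, hT₂, h₂⟩ := Runs.assign hW hB' 9 (.var 9 + 1)
      have he : (s.setArr a (Function.update (s.arr a) (I.eval s) (E.eval s))).setVar 9
          ((Expr.var 9 + 1).eval (s.setArr a (Function.update (s.arr a) (I.eval s) (E.eval s))))
          = scanSt σ a (b - j) (scanF σ a I E (b - j)) := by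
        have e1 : b - j = b - (j + 1) + 1 := by omega
        rw [e1, scanF, ← hs]
        simp [hs, scanSt, State.setArr, State.setVar]
      rw [he] at h₂
      refine ⟨_, ?_, .loopTrue ?_ (.seq h₁ h₂) hl⟩
      · have hw : (Expr.var 9 + 1 : Expr).wt = 12 := rfl
        have hw' : ((Expr.var 9).ltE bnd).wt = 2 + bnd.wt + 1 + 2 * (1 + bnd.deg) := rfl
        rw [hw] at hT₂
        rw [hw'] at hc
        nlinarith
      · simp [hs, hb]; omega
  obtain ⟨U, hU, h⟩ := key b le_rfl
  rw [Nat.sub_self, hs0] at h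
  obtain ⟨T, hT, h₀⟩ := Runs.assign hW hσ 9 0
  refine ⟨_, ?_, .seq h₀ h⟩
  have hw : (0 : Expr).wt = 2 := rfl
  rw [hw] at hT
  simp only [scanWt]
  nlinarith [Nat.zero_le (b * W)]

/-- A scan that writes consecutive cells. -/
theorem scanF_fill {σ : State} {a : ℕ} {I E : Expr} {b o : ℕ}
    (hI : ∀ k h, k < b → I.eval (scanSt σ a k h) = o + k) :
    (∀ y, (∀ k < b, y ≠ o + k) → scanF σ a I E b y = σ.arr a y) ∧
    ∀ k < b, ∃ h : ℕ → ℕ, (∀ y < o + k, h y = scanF σ a I E b y) ∧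
      (∀ y, o + k ≤ y → h y = σ.arr a y) ∧
      scanF σ a I E b (o + k) = E.eval (scanSt σ a k h) := by
  induction b with
  | zero => exact ⟨fun _ _ => rfl, fun k hk => absurd hk (by omega)⟩
  | succ b ih =>
    obtain ⟨ih1, ih2⟩ := ih fun k h hk => hI k h (by omega)
    have hstep : ∀ y, scanF σ a I E (b + 1) y =
        if y = o + b then E.eval (scanSt σ a b (scanF σ a I E b)) else scanF σ a I E b y := by
      intro y
      rw [scanF, Function.update_apply, hI b _ (by omega)]
    refine ⟨fun y hy => ?_, fun k hk => ?_⟩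
    · rw [hstep, if_neg (hy b (by omega)), ih1 y fun k hk => hy k (by omega)]
    · rcases Nat.lt_succ_iff_lt_or_eq.1 hk with hk | rfl
      · obtain ⟨h, h1, h2, h3⟩ := ih2 k hk
        refine ⟨h, fun y hy => ?_, h2, ?_⟩
        · rw [h1 y hy, hstep, if_neg (by omega)]
        · rw [hstep, if_neg (by omega), h3]
      -- The witness is the array at the moment of the write: already final below the written cell,
      -- still initial from there on.
      · refine ⟨scanF σ a I E k, fun y hy => ?_, fun y hy => ?_, ?_⟩
        · rw [hstep, if_neg (by omega)]
        · exact ih1 y fun j hj => by omega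
        · rw [hstep, if_pos rfl]

/-- A scan that adds numbers modulo `p` to computed cells. -/
theorem scanF_acc {σ : State} {a : ℕ} {I E : Expr} {b p : ℕ} (hp : 0 < p) (ι v : ℕ → ℕ)
    (hI : ∀ k h, k < b → I.eval (scanSt σ a k h) = ι k)
    (hE : ∀ k h, k < b → E.eval (scanSt σ a k h) = (h (ι k) + v k) % p) (y : ℕ)
    (hy : σ.arr a y < p) :
    scanF σ a I E b y < p ∧ (scanF σ a I E b y : ZMod p) =
      σ.arr a y + ∑ k ∈ Finset.range b, if ι k = y then (v k : ZMod p) else 0 := by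
  induction b with
  | zero => exact ⟨hy, by simp [scanF]⟩
  | succ b ih =>
    obtain ⟨h1, h2⟩ := ih (fun k h hk => hI k h (by omega)) fun k h hk => hE k h (by omega)
    rw [scanF, Function.update_apply, hI b _ (by omega), hE b _ (by omega), Finset.sum_range_succ,
      ← add_assoc, ← h2]
    by_cases hb : y = ι b
    · subst hb
      simp [Nat.mod_lt _ hp]
    · rw [if_neg hb, if_neg (Ne.symm hb)]
      exact ⟨h1, by simp⟩

/-- The last write to a cell wins. -/
theorem scanF_last {σ : State} {a : ℕ} {I E : Expr} {b : ℕ} (ι v : ℕ → ℕ)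
    (hI : ∀ k h, k < b → I.eval (scanSt σ a k h) = ι k)
    (hE : ∀ k h, k < b → E.eval (scanSt σ a k h) = v k) {i : ℕ} (hi : i < b)
    (hl : ∀ k, i < k → k < b → ι k ≠ ι i) : scanF σ a I E b (ι i) = v i := by
  induction b with
  | zero => omega
  | succ b ih =>
    rw [scanF, Function.update_apply, hI b _ (by omega), hE b _ (by omega)]
    rcases Nat.lt_succ_iff_lt_or_eq.1 hi with hi | rfl
    · rw [if_neg (hl b hi (by omega)).symm]
      exact ih (fun k h hk => hI k h (by omega)) (fun k h hk => hE k h (by omega)) hi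
        fun k h1 h2 => hl k h1 (by omega)
    · simp

/-! ### Edit distance -/

theorem bitAt_append_left (u v : List Bool) {i : ℕ} (h : i < u.length) :
    bitAt (u ++ v) i = bitAt u i := by
  simp [bitAt, List.getElem?_append_left h]

theorem bitAt_append_right (u v : List Bool) {i : ℕ} (h : u.length ≤ i) :
    bitAt (u ++ v) i = bitAt v (i - u.length) := by
  simp [bitAt, List.getElem?_append_right h]

theorem bitAt_cons_succ (b : Bool) (v : List Bool) (i : ℕ) : bitAt (b :: v) (i + 1) = bitAt v i := by
  simp [bitAt]

theorem bitAt_append_cons_right (u v : List Bool) (b : Bool) {i : ℕ} (h : u.length ≤ i) :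
    bitAt (u ++ b :: v) (i + 1) = bitAt (u ++ v) i := by
  rw [bitAt_append_right _ _ h, bitAt_append_right _ _ (by omega), Nat.sub_add_comm h,
    bitAt_cons_succ]

theorem bitAt_append_cons_ne (u v : List Bool) (a b : Bool) {i : ℕ} (h : i ≠ u.length) :
    bitAt (u ++ a :: v) i = bitAt (u ++ b :: v) i := by
  rcases lt_or_gt_of_ne h with h | h
  · rw [bitAt_append_left _ _ h, bitAt_append_left _ _ h]
  · obtain ⟨i, rfl⟩ : ∃ k, i = k + 1 := ⟨i - 1, by omega⟩
    rw [bitAt_append_cons_right _ _ _ (by omega), bitAt_append_cons_right _ _ _ (by omega)]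

theorem bitAt_le_one (l : List Bool) (i : ℕ) : bitAt l i ≤ 1 := by
  unfold bitAt; cases l.getD i false <;> simp

theorem bitAt_eq_zero {l : List Bool} {i : ℕ} (h : l.length ≤ i) : bitAt l i = 0 := by
  simp [bitAt, List.getElem?_eq_none h]

/-- Off the points of `X`, intervals of `S` reappear in `T`, shifted by at most `k`. -/
def ShiftedOff (S T : ℕ → ℕ) (k : ℕ) (X : Finset ℕ) : Prop :=
  ∀ a b, a < b → (∀ x ∈ X, a ≤ x → x < b → False) →
    ∃ δ : ℤ, |δ| ≤ k ∧ ∀ x, a ≤ x → x < b → ∃ y : ℕ, (y : ℤ) = x + δ ∧ S x = T y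

/-- One edit at position |u| splits the string there. An interval that avoids |u| lies entirely
before or entirely after it, so the edit moves it rigidly by at most one. The bad points of the
remaining edits are pulled back through the edit and |u| is added to them. -/
theorem EditsTo.shiftedOff {k : ℕ} {s t : List Bool} (h : EditsTo k s t) :
    ∃ X : Finset ℕ, X.card ≤ k ∧ ShiftedOff (bitAt s) (bitAt t) k X := by
  induction h with
  | refl s => exact ⟨∅, by simp, fun a b _ _ => ⟨0, by simp, fun x _ _ => ⟨x, by simp, rfl⟩⟩⟩
  | @step k s u t h _ ih =>
    obtain ⟨X, hX, hS⟩ := ih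
    cases h with
    | ins u v c =>
      refine ⟨insert u.length (X.image fun y => if y < u.length then y else y - 1),
        (Finset.card_insert_le _ _).trans (Nat.succ_le_succ (Finset.card_image_le.trans hX)),
        fun a b hab hav => ?_⟩
      have hav' : ∀ y ∈ X, a ≤ (if y < u.length then y else y - 1) →
          (if y < u.length then y else y - 1) < b → False := fun y hy =>
        hav _ (Finset.mem_insert_of_mem (Finset.mem_image_of_mem _ hy))
      have hp := hav _ (Finset.mem_insert_self _ _)
      by_cases hb : b ≤ u.length
      · obtain ⟨δ, hδ, hm⟩ := hS a b hab fun y hy h1 h2 => by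
          have := hav' y hy; rw [if_pos (by omega)] at this; exact this h1 h2
        refine ⟨δ, hδ.trans (by simp), fun x h1 h2 => ?_⟩
        obtain ⟨y, hy, e⟩ := hm x h1 h2
        refine ⟨y, hy, ?_⟩
        rw [← e, bitAt_append_left _ _ (by omega), bitAt_append_left _ _ (by omega)]
      · have ha : u.length < a := by by_contra hc; exact hp (by omega) (by omega)
        obtain ⟨δ, hδ, hm⟩ := hS (a + 1) (b + 1) (by omega) fun y hy h1 h2 => by
          have := hav' y hy; rw [if_neg (by omega)] at this; exact this (by omega) (by omega)
        refine ⟨δ + 1, (abs_add_le _ _).trans (by push_cast; simpa using hδ), fun x h1 h2 => ?_⟩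
        obtain ⟨y, hy, e⟩ := hm (x + 1) (by omega) (by omega)
        refine ⟨y, by push_cast at hy; omega, ?_⟩
        rw [← e, bitAt_append_cons_right _ _ _ (by omega)]
    | del u v c =>
      refine ⟨insert u.length (X.image fun y => if y < u.length then y else y + 1),
        (Finset.card_insert_le _ _).trans (Nat.succ_le_succ (Finset.card_image_le.trans hX)),
        fun a b hab hav => ?_⟩
      have hav' : ∀ y ∈ X, a ≤ (if y < u.length then y else y + 1) →
          (if y < u.length then y else y + 1) < b → False := fun y hy =>
        hav _ (Finset.mem_insert_of_mem (Finset.mem_image_of_mem _ hy))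
      have hp := hav _ (Finset.mem_insert_self _ _)
      by_cases hb : b ≤ u.length
      · obtain ⟨δ, hδ, hm⟩ := hS a b hab fun y hy h1 h2 => by
          have := hav' y hy; rw [if_pos (by omega)] at this; exact this h1 h2
        refine ⟨δ, hδ.trans (by simp), fun x h1 h2 => ?_⟩
        obtain ⟨y, hy, e⟩ := hm x h1 h2
        refine ⟨y, hy, ?_⟩
        rw [← e, bitAt_append_left _ _ (by omega), bitAt_append_left _ _ (by omega)]
      · have ha : u.length < a := by by_contra hc; exact hp (by omega) (by omega)
        obtain ⟨δ, hδ, hm⟩ := hS (a - 1) (b - 1) (by omega) fun y hy h1 h2 => by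
          have := hav' y hy; rw [if_neg (by omega)] at this; exact this (by omega) (by omega)
        refine ⟨δ - 1, (abs_sub _ _).trans (by push_cast; simpa using hδ), fun x h1 h2 => ?_⟩
        obtain ⟨x, rfl⟩ : ∃ z, x = z + 1 := ⟨x - 1, by omega⟩
        obtain ⟨y, hy, e⟩ := hm x (by omega) (by omega)
        refine ⟨y, by push_cast; omega, ?_⟩
        rw [← e, bitAt_append_cons_right _ _ _ (by omega)]
    | subst u v c c' =>
      refine ⟨insert u.length X, (Finset.card_insert_le _ _).trans (by omega),
        fun a b hab hav => ?_⟩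
      obtain ⟨δ, hδ, hm⟩ := hS a b hab fun y hy => hav y (Finset.mem_insert_of_mem hy)
      refine ⟨δ, hδ.trans (by simp), fun x h1 h2 => ?_⟩
      obtain ⟨y, hy, e⟩ := hm x h1 h2
      refine ⟨y, hy, ?_⟩
      rw [← e]
      refine bitAt_append_cons_ne _ _ _ _ fun hx => ?_
      exact hav _ (Finset.mem_insert_self _ _) (by omega) (by omega)

/-- Paths in the edit graph with diagonal edges where `m` holds; the last index is the cost. -/
inductive Grid (m : ℕ → ℕ → Prop) : ℕ → ℕ → ℕ → Prop
  | nil : Grid m 0 0 0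
  | mat {i j e : ℕ} : Grid m i j e → m i j → Grid m (i + 1) (j + 1) e
  | sub {i j e : ℕ} : Grid m i j e → Grid m (i + 1) (j + 1) (e + 1)
  | del {i j e : ℕ} : Grid m i j e → Grid m (i + 1) j (e + 1)
  | ins {i j e : ℕ} : Grid m i j e → Grid m i (j + 1) (e + 1)

/-- Position `i` of `s` and position `j` of `t` exist and carry the same symbol. -/
def SameAt (s t : List Bool) (i j : ℕ) : Prop :=
  i < s.length ∧ j < t.length ∧ bitAt s i = bitAt t j

theorem Grid.prefix {m m' : ℕ → ℕ → Prop} {p : ℕ} (hm : ∀ i j, i < p → m i j → m' i j)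
    {i j e : ℕ} (h : Grid m i j e) (hi : i ≤ p) : Grid m' i j e := by
  induction h with
  | nil => exact .nil
  | mat _ h ih => exact .mat (ih (by omega)) (hm _ _ (by omega) h)
  | sub _ ih => exact .sub (ih (by omega))
  | del _ ih => exact .del (ih (by omega))
  | ins _ ih => exact .ins (ih (by omega))

/-- A path for the edited string becomes a path for the original at the price of one more edit: an
inserted row is contracted, a deleted row is crossed by a deletion, and a match in the row of a
substitution becomes a substitution step. -/
theorem Edit.grid {s u t : List Bool} (h : Edit s u) {e : ℕ}
    (hg : Grid (SameAt u t) u.length t.length e) :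
    ∃ e' ≤ e + 1, Grid (SameAt s t) s.length t.length e' := by
  cases h with
  | ins a v c =>
    have hpre : ∀ i j, i < a.length → SameAt (a ++ c :: v) t i j → SameAt (a ++ v) t i j := by
      rintro i j hi ⟨_, h2, h3⟩
      refine ⟨by simp; omega, h2, ?_⟩
      rw [← h3, bitAt_append_left _ _ hi, bitAt_append_left _ _ hi]
    have key : ∀ {i j e}, Grid (SameAt (a ++ c :: v) t) i j e → a.length + 1 ≤ i →
        ∃ e' ≤ e + 1, Grid (SameAt (a ++ v) t) (i - 1) j e' := by
      intro i j e hg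
      induction hg with
      | nil => omega
      | @mat i j e hg hm ih =>
        intro hi
        rcases Nat.lt_or_ge a.length i with h | h
        · obtain ⟨e', he, hg'⟩ := ih h
          refine ⟨e', he, ?_⟩
          obtain ⟨i, rfl⟩ : ∃ k, i = k + 1 := ⟨i - 1, by omega⟩
          refine .mat hg' ⟨?_, hm.2.1, ?_⟩
          · have := hm.1; simp at this ⊢; omega
          · rw [← hm.2.2, bitAt_append_cons_right _ _ _ (by omega)]
        -- The path leaves the row of the inserted symbol here. With that row contracted, the
        -- diagonal step becomes a horizontal one.
        · exact ⟨e + 1, le_rfl, .ins (hg.prefix hpre h)⟩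
      | @sub i j e hg ih =>
        intro hi
        rcases Nat.lt_or_ge a.length i with h | h
        · obtain ⟨e', he, hg'⟩ := ih h
          obtain ⟨i, rfl⟩ : ∃ k, i = k + 1 := ⟨i - 1, by omega⟩
          exact ⟨e' + 1, by omega, .sub hg'⟩
        · exact ⟨e + 1, by omega, .ins (hg.prefix hpre h)⟩
      | @del i j e hg ih =>
        intro hi
        rcases Nat.lt_or_ge a.length i with h | h
        · obtain ⟨e', he, hg'⟩ := ih h
          obtain ⟨i, rfl⟩ : ∃ k, i = k + 1 := ⟨i - 1, by omega⟩
          exact ⟨e' + 1, by omega, .del hg'⟩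
        · exact ⟨e, by omega, hg.prefix hpre h⟩
      | @ins i j e hg ih =>
        intro hi
        obtain ⟨e', he, hg'⟩ := ih hi
        exact ⟨e' + 1, by omega, .ins hg'⟩
    obtain ⟨e', he, h⟩ := key hg (by simp)
    exact ⟨e', he, by simpa using h⟩
  | del a v c =>
    have hpre : ∀ i j, i < a.length → SameAt (a ++ v) t i j → SameAt (a ++ c :: v) t i j := by
      rintro i j hi ⟨_, h2, h3⟩
      refine ⟨by simp; omega, h2, ?_⟩
      rw [← h3, bitAt_append_left _ _ hi, bitAt_append_left _ _ hi]
    have key : ∀ {i j e}, Grid (SameAt (a ++ v) t) i j e → a.length ≤ i →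
        ∃ e' ≤ e + 1, Grid (SameAt (a ++ c :: v) t) (i + 1) j e' := by
      intro i j e hg
      induction hg with
      | nil =>
        intro hi
        exact ⟨1, le_rfl, .del .nil⟩
      | @mat i j e hg hm ih =>
        intro hi
        rcases Nat.lt_or_ge i a.length with h | h
        -- The path has just arrived at row |a|; the extra row of the deleted symbol is crossed by a
        -- deletion.
        · exact ⟨e + 1, le_rfl, .del ((hg.mat hm).prefix hpre h)⟩
        · obtain ⟨e', he, hg'⟩ := ih h
          refine ⟨e', he, .mat hg' ⟨?_, hm.2.1, ?_⟩⟩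
          · have := hm.1; simp at this ⊢; omega
          · rw [← hm.2.2, bitAt_append_cons_right _ _ _ (by omega)]
      | @sub i j e hg ih =>
        intro hi
        rcases Nat.lt_or_ge i a.length with h | h
        · exact ⟨e + 1 + 1, le_rfl, .del (hg.sub.prefix hpre h)⟩
        · obtain ⟨e', he, hg'⟩ := ih h
          exact ⟨e' + 1, by omega, .sub hg'⟩
      | @del i j e hg ih =>
        intro hi
        rcases Nat.lt_or_ge i a.length with h | h
        · exact ⟨e + 1 + 1, le_rfl, .del (hg.del.prefix hpre h)⟩
        · obtain ⟨e', he, hg'⟩ := ih h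
          exact ⟨e' + 1, by omega, .del hg'⟩
      | @ins i j e hg ih =>
        intro hi
        obtain ⟨e', he, hg'⟩ := ih hi
        exact ⟨e' + 1, by omega, .ins hg'⟩
    obtain ⟨e', he, h⟩ := key hg (by simp)
    exact ⟨e', he, by simpa [add_assoc] using h⟩
  | subst a v c c' =>
    -- The extra edit is charged only after row |a| has been passed, so the match in that row is
    -- paid for once.
    have key : ∀ {i j e}, Grid (SameAt (a ++ c' :: v) t) i j e →
        ∃ e', e' ≤ e + (if a.length < i then 1 else 0) ∧
          Grid (SameAt (a ++ c :: v) t) i j e' := by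
      intro i j e hg
      induction hg with
      | nil => exact ⟨0, by simp, .nil⟩
      | @mat i j e hg hm ih =>
        obtain ⟨e', he, hg'⟩ := ih
        by_cases hi : i = a.length
        · subst hi
          exact ⟨e' + 1, by simp at he ⊢; omega, .sub hg'⟩
        · refine ⟨e', he.trans (by split <;> split <;> omega), .mat hg' ⟨?_, hm.2.1, ?_⟩⟩
          · have := hm.1; simp at this ⊢; omega
          · rw [← hm.2.2, bitAt_append_cons_ne _ _ _ _ hi]
      | @sub i j e hg ih =>
        obtain ⟨e', he, hg'⟩ := ih
        exact ⟨e' + 1, by split at he <;> split <;> omega, .sub hg'⟩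
      | @del i j e hg ih =>
        obtain ⟨e', he, hg'⟩ := ih
        exact ⟨e' + 1, by split at he <;> split <;> omega, .del hg'⟩
      | @ins i j e hg ih =>
        obtain ⟨e', he, hg'⟩ := ih
        exact ⟨e' + 1, by omega, .ins hg'⟩
    obtain ⟨e', he, h⟩ := key hg
    exact ⟨e', by split at he <;> omega, by simpa using h⟩

theorem EditsTo.grid {k : ℕ} {s t : List Bool} (h : EditsTo k s t) :
    ∃ e ≤ k, Grid (SameAt s t) s.length t.length e := by
  induction h with
  | refl s =>
    have : ∀ i ≤ s.length, Grid (SameAt s s) i i 0 := by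
      intro i
      induction i with
      | zero => exact fun _ => .nil
      | succ i ih => exact fun hi => .mat (ih (by omega)) ⟨hi, hi, rfl⟩
    exact ⟨0, le_rfl, this _ le_rfl⟩
  | step h _ ih =>
    obtain ⟨e, he, hg⟩ := ih
    obtain ⟨e', he', hg'⟩ := h.grid hg
    exact ⟨e', by omega, hg'⟩

theorem EditsTo.snoc {k : ℕ} {s t u : List Bool} (h : EditsTo k s t) (h' : Edit t u) :
    EditsTo (k + 1) s u := by
  induction h with
  | refl s => exact .step h' (.refl _)
  | step h _ ih => exact .step h (ih h')

theorem EditsTo.append {k : ℕ} {s t : List Bool} (h : EditsTo k s t) (z : List Bool) :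
    EditsTo k (s ++ z) (t ++ z) := by
  induction h with
  | refl s => exact .refl _
  | step h _ ih =>
    refine .step ?_ ih
    cases h with
    | ins u v b => simpa using Edit.ins u (v ++ z) b
    | del u v b => simpa using Edit.del u (v ++ z) b
    | subst u v a b => simpa using Edit.subst u (v ++ z) a b

/-- Each step of the path acts at the end of the prefixes: a match appends a common symbol to both,
every other step is one final edit after the edits obtained so far. -/
theorem Grid.editsTo {s t : List Bool} {i j e : ℕ} (h : Grid (SameAt s t) i j e)
    (hi : i ≤ s.length) (hj : j ≤ t.length) : EditsTo e (s.take i) (t.take j) := by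
  have hs : ∀ (s : List Bool) (i : ℕ) (h : i + 1 ≤ s.length),
      s.take (i + 1) = s.take i ++ [s[i]] := fun s i h => by simp
  induction h with
  | nil => simpa using EditsTo.refl []
  | @mat i j e _ hm ih =>
    rw [hs s i hi, hs t j hj]
    have : s[i] = t[j] := by
      have h1 := hm.1
      have h2 := hm.2.1
      have := hm.2.2
      simp only [bitAt, List.getD_eq_getElem?_getD, List.getElem?_eq_getElem h1,
        List.getElem?_eq_getElem h2, Option.getD_some] at this
      revert this; cases s[i] <;> cases t[j] <;> simp
    rw [this]
    exact (ih (by omega) (by omega)).append _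
  | @sub i j e _ ih =>
    rw [hs s i hi, hs t j hj]
    exact ((ih (by omega) (by omega)).append [s[i]]).snoc
      (Edit.subst (t.take j) [] s[i] t[j])
  | @del i j e _ ih =>
    rw [hs s i hi]
    exact ((ih (by omega) (by omega)).append [s[i]]).snoc
      (by have := Edit.del (t.take j) [] s[i]; rwa [List.append_nil] at this)
  | @ins i j e _ ih =>
    rw [hs t j hj]
    exact (ih (by omega) (by omega)).snoc 
      (by have := Edit.ins (t.take j) [] t[j]; rwa [List.append_nil] at this)

/-- `lvNext` does not check the borders of the square, so substitution and deletion steps may leave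
it. Projecting back to the square keeps the matches, which lie inside, and never makes another step
dearer. -/
theorem Grid.clamp {m : ℕ → ℕ → Prop} {n : ℕ} (hm : ∀ i j, m i j → i < n ∧ j < n) {i j e : ℕ}
    (h : Grid m i j e) : ∃ e' ≤ e, Grid m (min i n) (min j n) e' := by
  induction h with
  | nil => exact ⟨0, le_rfl, by simpa using .nil⟩
  | @mat i j e _ h ih =>
    obtain ⟨e', he, hg⟩ := ih
    have := hm _ _ h
    rw [min_eq_left (by omega), min_eq_left (by omega)] at hg ⊢
    exact ⟨e', he, hg.mat h⟩
  | @sub i j e _ ih =>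
    obtain ⟨e', he, hg⟩ := ih
    rcases Nat.lt_or_ge i n with hi | hi <;> rcases Nat.lt_or_ge j n with hj | hj
    · rw [min_eq_left (by omega), min_eq_left (by omega)] at hg ⊢
      exact ⟨e' + 1, by omega, hg.sub⟩
    · rw [min_eq_left (by omega), min_eq_right (by omega)] at hg ⊢
      exact ⟨e' + 1, by omega, hg.del⟩
    · rw [min_eq_right (by omega), min_eq_left (by omega)] at hg ⊢
      exact ⟨e' + 1, by omega, hg.ins⟩
    · rw [min_eq_right (by omega), min_eq_right (by omega)] at hg ⊢
      exact ⟨e', by omega, hg⟩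
  | @del i j e _ ih =>
    obtain ⟨e', he, hg⟩ := ih
    rcases Nat.lt_or_ge i n with hi | hi
    · rw [min_eq_left (by omega)] at hg ⊢
      exact ⟨e' + 1, by omega, hg.del⟩
    · rw [min_eq_right (by omega)] at hg ⊢
      exact ⟨e', by omega, hg⟩
  | @ins i j e _ ih =>
    obtain ⟨e', he, hg⟩ := ih
    rcases Nat.lt_or_ge j n with hj | hj
    · rw [min_eq_left (b := n) (show j + 1 ≤ n by omega)]
      rw [min_eq_left (b := n) (show j ≤ n by omega)] at hg
      exact ⟨e' + 1, by omega, hg.ins⟩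
    · rw [min_eq_right (a := j + 1) (by omega)]
      rw [min_eq_right (a := j) (by omega)] at hg
      exact ⟨e', by omega, hg⟩

theorem editDist_le_iff {s t : List Bool} {n : ℕ} (hs : s.length = n) (ht : t.length = n) {K : ℕ} :
    editDist s t ≤ K ↔ ∃ e ≤ K, Grid (SameAt s t) n n e := by
  constructor
  · intro h
    obtain ⟨e, he, hg⟩ := EditsTo.grid (Nat.sInf_mem (exists_editsTo s t))
    exact ⟨e, he.trans h, by rwa [hs, ht] at hg⟩
  · rintro ⟨e, he, hg⟩
    have := hg.editsTo hs.ge ht.ge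
    rw [List.take_of_length_le hs.le, List.take_of_length_le ht.le] at this
    exact (Nat.sInf_le this).trans he

/-! ### Furthest reaching paths in the edit graph

Entries are `0` if undefined, and otherwise one more than the row that is reached. Diagonal `k`
consists of the pairs `(i, j)` with `j + (K + 1) = i + k`. -/

section

variable (n K L : ℕ) (cmp : ℕ → ℕ → ℕ → Prop) [∀ b i j, Decidable (cmp b i j)]

/-- Sliding down diagonal `k` by decreasing powers of two. -/
def slide (k v : ℕ) : ℕ → ℕ
  | 0 => v
  | b + 1 =>
    if 0 < slide k v b ∧ slide k v b - 1 + 2 ^ (L - (b + 1)) ≤ n ∧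
        slide k v b - 1 + k - (K + 1) + 2 ^ (L - (b + 1)) ≤ n ∧
        cmp (L - (b + 1)) (slide k v b - 1) (slide k v b - 1 + k - (K + 1)) then
      slide k v b + 2 ^ (L - (b + 1)) else slide k v b

/-- The candidate on diagonal `k` that is one edit away from the entries `row`. -/
def lvNext (row : ℕ → ℕ) (k : ℕ) : ℕ :=
  if 1 ≤ k ∧ k < 2 * K + 2 then
    max (max (if 0 < row k then row k + 1 else 0) (if 0 < row (k + 1) then row (k + 1) + 1 else 0))
      (row (k - 1))
  else 0

/-- Where the slide on diagonal `k` with `e` edits starts. -/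
def lvStart : ℕ → ℕ → ℕ
  | 0, k => if k = K + 1 then 1 else 0
  | e + 1, k => lvNext K (fun k' => slide n K L cmp k' (lvStart e k') L) k

/-- The entry for `e` edits and diagonal `k` after `b` rounds of the slide. -/
def lv (e k b : ℕ) : ℕ := slide n K L cmp k (lvStart n K L cmp e k) b

theorem lvStart_succ (e k : ℕ) :
    lvStart n K L cmp (e + 1) k = lvNext K (fun k' => lv n K L cmp e k' L) k := rfl

theorem lv_zero (e k : ℕ) : lv n K L cmp e k 0 = lvStart n K L cmp e k := rfl

theorem le_slide (k v b : ℕ) : v ≤ slide n K L cmp k v b := by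
  induction b with
  | zero => exact le_rfl
  | succ b ih =>
    rw [slide]
    split_ifs
    · exact ih.trans (Nat.le_add_right _ _)
    · exact ih

theorem slide_zero (k b : ℕ) : slide n K L cmp k 0 b = 0 := by
  induction b with
  | zero => rfl
  | succ b ih => rw [slide, if_neg (by simp [ih]), ih]

theorem slide_le (k v b : ℕ) : slide n K L cmp k v b ≤ max v (n + 1) := by
  induction b with
  | zero => simp [slide]
  | succ b ih =>
    rw [slide]
    split_ifs with h
    · have h1 := h.1
      have h2 := h.2.1
      omega
    · exact ih

/-- A slide stops at row n, but each substitution or deletion may go one row further, hence the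
summand `e`. The bound shows that reducing table entries modulo 4N is harmless. -/
theorem lv_le (e k b : ℕ) : lv n K L cmp e k b ≤ n + 1 + e := by
  induction e generalizing k b with
  | zero =>
    refine (slide_le ..).trans (max_le ?_ le_rfl)
    rw [lvStart]; split <;> omega
  | succ e ih =>
    refine (slide_le ..).trans (max_le ?_ (by omega))
    rw [lvStart_succ, lvNext]
    have h1 := ih k L
    have h2 := ih (k + 1) L
    have h3 := ih (k - 1) L
    split
    · refine max_le (max_le ?_ ?_) (by omega) <;> split <;> omega
    · omega

variable {n K L cmp} {cmp' : ℕ → ℕ → ℕ → Prop} [∀ b i j, Decidable (cmp' b i j)]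

/-- Both slides stay equal round by round, so the two comparisons need to agree only at the pairs
visited by the slide with `cmp`. Taking `cmp` exact makes these pairs independent of the coins. -/
theorem slide_congr {k v b : ℕ} (h : ∀ b' < b, 0 < slide n K L cmp k v b' →
      slide n K L cmp k v b' - 1 + 2 ^ (L - (b' + 1)) ≤ n →
      slide n K L cmp k v b' - 1 + k - (K + 1) + 2 ^ (L - (b' + 1)) ≤ n →
      (cmp' (L - (b' + 1)) (slide n K L cmp k v b' - 1) (slide n K L cmp k v b' - 1 + k - (K + 1)) ↔
        cmp (L - (b' + 1)) (slide n K L cmp k v b' - 1)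
          (slide n K L cmp k v b' - 1 + k - (K + 1)))) :
    slide n K L cmp' k v b = slide n K L cmp k v b := by
  induction b with
  | zero => rfl
  | succ b ih =>
    rw [slide, slide, ih fun b' hb => h b' (by omega)]
    refine if_congr ?_ rfl rfl
    constructor
    · rintro ⟨h1, h2, h3, h4⟩; exact ⟨h1, h2, h3, (h b (by omega) h1 h2 h3).1 h4⟩
    · rintro ⟨h1, h2, h3, h4⟩; exact ⟨h1, h2, h3, (h b (by omega) h1 h2 h3).2 h4⟩

/-- Two comparisons that agree wherever the first run looks give the same table. -/
theorem lv_congr (h : ∀ e ≤ K, ∀ k < 2 * K + 3, ∀ b < L, 0 < lv n K L cmp e k b →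
      lv n K L cmp e k b - 1 + 2 ^ (L - (b + 1)) ≤ n →
      lv n K L cmp e k b - 1 + k - (K + 1) + 2 ^ (L - (b + 1)) ≤ n →
      (cmp' (L - (b + 1)) (lv n K L cmp e k b - 1) (lv n K L cmp e k b - 1 + k - (K + 1)) ↔
        cmp (L - (b + 1)) (lv n K L cmp e k b - 1) (lv n K L cmp e k b - 1 + k - (K + 1))))
    {e k b : ℕ} (he : e ≤ K) (hk : k < 2 * K + 3) (hb : b ≤ L) :
    lv n K L cmp' e k b = lv n K L cmp e k b := by
  induction e generalizing k b with
  | zero => exact slide_congr fun b' hb' => h 0 (by omega) k hk b' (by omega)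
  | succ e ih =>
    have : lvStart n K L cmp' (e + 1) k = lvStart n K L cmp (e + 1) k := by
      rw [lvStart_succ, lvStart_succ, lvNext, lvNext]
      by_cases hk' : 1 ≤ k ∧ k < 2 * K + 2
      · rw [if_pos hk', if_pos hk', ih (by omega) hk le_rfl,
          ih (k := k + 1) (by omega) (by omega) le_rfl,
          ih (k := k - 1) (by omega) (by omega) le_rfl]
      · rw [if_neg hk', if_neg hk']
    rw [lv, this]
    exact slide_congr fun b' hb' => h (e + 1) he k hk b' (by omega)

end

/-- The windows of length `2 ^ b` of `S` at `i` and of `T` at `j` agree. -/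
def WinEq (S T : ℕ → ℕ) (b i j : ℕ) : Prop := ∀ x < 2 ^ b, S (i + x) = T (j + x)

instance (S T : ℕ → ℕ) (b i j : ℕ) : Decidable (WinEq S T b i j) := Nat.decidableBallLT _ _

/-! ### Correctness of the table of furthest reaching paths. -/

section

variable {s t : List Bool} {n K L : ℕ}

/-- After b rounds, fewer than 2^(L - b) further symbols match: this is true at the start because n
< 2^L, and each round halves the bound by testing one window. After L rounds the next pair is a
mismatch or lies outside the strings. -/
theorem slide_spec (hs : s.length = n) (ht : t.length = n) (hL : n < 2 ^ L) {k i j : ℕ}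
    (hij : j + (K + 1) = i + k) :
    ∃ l, slide n K L (WinEq (bitAt s) (bitAt t)) k (i + 1) L = i + l + 1 ∧
      (∀ x < l, SameAt s t (i + x) (j + x)) ∧ ¬ SameAt s t (i + l) (j + l) := by
  have key : ∀ b ≤ L, ∃ l, slide n K L (WinEq (bitAt s) (bitAt t)) k (i + 1) b = i + l + 1 ∧
      (∀ x < l, SameAt s t (i + x) (j + x)) ∧
      ¬ ∀ x < 2 ^ (L - b), SameAt s t (i + l + x) (j + l + x) := by
    intro b
    induction b with
    | zero =>
      exact fun _ => ⟨0, rfl, by simp, fun h => by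
        have := (h n (by simpa using hL)).1; omega⟩
    | succ b ih =>
      intro hb
      obtain ⟨l, h1, h2, h3⟩ := ih (by omega)
      have hpow : 2 ^ (L - b) = 2 ^ (L - (b + 1)) + 2 ^ (L - (b + 1)) := by
        rw [show L - b = L - (b + 1) + 1 by omega, pow_succ]; ring
      have hp : 0 < 2 ^ (L - (b + 1)) := by positivity
      have hj : i + l + k - (K + 1) = j + l := by omega
      simp only [slide, h1, Nat.add_sub_cancel, hj]
      split_ifs with hc
      · obtain ⟨_, c1, c2, c3⟩ := hc
        have hall : ∀ x < 2 ^ (L - (b + 1)), SameAt s t (i + l + x) (j + l + x) :=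
          fun x hx => ⟨by omega, by omega, c3 x hx⟩
        refine ⟨l + 2 ^ (L - (b + 1)), by omega, fun x hx => ?_, fun h => h3 fun x hx => ?_⟩
        · rcases Nat.lt_or_ge x l with h | h
          · exact h2 x h
          · have := hall (x - l) (by omega)
            rwa [show i + l + (x - l) = i + x by omega, show j + l + (x - l) = j + x by omega]
              at this
        · rcases Nat.lt_or_ge x (2 ^ (L - (b + 1))) with h' | h'
          · exact hall x h'
          · have := h (x - 2 ^ (L - (b + 1))) (by omega)
            rwa [show i + (l + 2 ^ (L - (b + 1))) + (x - 2 ^ (L - (b + 1))) = i + l + x by omega,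
              show j + (l + 2 ^ (L - (b + 1))) + (x - 2 ^ (L - (b + 1))) = j + l + x by omega]
              at this
      · refine ⟨l, rfl, h2, fun h => hc ⟨by omega, ?_, ?_, fun x hx => (h x hx).2.2⟩⟩
        · have := (h (2 ^ (L - (b + 1)) - 1) (by omega)).1; omega
        · have := (h (2 ^ (L - (b + 1)) - 1) (by omega)).2.1; omega
  obtain ⟨l, h1, h2, h3⟩ := key L le_rfl
  exact ⟨l, h1, h2, fun h => h3 fun x hx => by
    have : x = 0 := by simpa using hx
    simpa [this] using h⟩

theorem Grid.mat_iter {m : ℕ → ℕ → Prop} {i j e l : ℕ} (h : Grid m i j e)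
    (hm : ∀ x < l, m (i + x) (j + x)) : Grid m (i + l) (j + l) e := by
  induction l with
  | zero => exact h
  | succ l ih => exact (ih fun x hx => hm x (by omega)).mat (hm l (by omega))

theorem Grid.sub_iter {m : ℕ → ℕ → Prop} {i j e : ℕ} (h : Grid m i j e) (l : ℕ) :
    Grid m (i + l) (j + l) (e + l) := by
  induction l with
  | zero => exact h
  | succ l ih => exact ih.sub

theorem Grid.diag {m : ℕ → ℕ → Prop} {i j e : ℕ} (h : Grid m i j e) : i ≤ j + e ∧ j ≤ i + e := by
  induction h <;> omega

/-- Each of the three candidates of `lvNext` extends a path by one edit, and a slide extends it by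
matches; no restriction to the n × n square is claimed. -/
theorem lv_sound (hs : s.length = n) (ht : t.length = n) (hL : n < 2 ^ L) {e k i : ℕ}
    (h : lv n K L (WinEq (bitAt s) (bitAt t)) e k L = i + 1) :
    ∃ j, j + (K + 1) = i + k ∧ Grid (SameAt s t) i j e := by
  induction e generalizing k i with
  | zero =>
    rw [lv, lvStart] at h
    split at h
    · rename_i hk
      obtain ⟨l, h1, h2, -⟩ := slide_spec hs ht hL (K := K) (k := k) (i := 0) (j := 0) (by omega)
      have : i = 0 + l := by rw [Nat.zero_add] at h1; omega
      exact ⟨0 + l, by omega, this ▸ Grid.nil.mat_iter h2⟩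
    · rw [slide_zero] at h; omega
  | succ e ih =>
    rw [lv] at h
    obtain ⟨i', hi', j', hj', hg⟩ : ∃ i', lvStart n K L (WinEq (bitAt s) (bitAt t)) (e + 1) k = i' + 1 ∧
        ∃ j', j' + (K + 1) = i' + k ∧ Grid (SameAt s t) i' j' (e + 1) := by
      have h0 : lvStart n K L (WinEq (bitAt s) (bitAt t)) (e + 1) k ≠ 0 := by
        intro h0; rw [h0, slide_zero] at h; omega
      rw [lvStart_succ, lvNext] at h0 ⊢
      split at h0
      swap; · exact absurd rfl h0
      rename_i hk
      rw [if_pos hk]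
      have hcases : ∀ a b c : ℕ, max (max a b) c = a ∨ max (max a b) c = b ∨ max (max a b) c = c :=
        fun a b c => by omega
      rcases hcases _ _ _ with hm | hm | hm <;> rw [hm] at h0 ⊢
      · split at h0
        · rename_i h1
          obtain ⟨r, hr⟩ : ∃ r, lv n K L (WinEq (bitAt s) (bitAt t)) e k L = r + 1 :=
            ⟨_, (Nat.succ_pred_eq_of_pos h1).symm⟩
          obtain ⟨j, hj, hg⟩ := ih hr
          exact ⟨r + 1, by rw [if_pos h1, hr], j + 1, by omega, hg.sub⟩
        · exact absurd rfl h0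
      · split at h0
        · rename_i h1
          obtain ⟨r, hr⟩ : ∃ r, lv n K L (WinEq (bitAt s) (bitAt t)) e (k + 1) L = r + 1 :=
            ⟨_, (Nat.succ_pred_eq_of_pos h1).symm⟩
          obtain ⟨j, hj, hg⟩ := ih hr
          exact ⟨r + 1, by rw [if_pos h1, hr], j, by omega, hg.del⟩
        · exact absurd rfl h0
      · obtain ⟨r, hr⟩ : ∃ r, lv n K L (WinEq (bitAt s) (bitAt t)) e (k - 1) L = r + 1 :=
          ⟨_, (Nat.succ_pred_eq_of_pos (Nat.pos_of_ne_zero h0)).symm⟩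
        obtain ⟨j, hj, hg⟩ := ih hr
        exact ⟨r, hr, j + 1, by omega, hg.ins⟩
    rw [hi'] at h
    obtain ⟨l, h1, h2, -⟩ := slide_spec hs ht hL (K := K) hj'
    have : i = i' + l := by omega
    exact ⟨j' + l, by omega, this ▸ hg.mat_iter h2⟩

/-- Induction along the path. An edit step feeds one of the candidates of the next row of the table.
A match step at (i, j) cannot go beyond the entry, since an entry equal to i + 1 would mean that its
slide stopped at the matching pair (i, j). -/
theorem lv_complete (hs : s.length = n) (ht : t.length = n) (hL : n < 2 ^ L) {e i j : ℕ}
    (h : Grid (SameAt s t) i j e) (he : e ≤ K) {k : ℕ} (hk : j + (K + 1) = i + k) :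
    i + 1 ≤ lv n K L (WinEq (bitAt s) (bitAt t)) e k L := by
  induction h generalizing k with
  | nil =>
    refine le_trans ?_ (le_slide ..)
    rw [lvStart, if_pos (by omega)]
  | @mat i j e hg hm ih =>
    have h1 := ih he (k := k) (by omega)
    by_contra hc
    have hr : lv n K L (WinEq (bitAt s) (bitAt t)) e k L = i + 1 := by omega
    obtain ⟨v, hv⟩ : ∃ v, lvStart n K L (WinEq (bitAt s) (bitAt t)) e k = v := ⟨_, rfl⟩
    rw [lv, hv] at hr
    rcases v with _ | v
    · rw [slide_zero] at hr; omega
    · have hvi : v ≤ i := by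
        have := le_slide n K L (WinEq (bitAt s) (bitAt t)) k (v + 1) L; omega
      -- The slide must start at a genuine pair: the column v + k - (K + 1) may not be a truncated
      -- difference. This follows by tracing the start back to a path through `lv_sound`.
      have hj : K + 1 ≤ v + k := by
        cases e with
        | zero => rw [lvStart] at hv; split at hv <;> omega
        | succ e =>
          rw [lvStart_succ, lvNext] at hv
          split at hv
          swap; · omega
          have hcases : ∀ a b c : ℕ,
              max (max a b) c = a ∨ max (max a b) c = b ∨ max (max a b) c = c :=
            fun a b c => by omega
          rcases hcases (if 0 < lv n K L (WinEq (bitAt s) (bitAt t)) e k L then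
              lv n K L (WinEq (bitAt s) (bitAt t)) e k L + 1 else 0)
              (if 0 < lv n K L (WinEq (bitAt s) (bitAt t)) e (k + 1) L then
              lv n K L (WinEq (bitAt s) (bitAt t)) e (k + 1) L + 1 else 0)
              (lv n K L (WinEq (bitAt s) (bitAt t)) e (k - 1) L) with hm | hm | hm <;> rw [hm] at hv
          · split at hv
            · rename_i h1
              obtain ⟨r, hr⟩ : ∃ r, lv n K L (WinEq (bitAt s) (bitAt t)) e k L = r + 1 :=
                ⟨_, (Nat.succ_pred_eq_of_pos h1).symm⟩
              obtain ⟨j, hj, -⟩ := lv_sound hs ht hL hr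
              omega
            · omega
          · split at hv
            · rename_i h1
              obtain ⟨r, hr⟩ : ∃ r, lv n K L (WinEq (bitAt s) (bitAt t)) e (k + 1) L = r + 1 :=
                ⟨_, (Nat.succ_pred_eq_of_pos h1).symm⟩
              obtain ⟨j, hj, -⟩ := lv_sound hs ht hL hr
              omega
            · omega
          · obtain ⟨j, hj, -⟩ := lv_sound hs ht hL hv
            omega
      obtain ⟨l, h2, -, h3⟩ := slide_spec hs ht hL (K := K) (k := k) (i := v) (j := v + k - (K + 1))
        (by omega)
      have hl : v + l = i := by omega
      have hl' : v + k - (K + 1) + l = j := by omega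
      rw [hl, hl'] at h3
      exact h3 hm
  | @sub i j e hg ih =>
    have h1 := ih (by omega) (k := k) (by omega)
    -- With fewer than K edits before this step, the path is close enough to the main diagonal for
    -- `lvNext` not to discard diagonal `k`.
    have := hg.diag
    refine le_trans ?_ (le_slide ..)
    rw [lvStart_succ, lvNext, if_pos (by omega), if_pos (by omega)]
    omega
  | @del i j e hg ih =>
    have h1 := ih (by omega) (k := k + 1) (by omega)
    have := hg.diag
    refine le_trans ?_ (le_slide ..)
    rw [lvStart_succ, lvNext, if_pos (by omega),
      if_pos (show 0 < lv n K L (WinEq (bitAt s) (bitAt t)) e (k + 1) L by omega)]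
    omega
  | @ins i j e hg ih =>
    have := hg.diag
    have h1 := ih (by omega) (k := k - 1) (by omega)
    refine le_trans ?_ (le_slide ..)
    rw [lvStart_succ, lvNext, if_pos (by omega)]
    omega

theorem lt_lv_iff (hs : s.length = n) (ht : t.length = n) (hL : n < 2 ^ L) :
    n < lv n K L (WinEq (bitAt s) (bitAt t)) K (K + 1) L ↔ editDist s t ≤ K := by
  rw [editDist_le_iff hs ht]
  constructor
  · intro h
    obtain ⟨r, hr⟩ : ∃ r, lv n K L (WinEq (bitAt s) (bitAt t)) K (K + 1) L = r + 1 :=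
      ⟨_, (Nat.succ_pred_eq_of_pos (by omega)).symm⟩
    obtain ⟨j, hj, hg⟩ := lv_sound hs ht hL hr
    -- The entry may belong to a path that ran past the last row; clamping brings its end to the
    -- corner (n, n).
    obtain ⟨e, he, hg⟩ := hg.clamp (n := n) fun i j h => ⟨hs ▸ h.1, ht ▸ h.2.1⟩
    rw [min_eq_right (by omega), min_eq_right (by omega)] at hg
    exact ⟨e, he, hg⟩
  · rintro ⟨e, he, hg⟩
    -- The last row of the table stands for exactly K edits, so a cheaper path is padded with
    -- substitution steps beyond the corner.
    have := lv_complete hs ht hL (hg.sub_iter (K - e)) (K := K) (by omega) (k := K + 1) (by omega)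
    rw [show e + (K - e) = K by omega] at this
    omega

end

/-! ### Hash functions from random bits -/

/-- The `b`-th number of `w` bits in the bit sequence `r`. -/
def seed (w : ℕ) (r : ℕ → ℕ) (b : ℕ) : ℕ := ∑ u ∈ Finset.range w, r (b * w + u) * 2 ^ u

/-- The hash, with seeds `a`, of the window of `S` of length `2 ^ j` at position `i`. -/
def windowHash {p : ℕ} (a : ℕ → ZMod p) (S : ℕ → ℕ) : ℕ → ℕ → ZMod p
  | 0, i => S i
  | j + 1, i => windowHash a S j i + a j * windowHash a S j (i + 2 ^ j)

/-- The hash, with seeds `a`, of the lowest `b` binary digits of `i`. -/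
def indexHash {p : ℕ} (a : ℕ → ZMod p) (b i : ℕ) : ZMod p :=
  ∑ u ∈ Finset.range b, ((i / 2 ^ u % 2 : ℕ) : ZMod p) * a u

theorem windowHash_congr_seed {p : ℕ} {a a' : ℕ → ZMod p} {S : ℕ → ℕ} {j : ℕ}
    (h : ∀ b < j, a b = a' b) (i : ℕ) : windowHash a S j i = windowHash a' S j i := by
  induction j generalizing i with
  | zero => rfl
  | succ j ih =>
    rw [windowHash, windowHash, ih (fun b hb => h b (by omega)), ih (fun b hb => h b (by omega)),
      h j (by omega)]

theorem windowHash_congr {p : ℕ} {a : ℕ → ZMod p} {S T : ℕ → ℕ} {j i q : ℕ}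
    (h : WinEq S T j i q) : windowHash a S j i = windowHash a T j q := by
  induction j generalizing i q with
  | zero => have := h 0 (by simp); simp_all [windowHash]
  | succ j ih =>
    have hp : 2 ^ (j + 1) = 2 ^ j + 2 ^ j := by ring
    rw [windowHash, windowHash, ih fun x hx => h x (by omega),
      ih (i := i + 2 ^ j) (q := q + 2 ^ j) fun x hx => by
        rw [add_assoc, add_assoc]; exact h _ (by omega)]

theorem windowHash_eq_zero {p : ℕ} {a : ℕ → ZMod p} {S : ℕ → ℕ} {j i : ℕ}
    (h : ∀ x, i ≤ x → S x = 0) : windowHash a S j i = 0 := by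
  induction j generalizing i with
  | zero => simp [windowHash, h i le_rfl]
  | succ j ih => rw [windowHash, ih h, ih fun x hx => h x ((Nat.le_add_right _ _).trans hx)]; ring

theorem bits_inj {w : ℕ} {f g : ℕ → ℕ} (hf : ∀ u, f u ≤ 1) (hg : ∀ u, g u ≤ 1)
    (h : ∑ u ∈ Finset.range w, f u * 2 ^ u = ∑ u ∈ Finset.range w, g u * 2 ^ u) :
    ∀ u < w, f u = g u := by
  induction w generalizing f g with
  | zero => intro u hu; omega
  | succ w ih =>
    have e : ∀ f : ℕ → ℕ, ∑ u ∈ Finset.range (w + 1), f u * 2 ^ u =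
        2 * ∑ u ∈ Finset.range w, f (u + 1) * 2 ^ u + f 0 := by
      intro f
      rw [Finset.sum_range_succ', Finset.mul_sum]
      simp only [pow_succ, pow_zero, mul_one]
      congr 1
      exact Finset.sum_congr rfl fun u _ => by ring
    rw [e, e] at h
    have h0 := hf 0
    have h0' := hg 0
    intro u hu
    rcases u with _ | u
    · omega
    · exact ih (f := fun u => f (u + 1)) (g := fun u => g (u + 1)) (fun u => hf _) (fun u => hg _)
        (by omega) u (by omega)

theorem bits_lt {w : ℕ} {f : ℕ → ℕ} (hf : ∀ u, f u ≤ 1) :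
    ∑ u ∈ Finset.range w, f u * 2 ^ u < 2 ^ w := by
  induction w with
  | zero => simp
  | succ w ih =>
    rw [Finset.sum_range_succ, pow_succ]
    have := Nat.mul_le_mul_right (2 ^ w) (hf w)
    omega

theorem seed_lt {w : ℕ} {r : ℕ → ℕ} (hr : ∀ u, r u ≤ 1) (b : ℕ) : seed w r b < 2 ^ w :=
  bits_lt fun _ => hr _

theorem seed_congr {w b : ℕ} {r r' : ℕ → ℕ} (h : ∀ x, x / w = b → r x = r' x) :
    seed w r b = seed w r' b := by
  refine Finset.sum_congr rfl fun u hu => ?_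
  have hu := Finset.mem_range.1 hu
  rw [h]
  rw [mul_comm, Nat.mul_add_div (by omega), Nat.div_eq_of_lt hu, add_zero]

/-- The coins of a run as a sequence of numbers. -/
def coinSeq {R : ℕ} (r : Fin R → Bool) : ℕ → ℕ := bitAt (List.ofFn r)

theorem coinSeq_apply {R : ℕ} (r : Fin R → Bool) (x : Fin R) : coinSeq r x = (r x).toNat := by
  simp [coinSeq, bitAt]

theorem coinSeq_of_le {R : ℕ} (r : Fin R → Bool) {x : ℕ} (hx : R ≤ x) : coinSeq r x = 0 :=
  bitAt_eq_zero (by simpa using hx)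

theorem coinSeq_le_one {R : ℕ} (r : Fin R → Bool) (x : ℕ) : coinSeq r x ≤ 1 := bitAt_le_one _ _

/-- An event that determines one seed when the other coins are fixed is unlikely. -/
theorem ncard_mul_le_of_seed {L w b : ℕ} (hb : b < L) (P : (Fin (L * w) → Bool) → Prop)
    (hP : ∀ r r', (∀ x : Fin (L * w), x / w ≠ b → r x = r' x) → P r → P r' →
      seed w (coinSeq r) b = seed w (coinSeq r') b) :
    {r | P r}.ncard * 2 ^ w ≤ 2 ^ (L * w) := by
  rcases Nat.eq_zero_or_pos w with rfl | hw
  · refine le_trans (Nat.mul_le_mul_right _ (Set.ncard_le_card _)) (by simp)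
  -- Overwrite seed `b` by an arbitrary word. On runs in the event this loses nothing, since the
  -- other coins determine the overwritten seed; hence the event times 2^w words injects into all
  -- runs.
  let φ : (Fin (L * w) → Bool) × (Fin w → Bool) → (Fin (L * w) → Bool) := fun x y =>
    if (y : ℕ) / w = b then x.2 ⟨y % w, Nat.mod_lt _ hw⟩ else x.1 y
  have hcell : ∀ u < w, b * w + u < L * w := fun u hu => by
    calc b * w + u < (b + 1) * w := by rw [add_mul]; omega
      _ ≤ L * w := Nat.mul_le_mul_right _ hb
  have hinj : Set.InjOn φ ({r | P r} ×ˢ Set.univ) := by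
    rintro ⟨r, v⟩ ⟨hr, -⟩ ⟨r', v'⟩ ⟨hr', -⟩ h
    have hoff : ∀ x : Fin (L * w), x / w ≠ b → r x = r' x := fun x hx => by
      have := congrFun h x
      simpa [φ, hx] using this
    have hv : v = v' := by
      funext u
      have := congrFun h ⟨b * w + u, hcell u u.2⟩
      have e1 : (b * w + (u : ℕ)) / w = b := by
        rw [mul_comm, Nat.mul_add_div hw, Nat.div_eq_of_lt u.2, add_zero]
      have e2 : (b * w + (u : ℕ)) % w = u := by
        rw [mul_comm, Nat.mul_add_mod, Nat.mod_eq_of_lt u.2]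
      simpa [φ, e1, e2] using this
    have hs := bits_inj (fun _ => coinSeq_le_one _ _) (fun _ => coinSeq_le_one _ _)
      (hP r r' hoff hr hr')
    refine Prod.ext (funext fun x => ?_) hv
    by_cases hx : (x : ℕ) / w = b
    · have := hs (x % w) (Nat.mod_lt _ hw)
      rw [show b * w + (x : ℕ) % w = x by rw [← hx]; exact Nat.div_add_mod' _ _,
        coinSeq_apply, coinSeq_apply] at this
      change r x = r' x
      revert this; cases r x <;> cases r' x <;> simp
    · exact hoff x hx
  have h1 := hinj.ncard_image
  rw [Set.ncard_prod, Set.ncard_univ] at h1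
  calc {r | P r}.ncard * 2 ^ w = (φ '' ({r | P r} ×ˢ Set.univ)).ncard := by
        rw [h1]; simp
    _ ≤ Nat.card (Fin (L * w) → Bool) := Set.ncard_le_card _
    _ = 2 ^ (L * w) := by simp

theorem seed_eq_of_cast {p w : ℕ} (hwp : 2 ^ w ≤ p) {r r' : ℕ → ℕ} (hr : ∀ u, r u ≤ 1)
    (hr' : ∀ u, r' u ≤ 1) {b : ℕ} (h : (seed w r b : ZMod p) = seed w r' b) :
    seed w r b = seed w r' b := by
  have := (ZMod.natCast_eq_natCast_iff' _ _ _).1 h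
  rwa [Nat.mod_eq_of_lt ((seed_lt hr b).trans_le hwp),
    Nat.mod_eq_of_lt ((seed_lt hr' b).trans_le hwp)] at this

/-- The seeds modulo `p`. -/
def seedMod (p w : ℕ) (r : ℕ → ℕ) (b : ℕ) : ZMod p := (seed w r b : ZMod p)

theorem coinSeq_congr {L w b : ℕ} {r r' : Fin (L * w) → Bool}
    (h : ∀ x : Fin (L * w), x / w ≠ b → r x = r' x) {b' : ℕ} (hb : b' ≠ b) :
    seed w (coinSeq r) b' = seed w (coinSeq r') b' := by
  refine seed_congr fun x hx => ?_
  rcases Nat.lt_or_ge x (L * w) with h' | h'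
  · have := h ⟨x, h'⟩ (by simpa [hx] using hb)
    have e1 := coinSeq_apply r ⟨x, h'⟩
    have e2 := coinSeq_apply r' ⟨x, h'⟩
    simp only at e1 e2
    rw [e1, e2, this]
  · rw [coinSeq_of_le _ h', coinSeq_of_le _ h']

/-! ### Collision counts for the two hash families. -/

section

variable {p w L : ℕ} [Fact p.Prime]

/-- Different windows differ in one of their halves. Either the hashes of these halves already
collide, which the induction counts, or the equation of the two hashes is a nontrivial linear
equation for seed `j`, which the other coins then determine. -/
theorem windowHash_collision (hwp : 2 ^ w ≤ p) {S T : ℕ → ℕ} (hS : ∀ x, S x ≤ 1)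
    (hT : ∀ x, T x ≤ 1) {j i q : ℕ} (hj : j ≤ L) (hne : ¬ WinEq S T j i q) :
    {r : Fin (L * w) → Bool | windowHash (seedMod p w (coinSeq r)) S j i =
      windowHash (seedMod p w (coinSeq r)) T j q}.ncard * 2 ^ w ≤ j * 2 ^ (L * w) := by
  induction j generalizing i q with
  | zero =>
    have h0 : ((S i : ℕ) : ZMod p) ≠ T q := by
      intro h
      rw [ZMod.natCast_eq_natCast_iff'] at h
      have h2 := (Fact.out : p.Prime).two_le
      have h3 := hS i
      have h4 := hT q
      rw [Nat.mod_eq_of_lt (by omega), Nat.mod_eq_of_lt (by omega)] at h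
      exact hne fun x hx => by
        have : x = 0 := by simpa using hx
        simpa [this] using h
    simp [windowHash, h0]
  | succ j ih =>
    obtain ⟨d, hd, hne'⟩ : ∃ d, (d = 0 ∨ d = 2 ^ j) ∧ ¬ WinEq S T j (i + d) (q + d) := by
      by_contra hc
      push Not at hc
      refine hne fun x hx => ?_
      have hp : 2 ^ (j + 1) = 2 ^ j + 2 ^ j := by ring
      rcases Nat.lt_or_ge x (2 ^ j) with h | h
      · exact hc 0 (Or.inl rfl) x h
      · have := hc _ (Or.inr rfl) (x - 2 ^ j) (by omega)
        rwa [add_assoc, add_assoc, Nat.add_sub_cancel' h] at this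
    set A := {r : Fin (L * w) → Bool | windowHash (seedMod p w (coinSeq r)) S j (i + d) =
      windowHash (seedMod p w (coinSeq r)) T j (q + d)} with hA
    let P : (Fin (L * w) → Bool) → Prop := fun r =>
      windowHash (seedMod p w (coinSeq r)) S (j + 1) i =
        windowHash (seedMod p w (coinSeq r)) T (j + 1) q ∧ r ∉ A
    have hP : {r | P r}.ncard * 2 ^ w ≤ 2 ^ (L * w) := by
      refine ncard_mul_le_of_seed (b := j) (by omega) P ?_
      rintro r r' hrr ⟨h1, h2⟩ ⟨h1', -⟩
      have hs : ∀ b < j, seedMod p w (coinSeq r) b = seedMod p w (coinSeq r') b := fun b hb => by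
        rw [seedMod, coinSeq_congr hrr (by omega)]; rfl
      refine seed_eq_of_cast hwp (coinSeq_le_one r) (coinSeq_le_one r') (p := p) ?_
      simp only [windowHash] at h1 h1'
      rw [← windowHash_congr_seed hs, ← windowHash_congr_seed hs, ← windowHash_congr_seed hs,
        ← windowHash_congr_seed hs] at h1'
      set u := windowHash (seedMod p w (coinSeq r)) S j i
      set v := windowHash (seedMod p w (coinSeq r)) S j (i + 2 ^ j)
      set u' := windowHash (seedMod p w (coinSeq r)) T j q
      set v' := windowHash (seedMod p w (coinSeq r)) T j (q + 2 ^ j)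
      change seedMod p w (coinSeq r) j = seedMod p w (coinSeq r') j
      -- If the coefficient of the seed vanished, the second halves would have equal hashes, hence
      -- the first halves too, contradicting that one of these pairs does not collide.
      have hv : v - v' ≠ 0 := by
        intro hv
        have hv := sub_eq_zero.1 hv
        rw [hv] at h1
        have hu : u = u' := by simpa using h1
        rcases hd with rfl | rfl
        · exact h2 hu
        · exact h2 hv
      refine mul_right_cancel₀ hv ?_
      linear_combination h1 - h1'
    have hsub : {r : Fin (L * w) → Bool | windowHash (seedMod p w (coinSeq r)) S (j + 1) i =
        windowHash (seedMod p w (coinSeq r)) T (j + 1) q} ⊆ A ∪ {r | P r} := fun r hr => by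
      by_cases h : r ∈ A
      · exact Or.inl h
      · exact Or.inr ⟨hr, h⟩
    have h1 := (Set.ncard_le_ncard hsub).trans (Set.ncard_union_le _ _)
    have h2 := ih (by omega) hne'
    calc _ ≤ (A.ncard + {r | P r}.ncard) * 2 ^ w := Nat.mul_le_mul_right _ h1
      _ ≤ (j + 1) * 2 ^ (L * w) := by rw [add_mul, add_mul, one_mul]; exact Nat.add_le_add h2 hP

/-- The indices differ in some binary digit u, and seed u enters the difference of the hashes with
coefficient 1 or -1, so the other coins determine it. -/
theorem indexHash_collision (hwp : 2 ^ w ≤ p) {i q : ℕ} (hi : i < 2 ^ L) (hq : q < 2 ^ L)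
    (hne : i ≠ q) :
    {r : Fin (L * w) → Bool | indexHash (seedMod p w (coinSeq r)) L i =
      indexHash (seedMod p w (coinSeq r)) L q}.ncard * 2 ^ w ≤ 2 ^ (L * w) := by
  obtain ⟨u, hu, huv⟩ : ∃ u < L, i / 2 ^ u % 2 ≠ q / 2 ^ u % 2 := by
    by_contra hc
    push Not at hc
    refine hne (Nat.eq_of_testBit_eq fun u => ?_)
    rcases Nat.lt_or_ge u L with h | h
    · rw [Nat.testBit_eq_decide_div_mod_eq, Nat.testBit_eq_decide_div_mod_eq, hc u h]
    · have := Nat.pow_le_pow_right (n := 2) (by norm_num) h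
      rw [Nat.testBit_lt_two_pow (hi.trans_le this), Nat.testBit_lt_two_pow (hq.trans_le this)]
  refine ncard_mul_le_of_seed hu _ ?_
  intro r r' hrr h h'
  refine seed_eq_of_cast hwp (coinSeq_le_one r) (coinSeq_le_one r') (p := p) ?_
  simp only [indexHash] at h h'
  have hm := Finset.mem_range.2 hu
  rw [← Finset.add_sum_erase _ _ hm, ← Finset.add_sum_erase _ _ hm] at h h'
  have he : ∀ i : ℕ, ∑ b ∈ (Finset.range L).erase u, ((i / 2 ^ b % 2 : ℕ) : ZMod p) *
      seedMod p w (coinSeq r') b = ∑ b ∈ (Finset.range L).erase u, ((i / 2 ^ b % 2 : ℕ) : ZMod p) *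
      seedMod p w (coinSeq r) b := fun i => Finset.sum_congr rfl fun b hb => by
    rw [seedMod, seedMod, coinSeq_congr hrr (Finset.ne_of_mem_erase hb)]
  rw [he, he] at h'
  change seedMod p w (coinSeq r) u = seedMod p w (coinSeq r') u
  rcases Nat.mod_two_eq_zero_or_one (i / 2 ^ u) with e | e <;>
    rcases Nat.mod_two_eq_zero_or_one (q / 2 ^ u) with e' | e' <;> rw [e, e'] at h h' huv
  · exact absurd rfl huv
  · push_cast at h h'; linear_combination h' - h
  · push_cast at h h'; linear_combination h - h'
  · exact absurd rfl huv

end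

/-! ### Recovering a few values from power sums -/

/-- Replacing E_r by E_(r+1) - x_l E_r multiplies the weight of each node x_q by x_q - x_l. The step
l = k is skipped, so that the k-th weight survives. Each step shortens the usable range of exponents
by one. -/
theorem eliminate {F : Type*} [Field F] {m k R : ℕ} (x v : ℕ → F)
    (E : ℕ → ℕ → F) (h0 : ∀ r < R, E 0 r = ∑ q ∈ Finset.range m, v q * x q ^ r)
    (hs : ∀ l r, l < m → r + l + 1 < R →
      E (l + 1) r = if l = k then E l r else E l (r + 1) - x l * E l r) {l : ℕ} (hl : l ≤ m)
    {r : ℕ} (hr : r + l < R) :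
    E l r = ∑ q ∈ Finset.range m, v q * x q ^ r *
      ∏ l' ∈ Finset.range l, if l' = k then 1 else x q - x l' := by
  induction l generalizing r with
  | zero => rw [h0 r hr]; simp
  | succ l ih =>
    rw [hs l r (by omega) (by omega)]
    simp only [Finset.prod_range_succ]
    split_ifs with h
    · rw [ih (by omega) (by omega)]; simp
    · rw [ih (by omega) (by omega), ih (by omega) (by omega), Finset.mul_sum,
        ← Finset.sum_sub_distrib]
      exact Finset.sum_congr rfl fun q _ => by ring

/-- Every node other than the k-th is killed by its own factor. More power sums than nodes are
available, which leaves exponent 0 valid after all steps. -/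
theorem eliminate_all {F : Type*} [Field F] {m k R : ℕ} (hk : k < m) (x v : ℕ → F)
    (E : ℕ → ℕ → F) (h0 : ∀ r < R, E 0 r = ∑ q ∈ Finset.range m, v q * x q ^ r)
    (hs : ∀ l r, l < m → r + l + 1 < R →
      E (l + 1) r = if l = k then E l r else E l (r + 1) - x l * E l r) (hm : m < R) :
    E m 0 = v k * ∏ l' ∈ Finset.range m, if l' = k then 1 else x k - x l' := by
  rw [eliminate x v E h0 hs le_rfl (by omega), Finset.sum_eq_single k]
  · simp
  · intro q hq hqk
    rw [Finset.prod_eq_zero hq (by rw [if_neg hqk, sub_self]), mul_zero]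
  · intro h; exact absurd (Finset.mem_range.2 hk) h

theorem count_enum {P : ℕ → Prop} [DecidablePred P] {U : ℕ → ℕ} {b : ℕ}
    (hU : ∀ i < b, P i → U (Nat.count P i) = i) {k : ℕ} (hk : k < Nat.count P b) :
    U k < b ∧ P (U k) ∧ Nat.count P (U k) = k := by
  have h : k < Nat.count P b := hk
  have hmem : ∀ hf : (Set.ofPred P).Finite, k < hf.toFinset.card := fun hf =>
    h.trans_le (Nat.count_le_card hf b)
  have h1 : P (Nat.nth P k) := Nat.nth_mem k hmem
  have h2 : Nat.count P (Nat.nth P k) = k := Nat.count_nth hmem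
  have h3 : Nat.nth P k < b := Nat.nth_lt_of_lt_count h
  have := hU _ h3 h1
  rw [h2] at this
  rw [this]
  exact ⟨h3, h1, h2⟩

theorem sum_enum {F : Type*} [AddCommMonoid F] {P : ℕ → Prop} [DecidablePred P] {U : ℕ → ℕ}
    {b : ℕ} (hU : ∀ i < b, P i → U (Nat.count P i) = i) (f : ℕ → F) :
    ∑ i ∈ Finset.range b, (if P i then f i else 0) =
      ∑ k ∈ Finset.range (Nat.count P b), f (U k) := by
  induction b with
  | zero => simp
  | succ b ih =>
    rw [Finset.sum_range_succ, ih fun i hi => hU i (by omega), Nat.count_succ]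
    split_ifs with h
    · rw [Finset.sum_range_succ, hU b (by omega) h]
    · simp

/-! ### Blocks and the runs in which nothing goes wrong -/

/-- The `i`-th block of length `2 ^ j` of `S` occurs in `T` at `q`, at most `K` positions away. -/
def BlockMatch (S T : ℕ → ℕ) (K j i q : ℕ) : Prop :=
  i * 2 ^ j ≤ q + K ∧ q ≤ i * 2 ^ j + K ∧ WinEq S T j (i * 2 ^ j) q

/-- The `i`-th block of length `2 ^ j` of `S` does not occur in `T` near its position. -/
def Unmatched (S T : ℕ → ℕ) (K j i : ℕ) : Prop := ∀ q, ¬ BlockMatch S T K j i q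

/-- The block containing the `i`-th block of length `2 ^ j` is unmatched, or that block is the
top one. -/
def Unknown (S T : ℕ → ℕ) (K L j i : ℕ) : Prop := j < L → Unmatched S T K (j + 1) (i / 2)

noncomputable instance (S T : ℕ → ℕ) (K j : ℕ) : DecidablePred (Unmatched S T K j) :=
  Classical.decPred _

noncomputable instance (S T : ℕ → ℕ) (K L j : ℕ) : DecidablePred (Unknown S T K L j) :=
  Classical.decPred _

theorem half_mul_two_pow (i j : ℕ) : i * 2 ^ j = i / 2 * 2 ^ (j + 1) + i % 2 * 2 ^ j := by
  conv_lhs => rw [← Nat.div_add_mod i 2]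
  ring

/-- A half of a matched block keeps the shift of the whole block, so nearness is inherited as well.
-/
theorem BlockMatch.child {S T : ℕ → ℕ} {K j i q : ℕ} (h : BlockMatch S T K (j + 1) (i / 2) q) :
    BlockMatch S T K j i (q + i % 2 * 2 ^ j) := by
  obtain ⟨h1, h2, h3⟩ := h
  refine ⟨?_, ?_, fun x hx => ?_⟩
  · have e := half_mul_two_pow i j
    generalize i % 2 * 2 ^ j = c at *
    generalize i / 2 * 2 ^ (j + 1) = c at *
    omega
  · have e := half_mul_two_pow i j
    generalize i % 2 * 2 ^ j = c at *
    generalize i / 2 * 2 ^ (j + 1) = c at *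
    omega
  rw [half_mul_two_pow, add_assoc, add_assoc]
  refine h3 _ ?_
  rw [pow_succ]
  have : i % 2 * 2 ^ j ≤ 1 * 2 ^ j := Nat.mul_le_mul_right _ (by omega)
  omega

/-- At every length, at most `k` blocks of a string at edit distance `k` are unmatched. -/
theorem EditsTo.count_unmatched_le {k K : ℕ} {s t : List Bool} (h : EditsTo k s t) (hk : k ≤ K)
    (j J : ℕ) : Nat.count (Unmatched (bitAt s) (bitAt t) K j) J ≤ K := by
  obtain ⟨X, hX, hS⟩ := h.shiftedOff
  rw [Nat.count_eq_card_filter_range]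
  -- Every unmatched block contains a point of `X`: a block free of such points would reappear
  -- rigidly, at most k ≤ K positions away. Distinct blocks have distinct points, and `X` has at
  -- most k.
  refine le_trans (Finset.card_le_card (t := X.image (· / 2 ^ j)) fun i hi => ?_)
    (Finset.card_image_le.trans (hX.trans hk))
  have hi := (Finset.mem_filter.1 hi).2
  by_contra hc
  have hp : 0 < 2 ^ j := by positivity
  obtain ⟨δ, hδ, hm⟩ := hS (i * 2 ^ j) (i * 2 ^ j + 2 ^ j) (by omega) fun x hx h1 h2 => by
    refine hc (Finset.mem_image.2 ⟨x, hx, ?_⟩)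
    exact Nat.div_eq_of_lt_le h1 (by rw [add_mul]; omega)
  obtain ⟨y, hy, -⟩ := hm (i * 2 ^ j) le_rfl (by omega)
  rw [abs_le] at hδ
  refine hi y ⟨by omega, by omega, fun x hx => ?_⟩
  obtain ⟨z, hz, e⟩ := hm (i * 2 ^ j + x) (by omega) (by omega)
  rw [e]
  congr 1
  generalize i * 2 ^ j = c at *
  omega

theorem count_half {P : ℕ → Prop} [DecidablePred P] [DecidablePred fun i => P (i / 2)] (J : ℕ) :
    Nat.count (fun i => P (i / 2)) (2 * J) = 2 * Nat.count P J := by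
  induction J with
  | zero => simp
  | succ J ih =>
    have e : (2 * J + 1) / 2 = J := by omega
    have e' : 2 * J / 2 = J := by omega
    rw [show 2 * (J + 1) = 2 * J + 1 + 1 by ring, Nat.count_succ, Nat.count_succ, ih,
      Nat.count_succ]
    simp only [e, e']
    split_ifs <;> ring

/-- Below the top, the unknown blocks are the halves of the at most K unmatched blocks of the next
level. At the top there is one block, and 1 ≤ 2K. -/
theorem count_unknown_le {s t : List Bool} {K L j : ℕ} (hK : 1 ≤ K) (h : editDist s t ≤ K)
    (hj : j ≤ L) : Nat.count (Unknown (bitAt s) (bitAt t) K L j) (2 ^ (L - j)) ≤ 2 * K := by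
  rcases hj.eq_or_lt with rfl | hj
  · refine (Nat.count_le _).trans ?_
    rw [Nat.sub_self, pow_zero]; omega
  · classical
    have h1 : ∀ n, Nat.count (Unknown (bitAt s) (bitAt t) K L j) n =
        Nat.count (fun i => Unmatched (bitAt s) (bitAt t) K (j + 1) (i / 2)) n := fun n => by
      rw [Nat.count_eq_card_filter_range, Nat.count_eq_card_filter_range]
      congr 1
      ext i
      simp [Unknown, hj]
    rw [h1, show 2 ^ (L - j) = 2 * 2 ^ (L - (j + 1)) by
      rw [show L - j = L - (j + 1) + 1 by omega, pow_succ]; ring, count_half]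
    have := (show EditsTo (editDist s t) s t from Nat.sInf_mem (exists_editsTo s t))
    exact Nat.mul_le_mul_left _ (this.count_unmatched_le h _ _)

/-- No comparison of hashes that the protocol makes on these strings is misleading. -/
structure Good {p : ℕ} (S T : ℕ → ℕ) (n K L : ℕ) (a : ℕ → ZMod p) : Prop where
  block : ∀ j ≤ L, Nat.count (Unknown S T K L j) (2 ^ (L - j)) ≤ 2 * K →
    ∀ i < 2 ^ (L - j), Unknown S T K L j i → ∀ q, i * 2 ^ j ≤ q + K → q ≤ i * 2 ^ j + K →
    windowHash a S j (i * 2 ^ j) = windowHash a T j q → WinEq S T j (i * 2 ^ j) q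
  index : ∀ j ≤ L, Nat.count (Unknown S T K L j) (2 ^ (L - j)) ≤ 2 * K →
    ∀ i < 2 ^ (L - j), Unknown S T K L j i → ∀ i' < 2 ^ (L - j), Unknown S T K L j i' →
    indexHash a L i = indexHash a L i' → i = i'
  lv : ∀ e ≤ K, ∀ k < 2 * K + 3, ∀ b < L,
    windowHash a S (L - (b + 1)) (lv n K L (WinEq S T) e k b - 1) =
      windowHash a T (L - (b + 1)) (lv n K L (WinEq S T) e k b - 1 + k - (K + 1)) →
    WinEq S T (L - (b + 1)) (lv n K L (WinEq S T) e k b - 1)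
      (lv n K L (WinEq S T) e k b - 1 + k - (K + 1))

theorem ncard_biUnion_mul_le {α ι : Type*} (X : Finset ι) (A : ι → Set α) {m c d : ℕ}
    (h : ∀ i ∈ X, (A i).ncard * m ≤ c) (hd : X.card ≤ d) :
    (⋃ i ∈ X, A i).ncard * m ≤ d * c := by
  calc (⋃ i ∈ X, A i).ncard * m ≤ (∑ i ∈ X, (A i).ncard) * m :=
        Nat.mul_le_mul_right _ (X.set_ncard_biUnion_le A)
    _ = ∑ i ∈ X, (A i).ncard * m := Finset.sum_mul _ _ _
    _ ≤ X.card * c := by rw [← smul_eq_mul]; exact Finset.sum_le_card_nsmul _ _ _ h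
    _ ≤ d * c := Nat.mul_le_mul_right _ hd

/-- A union bound. It is efficient because the tests depend only on the strings: per level, at most
2K unknown blocks against 2K + 1 shifts and against each other, and the pairs visited by the exact
table. The total is a polynomial in K and L, not in n. -/
theorem ncard_not_good_mul_le {p w L n K : ℕ} [Fact p.Prime] (hwp : 2 ^ w ≤ p) (hK : 1 ≤ K)
    {S T : ℕ → ℕ} (hS : ∀ x, S x ≤ 1) (hT : ∀ x, T x ≤ 1) :
    {r : Fin (L * w) → Bool | ¬ Good S T n K L (seedMod p w (coinSeq r))}.ncard * 2 ^ w ≤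
      20 * K ^ 2 * (L + 1) ^ 2 * 2 ^ (L * w) := by
  classical
  -- The unknown blocks of a level, or none if there are too many. In the latter case `Good` demands
  -- nothing there, so the union has few terms even when the strings are far apart.
  let C : ℕ → Finset ℕ := fun j => if Nat.count (Unknown S T K L j) (2 ^ (L - j)) ≤ 2 * K then
    (Finset.range (2 ^ (L - j))).filter (Unknown S T K L j) else ∅
  have hC : ∀ j, (C j).card ≤ 2 * K := fun j => by
    simp only [C]; split
    · rwa [← Nat.count_eq_card_filter_range]
    · simp
  have hCm : ∀ j i, Nat.count (Unknown S T K L j) (2 ^ (L - j)) ≤ 2 * K → i < 2 ^ (L - j) →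
      Unknown S T K L j i → i ∈ C j := fun j i h1 h2 h3 => by
    simp only [C, if_pos h1, Finset.mem_filter, Finset.mem_range]; exact ⟨h2, h3⟩
  have hCl : ∀ j i, i ∈ C j → i < 2 ^ (L - j) := fun j i h => by
    simp only [C] at h; split at h
    · exact Finset.mem_range.1 (Finset.mem_filter.1 h).1
    · simp at h
  let a : (Fin (L * w) → Bool) → ℕ → ZMod p := fun r => seedMod p w (coinSeq r)
  let H : ℕ → ℕ → ℕ → Set (Fin (L * w) → Bool) := fun j i q =>
    {r | windowHash (a r) S j i = windowHash (a r) T j q ∧ ¬ WinEq S T j i q}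
  have hH : ∀ j i q, j ≤ L → (H j i q).ncard * 2 ^ w ≤ L * 2 ^ (L * w) := fun j i q hj => by
    by_cases h : WinEq S T j i q
    · simp [H, h]
    · simp only [H, h, not_false_iff, and_true]
      exact (windowHash_collision hwp hS hT hj h).trans (Nat.mul_le_mul_right _ hj)
  let G : ℕ → ℕ → Set (Fin (L * w) → Bool) := fun i q =>
    {r | indexHash (a r) L i = indexHash (a r) L q ∧ i ≠ q}
  have hG : ∀ i q, i < 2 ^ L → q < 2 ^ L → (G i q).ncard * 2 ^ w ≤ 2 ^ (L * w) :=
    fun i q hi hq => by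
    by_cases h : i = q
    · simp [G, h]
    · simp only [G, h, ne_eq, not_false_iff, and_true]
      exact indexHash_collision hwp hi hq h
  let B₁ := ⋃ j ∈ Finset.range (L + 1), ⋃ i ∈ C j, ⋃ d ∈ Finset.range (2 * K + 1),
    H j (i * 2 ^ j) (i * 2 ^ j + d - K)
  let B₂ := ⋃ j ∈ Finset.range (L + 1), ⋃ i ∈ C j, ⋃ i' ∈ C j, G i i'
  let B₃ := ⋃ e ∈ Finset.range (K + 1), ⋃ k ∈ Finset.range (2 * K + 3), ⋃ b ∈ Finset.range L,
    H (L - (b + 1)) (lv n K L (WinEq S T) e k b - 1)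
      (lv n K L (WinEq S T) e k b - 1 + k - (K + 1))
  have h1 : B₁.ncard * 2 ^ w ≤ (L + 1) * (2 * K * ((2 * K + 1) * (L * 2 ^ (L * w)))) :=
    ncard_biUnion_mul_le _ _ (fun j hj => ncard_biUnion_mul_le _ _ (fun i _ =>
      ncard_biUnion_mul_le _ _ (fun d _ => hH _ _ _ (by have := Finset.mem_range.1 hj; omega))
        (by simp)) (hC j)) (by simp)
  have h2 : B₂.ncard * 2 ^ w ≤ (L + 1) * (2 * K * (2 * K * 2 ^ (L * w))) :=
    ncard_biUnion_mul_le _ _ (fun j hj => ncard_biUnion_mul_le _ _ (fun i hi =>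
      ncard_biUnion_mul_le _ _ (fun i' hi' => hG _ _
        ((hCl j i hi).trans_le (Nat.pow_le_pow_right (by norm_num) (by omega)))
        ((hCl j i' hi').trans_le (Nat.pow_le_pow_right (by norm_num) (by omega))))
        (hC j)) (hC j)) (by simp)
  have h3 : B₃.ncard * 2 ^ w ≤ (K + 1) * ((2 * K + 3) * (L * (L * 2 ^ (L * w)))) :=
    ncard_biUnion_mul_le _ _ (fun e _ => ncard_biUnion_mul_le _ _ (fun k _ =>
      ncard_biUnion_mul_le _ _ (fun b _ => hH _ _ _ (by omega)) (by simp)) (by simp)) (by simp)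
  have hsub : {r : Fin (L * w) → Bool | ¬ Good S T n K L (seedMod p w (coinSeq r))} ⊆
      B₁ ∪ B₂ ∪ B₃ := by
    intro r hr
    by_contra hc
    refine hr ⟨fun j hj hf i hi hu q hq1 hq2 he => ?_, fun j hj hf i hi hu i' hi' hu' he => ?_,
      fun e he k hk b hb heq => ?_⟩ <;> by_contra hn <;> refine hc ?_
    · refine Or.inl (Or.inl ?_)
      simp only [B₁, Set.mem_iUnion, Finset.mem_range]
      refine ⟨j, by omega, i, hCm j i hf hi hu, q + K - i * 2 ^ j, by omega, ?_⟩
      rw [show i * 2 ^ j + (q + K - i * 2 ^ j) - K = q by omega]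
      exact ⟨he, hn⟩
    · refine Or.inl (Or.inr ?_)
      simp only [B₂, Set.mem_iUnion, Finset.mem_range]
      exact ⟨j, by omega, i, hCm j i hf hi hu, i', hCm j i' hf hi' hu', he, hn⟩
    · refine Or.inr ?_
      simp only [B₃, Set.mem_iUnion, Finset.mem_range]
      exact ⟨e, by omega, k, hk, b, hb, heq, hn⟩
  have h4 := (Set.ncard_le_ncard hsub).trans ((Set.ncard_union_le _ _).trans
    (Nat.add_le_add_right (Set.ncard_union_le _ _) _))
  calc _ ≤ (B₁.ncard + B₂.ncard + B₃.ncard) * 2 ^ w := Nat.mul_le_mul_right _ h4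
    _ ≤ (L + 1) * (2 * K * ((2 * K + 1) * (L * 2 ^ (L * w)))) +
        (L + 1) * (2 * K * (2 * K * 2 ^ (L * w))) +
        (K + 1) * ((2 * K + 3) * (L * (L * 2 ^ (L * w)))) := by
      rw [add_mul, add_mul]; exact Nat.add_le_add (Nat.add_le_add h1 h2) h3
    _ = ((L + 1) * (2 * K * ((2 * K + 1) * L)) + (L + 1) * (2 * K * (2 * K)) +
        (K + 1) * ((2 * K + 3) * (L * L))) * 2 ^ (L * w) := by ring
    _ ≤ _ := by
      refine Nat.mul_le_mul_right _ ?_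
      -- Written in K - 1 and L, the inequality can be checked with products of nonnegative terms.
      obtain ⟨k, rfl⟩ : ∃ k, K = k + 1 := ⟨K - 1, by omega⟩
      have : 0 ≤ L := Nat.zero_le _
      ring_nf
      nlinarith [mul_nonneg (Nat.zero_le k) this, Nat.zero_le (k * L ^ 2), Nat.zero_le (k ^ 2 * L),
        Nat.zero_le (k ^ 2 * L ^ 2)]

/-! ### Parameters of the protocol -/

/-- The parameters: strings of length `n`, threshold `K`, and error exponent `d`. -/
structure Par (d : ℕ) where
  n : ℕ
  K : ℕ
  three_le : 3 ≤ n
  one_le : 1 ≤ K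
  K_le : K ≤ n

theorem exists_prime_ge (M : ℕ) : ∃ p, p.Prime ∧ M ≤ p :=
  let ⟨p, h, hp⟩ := Nat.exists_infinite_primes M; ⟨p, hp, h⟩

namespace Par

variable {d : ℕ} (P : Par d)

/-- The number of levels. -/
def L : ℕ := P.n.size
/-- The padded length. -/
def N : ℕ := 2 ^ P.L
/-- The basic small quantity. -/
def Y : ℕ := 20 * P.K * (P.L + 1)
/-- A lower bound for the number of seed values. -/
def X : ℕ := P.Y ^ (d + 2)
/-- The number of bits of a seed. -/
def w : ℕ := P.X.size
/-- The number of seed values. -/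
def M : ℕ := 2 ^ P.w
/-- The modulus. -/
def p : ℕ := Nat.find (exists_prime_ge P.M)
/-- The number of syndromes per level, and also the number of shifts. -/
def KK : ℕ := 2 * P.K + 1
/-- The number of window positions. -/
def Z : ℕ := 2 * P.N
/-- A bound for the length of every loop. -/
def TB : ℕ := 4 * P.N * (P.L + 1) + P.Y ^ (2 * d + 8)
/-- The word length. -/
def W : ℕ := (4 * P.N * P.M + P.TB).size
/-- The unit of time. -/
def U : ℕ := (P.TB + 1) * P.W

theorem n_lt : P.n < P.N := Nat.lt_size_self P.n
theorem L_pos : 2 ≤ P.L := Nat.lt_size.2 (by simpa using (by have := P.three_le; omega : 2 ≤ P.n))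
theorem N_pos : 0 < P.N := by unfold N; positivity
theorem M_pos : 0 < P.M := by unfold M; positivity
theorem L_lt_N : P.L < P.N := Nat.lt_two_pow_self
theorem Y_ge : 20 * (P.L + 1) ≤ P.Y := by
  have := Nat.mul_le_mul_right (20 * (P.L + 1)) P.one_le
  unfold Y; nlinarith
theorem Y_ge' : 60 * P.K ≤ P.Y := by
  have := Nat.mul_le_mul_right (20 * P.K) P.L_pos
  unfold Y; nlinarith
theorem Y_pos : 60 ≤ P.Y := by have := P.Y_ge; have := P.L_pos; omega
theorem p_prime : P.p.Prime := (Nat.find_spec (exists_prime_ge P.M)).1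
theorem M_le_p : P.M ≤ P.p := (Nat.find_spec (exists_prime_ge P.M)).2
instance : Fact P.p.Prime := ⟨P.p_prime⟩
theorem X_lt_M : P.X < P.M := Nat.lt_size_self _
theorem X_pos : 60 ≤ P.X := by
  have := P.Y_pos
  calc 60 ≤ P.Y := this
    _ = P.Y ^ 1 := (pow_one _).symm
    _ ≤ P.X := Nat.pow_le_pow_right (by omega) (by omega)
theorem M_le : P.M ≤ 2 * P.X := by
  have h : P.w - 1 < P.w := by
    have : 0 < P.w := Nat.size_pos.2 (by have := P.X_pos; omega)
    omega
  have h2 := Nat.lt_size.1 h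
  unfold M
  rw [show P.w = P.w - 1 + 1 by omega, pow_succ]
  omega
-- Bertrand's postulate. It keeps residues within w + 1 binary digits and makes the search for the
-- prime short.
theorem p_le : P.p ≤ 2 * P.M := by
  obtain ⟨q, hq, h1, h2⟩ := Nat.exists_prime_lt_and_le_two_mul P.M P.M_pos.ne'
  exact (Nat.find_min' (exists_prime_ge P.M) ⟨hq, h1.le⟩).trans h2
theorem p_pos : 0 < P.p := P.p_prime.pos
theorem w_lt_M : P.w < P.M := Nat.lt_two_pow_self
theorem KK_pos : 3 ≤ P.KK := by have := P.one_le; unfold KK; omega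
theorem KK_le : P.KK ≤ P.Y := by have := P.one_le; have := P.Y_ge'; unfold KK; omega

theorem lt_pow_W {x : ℕ} (h : x ≤ 4 * P.N * P.M + P.TB) : x < 2 ^ P.W :=
  h.trans_lt (Nat.lt_size_self _)

theorem TB_lt : P.TB < 2 ^ P.W := P.lt_pow_W (by omega)

theorem W_pos : 1 ≤ P.W := Nat.size_pos.2 (by have := P.M_pos; have := P.N_pos; positivity)

theorem W_le_U : P.W ≤ P.U := Nat.le_mul_of_pos_left _ (Nat.succ_pos _)

theorem Y_pow_le {k : ℕ} (h : k ≤ 2 * d + 8) : P.Y ^ k ≤ P.TB :=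
  (Nat.pow_le_pow_right (by have := P.Y_pos; omega) h).trans (by unfold TB; omega)

theorem p_le_Y : P.p ≤ P.Y ^ (d + 3) := by
  have h1 := P.p_le
  have h2 := P.M_le
  have h3 := P.Y_pos
  rw [pow_succ]
  have : P.X * 60 ≤ P.X * P.Y := Nat.mul_le_mul_left _ h3
  unfold X at *; omega

/-- Trial division for the modulus takes on the order of M² rounds, and M is of order Y^(d+2). The
exponent 2d + 8 in `TB` leaves room for this. -/
theorem sq_M_le : 4 * P.M * P.M + 4 ≤ P.TB := by
  have h2 := P.M_le
  have h3 := P.Y_pos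
  have h4 : P.X * P.X * (60 * 60) ≤ P.X * P.X * (P.Y * P.Y) :=
    Nat.mul_le_mul_left _ (Nat.mul_le_mul h3 h3)
  have h5 : P.X * P.X * (P.Y * P.Y) = P.Y ^ (2 * d + 6) := by unfold X; ring
  have h6 := P.Y_pow_le (k := 2 * d + 6) (by omega)
  have h7 := P.X_pos
  nlinarith

theorem M_le_TB : P.M ≤ P.TB := by
  have := P.sq_M_le; have := P.M_pos; nlinarith

theorem N_le_TB : 4 * P.N * (P.L + 1) ≤ P.TB := by unfold TB; omega

theorem Z_mul_le : P.Z * (P.L + 1) ≤ P.TB := by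
  have := P.N_le_TB; unfold Z; nlinarith [Nat.zero_le (P.N * (P.L + 1))]

theorem N_mul_le : P.N * (P.L + 1) ≤ P.TB := by
  have := P.N_le_TB; nlinarith [Nat.zero_le (P.N * (P.L + 1))]

theorem N4_le : 4 * P.N ≤ P.TB := by
  have := P.N_le_TB; nlinarith [Nat.zero_le (P.N * P.L)]

end Par

/-- The time of straight programs and scans, in units. -/
def Prog.wt : Prog → ℕ
  | .skip => 1
  | .assign _ e => e.wt + 1
  | .store _ i e => i.wt + e.wt + i.deg + 1
  | .flip _ => 1
  | .seq p q => p.wt + q.wt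
  | .ite e p q => e.wt + 1 + p.wt + q.wt
  | .loop e p => e.wt + 1 + p.wt + 20

/-- The program `p` takes `σ` to `τ` in as many units of time as its weight. -/
def RunsU {d : ℕ} (P : Par d) (p : Prog) (σ τ : State) : Prop := Runs p σ τ (p.wt * P.U)

theorem RunsU.seq {d : ℕ} {P : Par d} {p q : Prog} {σ τ υ : State} (hp : RunsU P p σ τ)
    (hq : RunsU P q τ υ) : RunsU P (.seq p q) σ υ :=
  (Runs.seq hp hq).mono (le_of_eq (add_mul _ _ _).symm)

theorem RunsU.assign {d : ℕ} {P : Par d} {σ : State} (h : Bdd P.W σ) (x : ℕ) (e : Expr) :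
    RunsU P (.assign x e) σ (σ.setVar x (e.eval σ)) :=
  (Runs.assign P.W_pos h x e).mono ((mul_comm _ _).le.trans (Nat.mul_le_mul_left _ P.W_le_U))

/-- Two registers and `y = 2 ^ x`, where `x` is the bit length of `e`. -/
def sizeProg (x y : ℕ) (e : Expr) : Prog :=
  .seq (.assign y 1) (.seq (.assign x 0)
    (.loop ((Expr.var y).ltE (e + 1)) (.seq (.assign y (.var y * 2)) (.assign x (.var x + 1)))))

/-- The loop keeps y = 2^x and runs while y does not exceed the value, that is, while x is less than
its bit length. The expression must not depend on the two registers that the loop changes. -/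
theorem sizeProg_runs {d : ℕ} (P : Par d) {σ : State} (hσ : Bdd P.W σ) {x y t : ℕ} {e : Expr}
    (hxy : x ≠ y) (he : ∀ i k, e.eval ((σ.setVar y i).setVar x k) = t) (ht : 2 ^ t.size ≤ P.TB)
    (hte : t.size ≤ P.TB) :
    RunsU P (sizeProg x y e) σ ((σ.setVar y (2 ^ t.size)).setVar x t.size) ∧
      Bdd P.W ((σ.setVar y (2 ^ t.size)).setVar x t.size) := by
  have hW := P.W_pos
  have hlt : ∀ k ≤ t.size, 2 ^ k < 2 ^ P.W := fun k hk =>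
    (((Nat.pow_le_pow_right (by norm_num) hk).trans ht).trans_lt P.TB_lt)
  have hB : ∀ k ≤ t.size, Bdd P.W ((σ.setVar y (2 ^ k)).setVar x k) := fun k hk =>
    (hσ.setVar (hlt k hk)).setVar (lt_trans Nat.lt_two_pow_self (hlt k hk))
  have r1 := Runs.assign hW hσ y 1
  have hB1 : Bdd P.W (σ.setVar y 1) := hσ.setVar (by simpa using hlt 0 (Nat.zero_le _))
  have r2 := Runs.assign hW hB1 x 0
  obtain ⟨τ, r3, ⟨k, hk, rfl⟩, h0⟩ := Runs.loop hW (e := (Expr.var y).ltE (e + 1))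
    (p := .seq (.assign y (.var y * 2)) (.assign x (.var x + 1))) (t := P.W * 16 + P.W * 13)
    (fun τ => ∃ k ≤ t.size, τ = (σ.setVar y (2 ^ k)).setVar x k) (fun τ => t.size - τ.var x)
    (by rintro τ ⟨k, hk, rfl⟩; exact hB k hk)
    (by
      rintro τ ⟨k, hk, rfl⟩ hne
      have hk' : k < t.size := by
        rw [Nat.lt_size]
        simp [he, hxy.symm] at hne
        omega
      have q1 := Runs.assign hW (hB k hk) y (.var y * 2)
      have e1 : (((σ.setVar y (2 ^ k)).setVar x k).setVar y
          ((Expr.var y * 2).eval ((σ.setVar y (2 ^ k)).setVar x k))).setVar x (k + 1) =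
          (σ.setVar y (2 ^ (k + 1))).setVar x (k + 1) := by
        simp [State.setVar, hxy.symm, Function.update_comm hxy, pow_succ]
      have q2 := Runs.assign hW (σ := ((σ.setVar y (2 ^ k)).setVar x k).setVar y
          ((Expr.var y * 2).eval ((σ.setVar y (2 ^ k)).setVar x k)))
        ((hB k hk).setVar (by
          simp [hxy.symm, ← pow_succ]; simpa using hlt (k + 1) hk')) x (.var x + 1)
      have e2 : (Expr.var x + 1).eval (((σ.setVar y (2 ^ k)).setVar x k).setVar y
          ((Expr.var y * 2).eval ((σ.setVar y (2 ^ k)).setVar x k))) = k + 1 := by simp [hxy]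
      rw [e2, e1] at q2
      exact ⟨_, q1.seq q2, ⟨k + 1, hk', rfl⟩, by simp; omega⟩)
    ((σ.setVar y 1).setVar x ((0 : Expr).eval (σ.setVar y 1))) ⟨0, Nat.zero_le _, by simp⟩
  have hkt : k = t.size := by
    refine le_antisymm hk (Nat.size_le.2 ?_)
    simp [he, hxy.symm] at h0
    omega
  subst hkt
  refine ⟨((r1.seq (r2.seq r3))).mono ?_, hB _ le_rfl⟩
  have w1 : (1 : Expr).wt = 3 := rfl
  have w0 : (0 : Expr).wt = 2 := rfl
  have w2 : ((Expr.var y).ltE (e + 1)).wt = 2 + (e.wt + 3 + 1 + 2 * (e.deg + 2)) + 1 +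
    2 * (1 + (e.deg + 2)) := rfl
  rw [w1, w0, w2]
  have e0 : ((σ.setVar y 1).setVar x ((0 : Expr).eval (σ.setVar y 1))).var x = 0 := by simp
  rw [e0, Nat.sub_zero]
  have w3 : (sizeProg x y e).wt = e.wt + 4 * e.deg + 74 := by
    change 3 + 1 + (2 + 1 + (2 + (e.wt + 3 + 1 + 2 * (e.deg + 2)) + 1 + 2 * (1 + (e.deg + 2)) + 1 +
      (15 + 1 + (12 + 1)) + 20)) = _
    ring
  rw [w3]
  unfold Par.U
  have h3 := Nat.mul_le_mul_right (P.W * (2 + (e.wt + 3 + 1 + 2 * (e.deg + 2)) + 1 +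
      2 * (1 + (e.deg + 2)) + 1) + (P.W * 16 + P.W * 13)) (show t.size + 1 ≤ P.TB + 1 by omega)
  have h4 : P.W ≤ (P.TB + 1) * P.W := Nat.le_mul_of_pos_left _ (Nat.succ_pos _)
  have h5 : P.W * (3 + 1) + P.W * (2 + 1) ≤ ((P.TB + 1) * P.W) * 7 := by omega
  refine (le_of_eq (add_assoc _ _ _).symm).trans ((Nat.add_le_add h5 h3).trans ?_)
  generalize (P.TB + 1) = v
  generalize P.W = u
  calc _ = (e.wt + 4 * e.deg + 54) * (v * u) := by ring
    _ ≤ _ := Nat.mul_le_mul_right _ (by omega)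

/-- The least prime that is at least register `6`, in register `7`. -/
def primeProg : Prog :=
  .seq (.assign 7 (.var 6)) (.seq (.assign 8 2) (.loop ((Expr.var 8).ltE (.var 7))
    (.ite (Expr.var 7 % Expr.var 8) (.assign 8 (.var 8 + 1))
      (.seq (.assign 7 (.var 7 + 1)) (.assign 8 2)))))

/-- Trial division: register `8` runs through possible divisors of the candidate in register `7`,
and a divisor found moves on to the next candidate. The loop ends when the divisor reaches the
candidate, which then has no smaller divisor above 1. -/
theorem primeProg_runs {d : ℕ} (P : Par d) {σ : State} (hσ : Bdd P.W σ) (hM : σ.var 6 = P.M) :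
    ∃ i, RunsU P primeProg σ ((σ.setVar 7 P.p).setVar 8 i) ∧
      Bdd P.W ((σ.setVar 7 P.p).setVar 8 i) := by
  have hW := P.W_pos
  have hM2 : 60 ≤ P.M := P.X_pos.trans P.X_lt_M.le
  have hsq := P.sq_M_le
  have hTB := P.TB_lt
  have hp2 := P.p_le
  have hMp := P.M_le_p
  have hpW : P.p < 2 ^ P.W := by nlinarith
  have hB : ∀ q i, q ≤ P.p → i ≤ P.p → Bdd P.W ((σ.setVar 7 q).setVar 8 i) := fun q i hq hi =>
    (hσ.setVar (hq.trans_lt hpW)).setVar (hi.trans_lt hpW)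
  have r1 := Runs.assign hW hσ 7 (.var 6)
  have hB1 : Bdd P.W (σ.setVar 7 ((Expr.var 6).eval σ)) := hσ.setVar (hσ.1 6)
  have r2 := Runs.assign hW hB1 8 2
  obtain ⟨τ, r3, ⟨q, i, h1, h2, h3, h4, h5, rfl⟩, h0⟩ := Runs.loop hW
    (e := (Expr.var 8).ltE (.var 7))
    (p := .ite (Expr.var 7 % Expr.var 8) (.assign 8 (.var 8 + 1))
      (.seq (.assign 7 (.var 7 + 1)) (.assign 8 2)))
    (t := P.W * 40)
    (fun τ => ∃ q i, P.M ≤ q ∧ q ≤ P.p ∧ 2 ≤ i ∧ i ≤ q ∧ (∀ m, 2 ≤ m → m < i → ¬ m ∣ q) ∧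
      τ = (σ.setVar 7 q).setVar 8 i)
    -- A lexicographic measure: candidates still to come, then divisors still to try.
    (fun τ => (P.p - τ.var 7) * (P.p + 1) + (τ.var 7 - τ.var 8))
    (by rintro τ ⟨q, i, h1, h2, h3, h4, h5, rfl⟩; exact hB q i h2 (h4.trans h2))
    (by
      rintro τ ⟨q, i, h1, h2, h3, h4, h5, rfl⟩ hne
      have hiq : i < q := by simpa using hne
      have hb := hB q i h2 (h4.trans h2)
      have hc := (Expr.var 7 % Expr.var 8).cost_le hW hb
      have hw : (Expr.var 7 % Expr.var 8).wt = 9 := rfl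
      rw [hw] at hc
      by_cases hdvd : i ∣ q
      -- A divisor strictly between 1 and the candidate excludes the prime itself, so the search
      -- never passes it.
      · have hqp : q ≠ P.p := by
          rintro rfl
          rcases (Nat.dvd_prime P.p_prime).1 hdvd with h | h <;> omega
        have q1 := Runs.assign hW hb 7 (.var 7 + 1)
        have q2 := Runs.assign hW (hb.setVar (x := 7) (k := (Expr.var 7 + 1).eval
          ((σ.setVar 7 q).setVar 8 i)) (by simp; omega)) 8 2
        obtain ⟨T, hT, hx⟩ := q1.seq q2
        have e1 : ((((σ.setVar 7 q).setVar 8 i).setVar 7 ((Expr.var 7 + 1).eval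
          ((σ.setVar 7 q).setVar 8 i)))).setVar 8 ((2 : Expr).eval (((σ.setVar 7 q).setVar 8 i).setVar 7
          ((Expr.var 7 + 1).eval ((σ.setVar 7 q).setVar 8 i)))) =
          (σ.setVar 7 (q + 1)).setVar 8 2 := by
          simp [State.setVar, Function.update_comm (show (8 : ℕ) ≠ 7 by norm_num)]
        rw [e1] at hx
        have w1 : (Expr.var 7 + 1 : Expr).wt = 12 := rfl
        have w2 : (2 : Expr).wt = 4 := rfl
        rw [w1, w2] at hT
        refine ⟨_, ⟨_, ?_, .iteFalse ?_ hx⟩, ⟨q + 1, 2, by omega, by omega, le_rfl, by omega,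
          by omega, rfl⟩, ?_⟩
        · omega
        · simpa using Nat.mod_eq_zero_of_dvd hdvd
        · obtain ⟨z, hz⟩ : ∃ z, P.p = q + 1 + z := ⟨P.p - (q + 1), by omega⟩
          simp only [State.setVar_var]
          norm_num
          rw [show P.p - q = P.p - (q + 1) + 1 by omega, add_mul, one_mul]
          omega
      · obtain ⟨T, hT, hx⟩ := Runs.assign hW hb 8 (.var 8 + 1)
        have e1 : ((σ.setVar 7 q).setVar 8 i).setVar 8 ((Expr.var 8 + 1).eval
          ((σ.setVar 7 q).setVar 8 i)) = (σ.setVar 7 q).setVar 8 (i + 1) := by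
          simp [State.setVar]
        rw [e1] at hx
        have w1 : (Expr.var 8 + 1 : Expr).wt = 12 := rfl
        rw [w1] at hT
        refine ⟨_, ⟨_, ?_, .iteTrue ?_ hx⟩, ⟨q, i + 1, h1, h2, by omega, by omega, ?_, rfl⟩, ?_⟩
        · omega
        · simpa using fun h => hdvd (Nat.dvd_of_mod_eq_zero h)
        · intro m hm hmi
          rcases Nat.lt_succ_iff_lt_or_eq.1 hmi with h | rfl
          · exact h5 m hm h
          · exact hdvd
        · simp only [State.setVar_var]
          norm_num
          omega)
    ((σ.setVar 7 ((Expr.var 6).eval σ)).setVar 8 ((2 : Expr).eval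
      (σ.setVar 7 ((Expr.var 6).eval σ))))
    ⟨P.M, 2, le_rfl, P.M_le_p, le_rfl, by omega, by omega, by simp [hM]⟩
  have hiq : i = q := by simp at h0; omega
  have hq : q = P.p := by
    refine le_antisymm h2 (Nat.find_min' (exists_prime_ge P.M) ⟨?_, h1⟩)
    rw [Nat.prime_def]
    refine ⟨by omega, fun m hm => ?_⟩
    by_contra hc
    push Not at hc
    have hm0 : m ≠ 0 := by rintro rfl; have := zero_dvd_iff.1 hm; omega
    have := Nat.le_of_dvd (by omega) hm
    exact h5 m (by omega) (by omega) hm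
  subst hq
  refine ⟨i, (r1.seq (r2.seq r3)).mono ?_, hB _ _ le_rfl (h4.trans h2)⟩
  have w1 : (Expr.var 6).wt = 2 := rfl
  have w2 : (2 : Expr).wt = 4 := rfl
  have w3 : ((Expr.var 8).ltE (.var 7)).wt = 9 := rfl
  have w4 : primeProg.wt = 79 := rfl
  rw [w1, w2, w3, w4]
  simp only [State.setVar_var]
  norm_num
  rw [hM]
  -- At most M candidates are rejected, each after at most 2M + 1 steps, by p ≤ 2M.
  have hm : (P.p - P.M) * (P.p + 1) + (P.M - 2) + 1 ≤ P.TB + 1 := by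
    have : (P.p - P.M) * (P.p + 1) ≤ P.M * (2 * P.M + 1) :=
      Nat.mul_le_mul (by omega) (by omega)
    have h : P.M - 2 ≤ P.M := Nat.sub_le _ _
    nlinarith
  have h6 := Nat.mul_le_mul_right (P.W * 10 + P.W * 40) hm
  have h7 := P.W_le_U
  unfold Par.U at *
  nlinarith

/-- The power `e ^ k`. -/
def Expr.powE (e : Expr) : ℕ → Expr
  | 0 => 1
  | k + 1 => powE e k * e

@[simp] theorem Expr.eval_powE (σ : State) (e : Expr) (k : ℕ) :
    (e.powE k).eval σ = e.eval σ ^ k := by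
  induction k with
  | zero => rfl
  | succ k ih => rw [powE, eval_mul, ih, pow_succ]

/-- The registers hold the parameters. -/
structure Regs {d : ℕ} (P : Par d) (σ : State) : Prop where
  bdd : Bdd P.W σ
  n : σ.var 0 = P.n
  K : σ.var 1 = P.K
  L : σ.var 3 = P.L
  N : σ.var 4 = P.N
  w : σ.var 5 = P.w
  M : σ.var 6 = P.M
  p : σ.var 7 = P.p

/-- Computing the parameters. -/
def setup (d : ℕ) : Prog :=
  .seq (sizeProg 3 4 (.var 0)) (.seq (sizeProg 5 6 ((20 * .var 1 * (.var 3 + 1) : Expr).powE (d + 2)))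
    primeProg)

theorem setup_runs {d : ℕ} (P : Par d) {σ : State} (hσ : Bdd P.W σ) (hn : σ.var 0 = P.n)
    (hK : σ.var 1 = P.K) :
    ∃ τ, RunsU P (setup d) σ τ ∧ Regs P τ ∧ τ.arr = σ.arr ∧ τ.coins = σ.coins ∧
      ∀ y, y < 3 ∨ 9 ≤ y → τ.var y = σ.var y := by
  obtain ⟨r1, b1⟩ := sizeProg_runs P hσ (x := 3) (y := 4) (t := P.n) (e := .var 0) (by norm_num)
    (by simp [hn]) (by have := P.N4_le; unfold Par.N Par.L at this; omega)
    (by have := P.N4_le; have := P.L_lt_N; unfold Par.L at this; omega)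
  obtain ⟨r2, b2⟩ := sizeProg_runs P b1 (x := 5) (y := 6) (t := P.X)
    (e := (20 * .var 1 * (.var 3 + 1) : Expr).powE (d + 2)) (by norm_num)
    (by simp [hK]; rfl) (by have := P.M_le_TB; unfold Par.M Par.w at this; omega)
    (by have := P.M_le_TB; have := P.w_lt_M; unfold Par.w at this; omega)
  obtain ⟨i, r3, b3⟩ := primeProg_runs P b2 (by simp; rfl)
  refine ⟨_, r1.seq (r2.seq r3), ⟨b3, ?_, ?_, ?_, ?_, ?_, ?_, ?_⟩, rfl, rfl, ?_⟩
  · simp [hn]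
  · simp [hK]
  · simp; rfl
  · simp; rfl
  · simp; rfl
  · simp; rfl
  · simp
  · intro y hy
    simp only [State.setVar_var]
    rw [if_neg (by omega), if_neg (by omega), if_neg (by omega), if_neg (by omega),
      if_neg (by omega), if_neg (by omega)]

section

variable {d : ℕ} {P : Par d}

theorem Regs.scanSt {σ : State} (h : Regs P σ) {a k : ℕ} {f : ℕ → ℕ}
    (hb : Bdd P.W (scanSt σ a k f)) : Regs P (scanSt σ a k f) :=
  ⟨hb, by simp [h.n], by simp [h.K], by simp [h.L], by simp [h.N], by simp [h.w], by simp [h.M],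
    by simp [h.p]⟩

theorem Regs.setVar {σ : State} (h : Regs P σ) {x k : ℕ} (hx : 8 ≤ x) (hk : k < 2 ^ P.W) :
    Regs P (σ.setVar x k) := by
  refine ⟨h.bdd.setVar hk, ?_, ?_, ?_, ?_, ?_, ?_, ?_⟩ <;> rw [State.setVar_var, if_neg (by omega)]
  exacts [h.n, h.K, h.L, h.N, h.w, h.M, h.p]

/-- Scans whose values are reduced by a modulus. -/
theorem Regs.scan {σ : State} (h : Regs P σ) {bnd I E m : Expr} {a b μ : ℕ}
    (hb : ∀ k f, bnd.eval (DocExchange.scanSt σ a k f) = b) (hbT : b ≤ P.TB)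
    (hm : ∀ k f, m.eval (DocExchange.scanSt σ a k f) = μ) (hμ : 0 < μ)
    (hμ' : μ ≤ 4 * P.N * P.M + P.TB) :
    RunsU P (DocExchange.scan bnd a I (E % m)) σ
      (DocExchange.scanSt σ a b (scanF σ a I (E % m) b)) ∧
      Regs P (DocExchange.scanSt σ a b (scanF σ a I (E % m) b)) := by
  obtain ⟨h1, h2⟩ := scan_runs P.W_pos h.bdd (I := I) (E := E % m) hb (hbT.trans_lt P.TB_lt)
    (fun k f _ => by
      rw [Expr.eval_mod, hm]
      exact (Nat.mod_lt _ hμ).trans (P.lt_pow_W hμ'))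
  refine ⟨h1.mono ?_, h.scanSt h2⟩
  have : (b + 1) * P.W ≤ P.U := Nat.mul_le_mul_right _ (by omega)
  calc (b + 1) * (P.W * scanWt bnd I (E % m)) = (b + 1) * P.W * scanWt bnd I (E % m) := by ring
    _ ≤ P.U * (DocExchange.scan bnd a I (E % m)).wt := by
      refine Nat.mul_le_mul this ?_
      have : (DocExchange.scan bnd a I (E % m)).wt = 2 + 1 + (2 + bnd.wt + 1 + 2 * (1 + bnd.deg) + 1 +
        (I.wt + (E % m).wt + I.deg + 1 + (12 + 1)) + 20) := rfl
      rw [this, scanWt]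
      omega
    _ = _ := mul_comm _ _

end

/-- The threshold. -/
abbrev eK : Expr := .var 1
/-- The number of levels. -/
abbrev eL : Expr := .var 3
/-- The padded length. -/
abbrev eN : Expr := .var 4
/-- The number of bits of a seed. -/
abbrev ew : Expr := .var 5
/-- The number of seed values. -/
abbrev eM : Expr := .var 6
/-- The modulus. -/
abbrev ep : Expr := .var 7
/-- The counter of a scan. -/
abbrev ec : Expr := .var 9
/-- The number of syndromes per level. -/
abbrev eKK : Expr := 2 * .var 1 + 1
/-- The number of window positions. -/
abbrev eZ : Expr := 2 * .var 4

/-- `τ` differs from `σ` only in array `a` and register `9`. -/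
def Only (a : ℕ) (σ τ : State) : Prop :=
  (∀ y, y ≠ 9 → τ.var y = σ.var y) ∧ (∀ b, b ≠ a → τ.arr b = σ.arr b) ∧ τ.coins = σ.coins

theorem only_scanSt (a : ℕ) (σ : State) (k : ℕ) (f : ℕ → ℕ) : Only a σ (scanSt σ a k f) :=
  ⟨fun y hy => by simp [hy], fun b hb => by simp [hb], rfl⟩

/-- Powers of two, in array `3`. -/
def powProg : Prog :=
  scan (eL + ew + 1) 3 ec ((ec.eqE 0).sel 1 (2 * .get 3 (ec - 1)) % (4 * eN * eM))

/-- The seeds modulo `p`, in array `4`, from their bits in array `1`. -/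
def seedProg : Prog :=
  scan (eL * ew) 4 (ec / ew) ((.get 4 (ec / ew) + .get 1 ec * .get 3 (ec % ew)) % ep)

/-- All hashes of windows of array `src`, in array `dst`. -/
def hashProg (src dst : ℕ) : Prog :=
  scan ((eL + 1) * eZ) dst ec ((ec.ltE eZ).sel (.get src ec) (.get dst (ec - eZ) +
    .get 4 (ec / eZ - 1) * ((ec % eZ + .get 3 (ec / eZ - 1)).ltE eZ *
      .get dst (ec - eZ + .get 3 (ec / eZ - 1)))) % ep)

/-- All hashes of indices, in array `6`. -/
def indexProg : Prog :=
  scan ((eL + 1) * eN) 6 ec ((ec.ltE eN).sel 0 (.get 6 (ec - eN) +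
    ec % eN / .get 3 (ec / eN - 1) % 2 * .get 4 (ec / eN - 1)) % ep)

/-- Powers of residues, in array `7`. -/
def powerProg : Prog :=
  scan (eKK * ep) 7 ec ((ec.ltE ep).sel 1 (.get 7 (ec - ep) * (ec % ep)) % ep)

/-! ### Programs for the tables that both parties use. -/

section

variable {d : ℕ} {P : Par d} {σ : State}

theorem Par.Lw_le (P : Par d) : P.L * P.w ≤ P.TB := by
  have h1 := P.M_le
  have h2 := P.w_lt_M
  have h3 := P.Y_ge
  have h4 := P.Y_pow_le (k := d + 4) (by omega)
  have h5 : P.L * P.w ≤ P.Y * (2 * P.X) := Nat.mul_le_mul (by omega) (by omega)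
  have h6 : P.Y * (2 * P.X) ≤ P.Y ^ (d + 4) := by
    have h7 := P.Y_pos
    calc P.Y * (2 * P.X) = 2 * (P.Y * P.X) := by ring
      _ ≤ P.Y * (P.Y * P.X) := Nat.mul_le_mul_right _ (by omega)
      _ = _ := by unfold Par.X; ring
  omega

/-- The reduction modulo 4NM never acts, since the largest power is 2^(L + w) = NM. It is there
because `Regs.scan` takes its size bound from a modulus. -/
theorem powProg_runs (h : Regs P σ) : ∃ τ, RunsU P powProg σ τ ∧
    Regs P τ ∧ Only 3 σ τ ∧ ∀ x ≤ P.L + P.w, τ.arr 3 x = 2 ^ x := by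
  have hTB : P.L + P.w + 1 ≤ P.TB := by
    have := P.L_lt_N; have := P.w_lt_M; have := P.N4_le; have := P.M_le; have := P.Y_pos
    have h4 := P.Y_pow_le (k := d + 3) (by omega)
    have : 60 * P.X ≤ P.Y ^ (d + 3) := by
      rw [pow_succ, mul_comm]; exact Nat.mul_le_mul_left _ this
    have : 4 * P.N * 1 ≤ 4 * P.N * (P.L + 1) := Nat.mul_le_mul_left _ (by omega)
    have : P.Y ^ (d + 3) ≤ P.Y ^ (2 * d + 8) := Nat.pow_le_pow_right (by omega) (by omega)
    unfold Par.TB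
    omega
  have hμ : 0 < 4 * P.N * P.M := by have := P.N_pos; have := P.M_pos; positivity
  obtain ⟨r, hr⟩ := h.scan (bnd := eL + ew + 1) (a := 3) (I := ec)
    (E := (ec.eqE 0).sel 1 (2 * .get 3 (ec - 1))) (m := 4 * eN * eM) (b := P.L + P.w + 1)
    (μ := 4 * P.N * P.M)
    (by simp [h.L, h.w]) hTB (by simp [h.N, h.M]) hμ (by omega)
  refine ⟨_, r, hr, only_scanSt .., fun x hx => ?_⟩
  rw [scanSt_arr, if_pos rfl]
  obtain ⟨-, hF⟩ := scanF_fill (σ := σ) (a := 3) (I := ec)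
    (E := (ec.eqE 0).sel 1 (2 * .get 3 (ec - 1)) % (4 * eN * eM)) (b := P.L + P.w + 1) (o := 0)
    (fun k f _ => by simp)
  induction x with
  | zero =>
    obtain ⟨f, h1, h2, h3⟩ := hF 0 (by omega)
    rw [zero_add] at h3
    rw [h3]
    simp [Expr.sel, h.N, h.M]
    refine Nat.mod_eq_of_lt ?_
    have := P.N_pos; have := P.M_pos; nlinarith
  | succ x ih =>
    obtain ⟨f, h1, h2, h3⟩ := hF (x + 1) (by omega)
    rw [zero_add] at h3
    rw [h3]
    simp only [Expr.sel, Expr.eval_mod, Expr.eval_add, Expr.eval_mul, Expr.eval_sub, Expr.eval_eqE,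
      Expr.eval_get, Expr.eval_ofNat, Expr.eval_var, scanSt_var, scanSt_arr, sel_arith, if_true]
    norm_num
    rw [h1 x (by omega), ih (by omega), h.N, h.M, ← pow_succ']
    refine Nat.mod_eq_of_lt ?_
    have : 2 ^ (x + 1) < 2 ^ (P.L + P.w + 2) := Nat.pow_lt_pow_right (by norm_num) (by omega)
    calc _ < _ := this
      _ = _ := by unfold Par.N Par.M; ring

end

theorem sum_block {F : Type*} [AddCommMonoid F] (f : ℕ → F) {B w b : ℕ} (hw : 0 < w) (hb : b < B) :
    ∑ k ∈ Finset.range (B * w), (if k / w = b then f k else 0) =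
      ∑ u ∈ Finset.range w, f (b * w + u) := by
  rw [← Finset.sum_filter]
  symm
  refine Finset.sum_bij (fun u _ => b * w + u) (fun u hu => ?_) (fun u _ v _ h => by simpa using h)
    (fun k hk => ?_) fun _ _ => rfl
  · have hu := Finset.mem_range.1 hu
    rw [Finset.mem_filter, Finset.mem_range]
    refine ⟨?_, by rw [mul_comm, Nat.mul_add_div hw, Nat.div_eq_of_lt hu, add_zero]⟩
    calc b * w + u < (b + 1) * w := by rw [add_mul]; omega
      _ ≤ B * w := Nat.mul_le_mul_right _ hb
  · obtain ⟨h1, rfl⟩ := Finset.mem_filter.1 hk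
    exact ⟨k % w, Finset.mem_range.2 (Nat.mod_lt _ hw), Nat.div_add_mod' _ _⟩

theorem mul_add_div_of_lt {j i w : ℕ} (h : i < w) : (j * w + i) / w = j := by
  rw [mul_comm, Nat.mul_add_div (by omega), Nat.div_eq_of_lt h, add_zero]

theorem mul_add_mod_of_lt {j i w : ℕ} (h : i < w) : (j * w + i) % w = i := by
  rw [mul_comm, Nat.mul_add_mod, Nat.mod_eq_of_lt h]

theorem mul_add_lt {j i w B : ℕ} (hj : j < B) (h : i < w) : j * w + i < B * w := by
  calc j * w + i < (j + 1) * w := by rw [add_mul]; omega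
    _ ≤ B * w := Nat.mul_le_mul_right _ hj

/-- `h` holds the powers of two. -/
def PowTab {d : ℕ} (P : Par d) (h : ℕ → ℕ) : Prop := ∀ x ≤ P.L + P.w, h x = 2 ^ x

/-- `h` holds the seeds `a`. -/
def SeedTab {d : ℕ} (P : Par d) (a : ℕ → ZMod P.p) (h : ℕ → ℕ) : Prop :=
  ∀ b < P.L, (h b : ZMod P.p) = a b

/-- `h` holds the hashes of the windows of `S`. -/
def HashTab {d : ℕ} (P : Par d) (a : ℕ → ZMod P.p) (S h : ℕ → ℕ) : Prop :=
  ∀ j ≤ P.L, ∀ i < P.Z, h (j * P.Z + i) < P.p ∧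
    (h (j * P.Z + i) : ZMod P.p) = windowHash a S j i

/-- `h` holds the hashes of indices. -/
def IndexTab {d : ℕ} (P : Par d) (a : ℕ → ZMod P.p) (h : ℕ → ℕ) : Prop :=
  ∀ i < P.N, h (P.L * P.N + i) < P.p ∧ (h (P.L * P.N + i) : ZMod P.p) = indexHash a P.L i

/-- `h` holds the powers of residues. -/
def PowerTab {d : ℕ} (P : Par d) (h : ℕ → ℕ) : Prop :=
  ∀ r < P.KK, ∀ x < P.p, (h (r * P.p + x) : ZMod P.p) = (x : ZMod P.p) ^ r

section

variable {d : ℕ} {P : Par d} {σ : State}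

theorem Par.p_le_bound (P : Par d) : P.p ≤ 4 * P.N * P.M + P.TB := by
  have h1 := P.p_le
  have h2 := P.N_pos
  have : P.M * 1 ≤ P.M * P.N := Nat.mul_le_mul_left _ h2
  nlinarith

theorem seedProg_runs (h : Regs P σ) (h3 : PowTab P (σ.arr 3)) (h4 : ∀ b, σ.arr 4 b = 0) :
    ∃ τ, RunsU P seedProg σ τ ∧ Regs P τ ∧ Only 4 σ τ ∧
      SeedTab P (seedMod P.p P.w (σ.arr 1)) (τ.arr 4) := by
  have hw : 0 < P.w := Nat.size_pos.2 (by have := P.X_pos; omega)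
  obtain ⟨r, hr⟩ := h.scan (bnd := eL * ew) (a := 4) (I := ec / ew)
    (E := .get 4 (ec / ew) + .get 1 ec * .get 3 (ec % ew)) (m := ep) (b := P.L * P.w)
    (by simp [h.L, h.w]) P.Lw_le (by simp [h.p]) P.p_pos P.p_le_bound
  refine ⟨_, r, hr, only_scanSt .., fun b hb => ?_⟩
  rw [scanSt_arr, if_pos rfl]
  obtain ⟨-, e⟩ := scanF_acc (σ := σ) (a := 4) (I := ec / ew)
    (E := (.get 4 (ec / ew) + .get 1 ec * .get 3 (ec % ew)) % ep) (b := P.L * P.w) P.p_pos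
    (fun k => k / P.w) (fun k => σ.arr 1 k * σ.arr 3 (k % P.w)) (fun k f _ => by simp [h.w])
    (fun k f _ => by simp [h.w, h.p]) b (by rw [h4]; exact P.p_pos)
  rw [e, h4, sum_block _ hw hb, seedMod, seed]
  push_cast
  rw [zero_add]
  refine Finset.sum_congr rfl fun u hu => ?_
  have hu := Finset.mem_range.1 hu
  rw [mul_add_mod_of_lt hu, h3 u (by omega)]
  push_cast; ring

/-- One linear scan suffices because a window of level j + 1 needs two windows of level j, whose
cells were written one full row earlier or shortly after that. -/
theorem hashProg_runs (h : Regs P σ) (h3 : PowTab P (σ.arr 3)) {a : ℕ → ZMod P.p}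
    (h4 : SeedTab P a (σ.arr 4)) {src dst : ℕ} (hsrc : src ≠ dst) (hd3 : 3 ≠ dst) (hd4 : 4 ≠ dst)
    (hS : ∀ x, P.Z ≤ x → σ.arr src x = 0) :
    ∃ τ, RunsU P (hashProg src dst) σ τ ∧ Regs P τ ∧ Only dst σ τ ∧
      HashTab P a (σ.arr src) (τ.arr dst) := by
  have hZ : 0 < P.Z := Nat.mul_pos (by norm_num) P.N_pos
  obtain ⟨r, hr⟩ := h.scan (bnd := (eL + 1) * eZ) (a := dst) (I := ec)
    (E := (ec.ltE eZ).sel (.get src ec) (.get dst (ec - eZ) +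
    .get 4 (ec / eZ - 1) * ((ec % eZ + .get 3 (ec / eZ - 1)).ltE eZ *
      .get dst (ec - eZ + .get 3 (ec / eZ - 1))))) (m := ep) (b := (P.L + 1) * P.Z)
    (by simp [h.L, h.N, Par.Z]) (by rw [mul_comm]; exact P.Z_mul_le)
    (by simp [h.p]) P.p_pos P.p_le_bound
  refine ⟨_, r, hr, only_scanSt .., ?_⟩
  rw [scanSt_arr, if_pos rfl]
  obtain ⟨-, hF⟩ := scanF_fill (σ := σ) (a := dst) (I := ec)
    (E := (ec.ltE eZ).sel (.get src ec) (.get dst (ec - eZ) +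
    .get 4 (ec / eZ - 1) * ((ec % eZ + .get 3 (ec / eZ - 1)).ltE eZ *
      .get dst (ec - eZ + .get 3 (ec / eZ - 1)))) % ep) (b := (P.L + 1) * P.Z) (o := 0)
    (fun k f _ => by simp)
  set F := scanF σ dst ec _ _
  intro j
  induction j with
  | zero =>
    intro _ i hi
    obtain ⟨f, -, -, e⟩ := hF i (by nlinarith)
    have hi' : i < 2 * P.N := hi
    rw [zero_add] at e
    rw [zero_mul, zero_add, e]
    simp [Expr.sel, h.p, h.N, hi', hsrc, windowHash, Nat.mod_lt _ P.p_pos]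
  | succ j ih =>
    intro hj i hi
    obtain ⟨f, h1, -, e⟩ := hF ((j + 1) * P.Z + i) (mul_add_lt (by omega) hi)
    rw [zero_add] at e
    have e1 : ((j + 1) * P.Z + i) / P.Z = j + 1 := mul_add_div_of_lt hi
    have e2 : ((j + 1) * P.Z + i) % P.Z = i := mul_add_mod_of_lt hi
    have e3 : (j + 1) * P.Z + i - P.Z = j * P.Z + i := by rw [add_mul]; omega
    have e4 : ¬ (j + 1) * P.Z + i < P.Z := by rw [add_mul]; omega
    have e5 : (2 * P.N) = P.Z := rfl
    have e6 : (j + 1) * P.Z = j * P.Z + P.Z := by ring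
    simp only [Expr.sel, Expr.eval_mod, Expr.eval_add, Expr.eval_mul, Expr.eval_sub, Expr.eval_div,
      Expr.eval_ltE, Expr.eval_get, Expr.eval_ofNat, Expr.eval_var, scanSt_var, scanSt_arr,
      sel_arith, if_true, if_neg hd3, if_neg hd4] at e
    norm_num at e
    rw [h.p, h.N, e5, e1, e2, e3, if_neg e4, Nat.add_sub_cancel, h3 j (by omega),
      h1 (j * P.Z + i) (by omega)] at e
    rw [e]
    refine ⟨Nat.mod_lt _ P.p_pos, ?_⟩
    rw [ZMod.natCast_mod, windowHash]
    push_cast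
    rw [(ih (by omega) i hi).2, h4 j (by omega)]
    congr 2
    -- If the second half starts beyond the table, the machine uses 0. This is its true hash,
    -- because the string vanishes from position Z on.
    split_ifs with hlt
    · have hpow : 2 ^ j < P.Z := by omega
      rw [h1 _ (by omega), add_assoc, (ih (by omega) _ hlt).2]
    · rw [windowHash_eq_zero fun x hx => hS x (by omega)]; simp

theorem indexProg_runs (h : Regs P σ) (h3 : PowTab P (σ.arr 3)) {a : ℕ → ZMod P.p}
    (h4 : SeedTab P a (σ.arr 4)) :
    ∃ τ, RunsU P indexProg σ τ ∧ Regs P τ ∧ Only 6 σ τ ∧ IndexTab P a (τ.arr 6) := by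
  have hN := P.N_pos
  obtain ⟨r, hr⟩ := h.scan (bnd := (eL + 1) * eN) (a := 6) (I := ec)
    (E := (ec.ltE eN).sel 0 (.get 6 (ec - eN) +
    ec % eN / .get 3 (ec / eN - 1) % 2 * .get 4 (ec / eN - 1))) (m := ep) (b := (P.L + 1) * P.N)
    (by simp [h.L, h.N]) (by rw [mul_comm]; exact P.N_mul_le)
    (by simp [h.p]) P.p_pos P.p_le_bound
  refine ⟨_, r, hr, only_scanSt .., ?_⟩
  rw [scanSt_arr, if_pos rfl]
  obtain ⟨-, hF⟩ := scanF_fill (σ := σ) (a := 6) (I := ec)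
    (E := (ec.ltE eN).sel 0 (.get 6 (ec - eN) +
    ec % eN / .get 3 (ec / eN - 1) % 2 * .get 4 (ec / eN - 1)) % ep) (b := (P.L + 1) * P.N) (o := 0)
    (fun k f _ => by simp)
  set F := scanF σ 6 ec _ _
  have key : ∀ j ≤ P.L, ∀ i < P.N, F (j * P.N + i) < P.p ∧
      (F (j * P.N + i) : ZMod P.p) = indexHash a j i := by
    intro j
    induction j with
    | zero =>
      intro _ i hi
      obtain ⟨f, -, -, e⟩ := hF i (by nlinarith)
      rw [zero_add] at e
      rw [zero_mul, zero_add, e]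
      simp [Expr.sel, h.p, h.N, hi, indexHash, P.p_pos]
    | succ j ih =>
      intro hj i hi
      obtain ⟨f, h1, -, e⟩ := hF ((j + 1) * P.N + i) (mul_add_lt (by omega) hi)
      rw [zero_add] at e
      have e1 : ((j + 1) * P.N + i) / P.N = j + 1 := mul_add_div_of_lt hi
      have e2 : ((j + 1) * P.N + i) % P.N = i := mul_add_mod_of_lt hi
      have e3 : (j + 1) * P.N + i - P.N = j * P.N + i := by rw [add_mul]; omega
      have e4 : ¬ (j + 1) * P.N + i < P.N := by rw [add_mul]; omega
      have e6 : (j + 1) * P.N = j * P.N + P.N := by ring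
      simp only [Expr.sel, Expr.eval_mod, Expr.eval_add, Expr.eval_mul, Expr.eval_sub,
        Expr.eval_div, Expr.eval_ltE, Expr.eval_get, Expr.eval_ofNat, Expr.eval_var, scanSt_var,
        scanSt_arr, sel_arith, if_true] at e
      norm_num at e
      rw [h.p, h.N, e1, e2, e3, if_neg e4, Nat.add_sub_cancel, h3 j (by omega),
        h1 (j * P.N + i) (by omega)] at e
      rw [e]
      refine ⟨Nat.mod_lt _ P.p_pos, ?_⟩
      rw [ZMod.natCast_mod, indexHash, Finset.sum_range_succ, ← indexHash]
      push_cast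
      rw [(ih (by omega) i hi).2, h4 j (by omega)]
  exact key P.L le_rfl

/-- The cost of all power sums once blocks are grouped by node: it involves p and not N, and p is
polynomial in K log n. -/
theorem Par.KKp_le (P : Par d) : (P.L + 1) * P.KK * P.p ≤ P.TB := by
  have h1 := P.p_le_Y
  have h2 := P.KK_le
  have h3 : P.L + 1 ≤ P.Y := by have := P.Y_ge; omega
  calc (P.L + 1) * P.KK * P.p ≤ P.Y * P.Y * P.Y ^ (d + 3) :=
        Nat.mul_le_mul (Nat.mul_le_mul h3 h2) h1
    _ = P.Y ^ (d + 5) := by ring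
    _ ≤ _ := P.Y_pow_le (by omega)

theorem powerProg_runs (h : Regs P σ) :
    ∃ τ, RunsU P powerProg σ τ ∧ Regs P τ ∧ Only 7 σ τ ∧ PowerTab P (τ.arr 7) := by
  have hp := P.p_pos
  obtain ⟨r, hr⟩ := h.scan (bnd := eKK * ep) (a := 7) (I := ec)
    (E := (ec.ltE ep).sel 1 (.get 7 (ec - ep) * (ec % ep))) (m := ep) (b := P.KK * P.p)
    (by simp [h.K, h.p, Par.KK])
    (le_trans (by rw [mul_assoc]; exact Nat.le_mul_of_pos_left _ (Nat.succ_pos _)) P.KKp_le)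
    (by simp [h.p]) P.p_pos P.p_le_bound
  refine ⟨_, r, hr, only_scanSt .., ?_⟩
  rw [scanSt_arr, if_pos rfl]
  obtain ⟨-, hF⟩ := scanF_fill (σ := σ) (a := 7) (I := ec)
    (E := (ec.ltE ep).sel 1 (.get 7 (ec - ep) * (ec % ep)) % ep) (b := P.KK * P.p) (o := 0)
    (fun k f _ => by simp)
  set F := scanF σ 7 ec _ _
  intro j
  induction j with
  | zero =>
    intro hj i hi
    obtain ⟨f, -, -, e⟩ := hF i (by nlinarith)
    rw [zero_add] at e
    rw [zero_mul, zero_add, e]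
    simp [Expr.sel, h.p, hi]
  | succ j ih =>
    intro hj i hi
    obtain ⟨f, h1, -, e⟩ := hF ((j + 1) * P.p + i) (mul_add_lt (by omega) hi)
    rw [zero_add] at e
    have e2 : ((j + 1) * P.p + i) % P.p = i := mul_add_mod_of_lt hi
    have e3 : (j + 1) * P.p + i - P.p = j * P.p + i := by rw [add_mul]; omega
    have e4 : ¬ (j + 1) * P.p + i < P.p := by rw [add_mul]; omega
    have e6 : (j + 1) * P.p = j * P.p + P.p := by ring
    simp only [Expr.sel, Expr.eval_mod, Expr.eval_add, Expr.eval_mul, Expr.eval_sub,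
      Expr.eval_ltE, Expr.eval_get, Expr.eval_ofNat, Expr.eval_var, scanSt_var,
      scanSt_arr, sel_arith, if_true] at e
    norm_num at e
    rw [h.p, e2, e3, if_neg e4, h1 (j * P.p + i) (by omega)] at e
    rw [e, ZMod.natCast_mod]
    push_cast
    rw [ih (by omega) i hi, pow_succ]

/-- The tables that both parties need. -/
def tables : Prog :=
  .seq powProg (.seq seedProg (.seq (hashProg 0 5) (.seq indexProg powerProg)))

/-- The tables have been computed, with seeds `a`. -/
structure Tables (P : Par d) (a : ℕ → ZMod P.p) (σ : State) : Prop where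
  pow : PowTab P (σ.arr 3)
  seed : SeedTab P a (σ.arr 4)
  index : IndexTab P a (σ.arr 6)
  power : PowerTab P (σ.arr 7)

theorem tables_runs (h : Regs P σ) (h4 : ∀ b, σ.arr 4 b = 0) (h0 : ∀ x, P.n ≤ x → σ.arr 0 x = 0) :
    ∃ τ, RunsU P tables σ τ ∧ Regs P τ ∧ Tables P (seedMod P.p P.w (σ.arr 1)) τ ∧
      HashTab P (seedMod P.p P.w (σ.arr 1)) (σ.arr 0) (τ.arr 5) ∧
      (∀ y, y ≠ 9 → τ.var y = σ.var y) ∧ (∀ b, b < 3 ∨ 8 ≤ b → τ.arr b = σ.arr b) ∧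
      τ.coins = σ.coins := by
  obtain ⟨σ₁, r₁, g₁, o₁, t₁⟩ := powProg_runs h
  obtain ⟨σ₂, r₂, g₂, o₂, t₂⟩ := seedProg_runs g₁ t₁ (by rw [o₁.2.1 4 (by norm_num)]; exact h4)
  rw [o₁.2.1 1 (by norm_num)] at t₂
  obtain ⟨σ₃, r₃, g₃, o₃, t₃⟩ := hashProg_runs (src := 0) (dst := 5) g₂
    (by rw [o₂.2.1 3 (by norm_num)]; exact t₁) t₂ (by norm_num) (by norm_num) (by norm_num)
    (by
      rw [o₂.2.1 0 (by norm_num), o₁.2.1 0 (by norm_num)]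
      intro x hx
      refine h0 x (le_trans ?_ hx)
      have := P.n_lt; unfold Par.Z; omega)
  obtain ⟨σ₄, r₄, g₄, o₄, t₄⟩ := indexProg_runs g₃
    (by rw [o₃.2.1 3 (by norm_num), o₂.2.1 3 (by norm_num)]; exact t₁)
    (by rw [o₃.2.1 4 (by norm_num)]; exact t₂)
  obtain ⟨σ₅, r₅, g₅, o₅, t₅⟩ := powerProg_runs g₄
  rw [o₂.2.1 0 (by norm_num), o₁.2.1 0 (by norm_num)] at t₃
  refine ⟨σ₅, r₁.seq (r₂.seq (r₃.seq (r₄.seq r₅))), g₅, ⟨?_, ?_, ?_, t₅⟩, ?_, ?_, ?_, ?_⟩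
  · rw [o₅.2.1 3 (by norm_num), o₄.2.1 3 (by norm_num), o₃.2.1 3 (by norm_num),
      o₂.2.1 3 (by norm_num)]; exact t₁
  · rw [o₅.2.1 4 (by norm_num), o₄.2.1 4 (by norm_num), o₃.2.1 4 (by norm_num)]; exact t₂
  · rw [o₅.2.1 6 (by norm_num)]; exact t₄
  · rw [o₅.2.1 5 (by norm_num), o₄.2.1 5 (by norm_num)]; exact t₃
  · intro y hy
    rw [o₅.1 y hy, o₄.1 y hy, o₃.1 y hy, o₂.1 y hy, o₁.1 y hy]
  · intro b hb
    rw [o₅.2.1 b (by omega), o₄.2.1 b (by omega), o₃.2.1 b (by omega), o₂.2.1 b (by omega),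
      o₁.2.1 b (by omega)]
  · rw [o₅.2.2, o₄.2.2, o₃.2.2, o₂.2.2, o₁.2.2]

end

/-! ### Alice -/

/-- The coins, in array `1`. -/
def flipProg : Prog :=
  .seq (.assign 9 0) (.loop (ec.ltE (eL * ew))
    (.seq (.flip 16) (.seq (.store 1 ec (.var 16)) (.assign 9 (ec + 1)))))

/-- Hashes of blocks, summed over the blocks with the same index hash, in array `8`. -/
def bucketProg : Prog :=
  scan ((eL + 1) * eN) 8 (ec / eN * ep + .get 6 (eL * eN + ec % eN))
    ((.get 8 (ec / eN * ep + .get 6 (eL * eN + ec % eN)) +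
      (ec % eN * .get 3 (ec / eN)).ltE eN * .get 5 (ec / eN * eZ + ec % eN * .get 3 (ec / eN))) % ep)

/-- The syndromes, in array `9`. -/
def syndromeProg : Prog :=
  scan ((eL + 1) * eKK * ep) 9 (ec / ep)
    ((.get 9 (ec / ep) + .get 8 (ec / ep / eKK * ep + ec % ep) * .get 7 (ec / ep % eKK * ep + ec % ep))
      % ep)

/-- The digits of the syndromes, appended to array `1`. -/
def digitProg : Prog :=
  scan ((eL + 1) * eKK * (ew + 1)) 1 (eL * ew + ec)
    (.get 9 (ec / (ew + 1)) / .get 3 (ec % (ew + 1)) % 2)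

/-- Alice's program. -/
def alice (d : ℕ) : Prog :=
  .seq (setup d) (.seq flipProg (.seq tables (.seq bucketProg (.seq syndromeProg (.seq digitProg
    (.assign 0 (eL * ew + (eL + 1) * eKK * (ew + 1))))))))

/-- Alice's syndromes. -/
def syndrome {p : ℕ} (a : ℕ → ZMod p) (S : ℕ → ℕ) (L j r : ℕ) : ZMod p :=
  ∑ i ∈ Finset.range (2 ^ (L - j)), windowHash a S j (i * 2 ^ j) * indexHash a L i ^ r

/-! ### Correctness of Alice's program. -/

section

variable {d : ℕ} {P : Par d} {σ : State}

/-- The length of Alice's message. -/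
def Par.msgLen (P : Par d) : ℕ := P.L * P.w + (P.L + 1) * P.KK * (P.w + 1)

/-- `m` consists of the coins `r` and the syndromes of `S`. -/
structure IsMsg (P : Par d) (S r m : ℕ → ℕ) : Prop where
  coin : ∀ x < P.L * P.w, m x = r x
  symbol : ∀ j ≤ P.L, ∀ k < P.KK, ∃ v < P.p,
    (v : ZMod P.p) = syndrome (seedMod P.p P.w r) S P.L j k ∧
    ∀ u < P.w + 1, m (P.L * P.w + ((j * P.KK + k) * (P.w + 1) + u)) = v / 2 ^ u % 2

/-- Tossing consumes the list of coins, which a scan leaves alone, so this loop gets its own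
induction, over the coins left. The supply is exactly what the loop consumes. -/
theorem flipLoop_runs (l : List Bool) (h : Regs P σ) (hl : σ.coins = l)
    (h9 : σ.var 9 + l.length = P.L * P.w) :
    ∃ τ, Runs (.loop (ec.ltE (eL * ew))
      (.seq (.flip 16) (.seq (.store 1 ec (.var 16)) (.assign 9 (ec + 1))))) σ τ
      (l.length * (P.W * 50) + P.W * 50) ∧ Regs P τ ∧
      (∀ y, y ≠ 9 → y ≠ 16 → τ.var y = σ.var y) ∧ (∀ b, b ≠ 1 → τ.arr b = σ.arr b) ∧
      ∀ x, τ.arr 1 x = if σ.var 9 ≤ x ∧ x < P.L * P.w then bitAt l (x - σ.var 9) else σ.arr 1 x := by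
  have hW := P.W_pos
  induction l generalizing σ with
  | nil =>
    refine ⟨σ, ⟨_, ?_, .loopFalse ?_⟩, h, fun _ _ _ => rfl, fun _ _ => rfl, fun x => ?_⟩
    · have := (ec.ltE (eL * ew)).cost_le hW h.bdd
      have e : (ec.ltE (eL * ew)).wt = 18 := rfl
      rw [e] at this; omega
    · simp [h.L, h.w] at h9 ⊢; omega
    · simp at h9; rw [if_neg (by omega)]
  | cons c l ih =>
    simp only [List.length_cons] at h9
    obtain ⟨v, m, _⟩ := σ
    simp only at hl h9
    subst hl
    set s₁ : State := ⟨Function.update v 16 c.toNat, m, l⟩ with hs₁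
    have g₁ : Regs P s₁ := by
      have := h.setVar (x := 16) (k := c.toNat) (by norm_num) (by
        have : 2 ^ 1 ≤ 2 ^ P.W := Nat.pow_le_pow_right (by norm_num) hW
        cases c <;> simp ; omega)
      exact ⟨this.bdd, this.n, this.K, this.L, this.N, this.w, this.M, this.p⟩
    have q₀ : Exec (.flip 16) ⟨v, m, c :: l⟩ s₁ 1 := .flip v m c l 16
    have q₁ := Runs.store hW g₁.bdd 1 ec (.var 16)
    set s₂ := s₁.setArr 1 (Function.update (s₁.arr 1) (ec.eval s₁) ((Expr.var 16).eval s₁)) with hs₂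
    have b₂ : Bdd P.W s₂ := g₁.bdd.setArr fun i => by
      rw [Function.update_apply]; split
      · exact g₁.bdd.1 16
      · exact g₁.bdd.2 1 i
    have g₂ : Regs P s₂ := ⟨b₂, g₁.n, g₁.K, g₁.L, g₁.N, g₁.w, g₁.M, g₁.p⟩
    have q₂ := Runs.assign hW b₂ 9 (ec + 1)
    have e9 : (ec + 1).eval s₂ = v 9 + 1 := by simp [hs₂, hs₁]
    rw [e9] at q₂
    have hlt : v 9 + 1 < 2 ^ P.W := by
      have := P.Lw_le; have := P.TB_lt; omega
    obtain ⟨τ, ⟨T, hT, q₃⟩, g₃, c₁, c₂, c₃⟩ := ih (σ := s₂.setVar 9 (v 9 + 1))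
      (g₂.setVar (by norm_num) hlt) rfl (by simp; omega)
    obtain ⟨T₁, hT₁, q₁⟩ := q₁
    obtain ⟨T₂, hT₂, q₂⟩ := q₂
    have hc := (ec.ltE (eL * ew)).cost_le hW h.bdd
    have e : (ec.ltE (eL * ew)).wt = 18 := rfl
    have e' : (ec + 1).wt = 12 := rfl
    have e'' : ec.wt + (Expr.var 16).wt + ec.deg + 1 = 6 := rfl
    rw [e] at hc
    rw [e'] at hT₂
    rw [e''] at hT₁
    refine ⟨τ, ⟨_, ?_, .loopTrue ?_ (.seq q₀ (.seq q₁ q₂)) q₃⟩, g₃, ?_, ?_, ?_⟩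
    · rw [List.length_cons, add_mul]; omega
    · have h1 := h.L
      have h2 := h.w
      simp only at h1 h2
      simp [h1, h2]; omega
    · intro y h1 h2
      rw [c₁ y h1 h2]
      simp [hs₂, hs₁, h1, h2]
    · intro b hb
      rw [c₂ b hb]
      simp [hs₂, hs₁, hb]
    · intro x
      rw [c₃ x]
      simp only [State.setVar_var, if_true, State.setVar_arr, hs₂, State.setArr_arr,
        Function.update_apply, Expr.eval_var, hs₁]
      norm_num
      by_cases hx : x = v 9
      · subst hx
        rw [if_neg (by omega), if_pos (by omega)]
        simp [bitAt]
        intro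
        omega
      · by_cases hx' : v 9 < x ∧ x < P.L * P.w
        · rw [if_pos hx', if_pos (by omega), show x - v 9 = x - (v 9 + 1) + 1 by omega,
            bitAt_cons_succ]
        · rw [if_neg hx', if_neg hx, if_neg (by omega)]

theorem flipProg_runs (h : Regs P σ) (hl : σ.coins.length = P.L * P.w)
    (h1 : ∀ x, σ.arr 1 x = 0) :
    ∃ τ, RunsU P flipProg σ τ ∧ Regs P τ ∧
      (∀ y, y ≠ 9 → y ≠ 16 → τ.var y = σ.var y) ∧ (∀ b, b ≠ 1 → τ.arr b = σ.arr b) ∧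
      τ.arr 1 = bitAt σ.coins := by
  have r := Runs.assign P.W_pos h.bdd 9 0
  obtain ⟨τ, r', g, c₁, c₂, c₃⟩ := flipLoop_runs σ.coins (h.setVar (x := 9) (k := 0) (by norm_num)
    (by positivity)) rfl (by simpa using hl)
  refine ⟨τ, (r.seq r').mono ?_, g, fun y h1 h2 => by rw [c₁ y h1 h2]; simp [h1], c₂,
    funext fun x => ?_⟩
  · have e : flipProg.wt = 62 := rfl
    have e0 : (0 : Expr).wt = 2 := rfl
    rw [e, e0, hl, Par.U]
    have := Nat.mul_le_mul_right (P.W * 50) (show P.L * P.w + 1 ≤ P.TB + 1 by have := P.Lw_le; omega)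
    have := P.W_le_U
    unfold Par.U at this
    nlinarith
  · rw [c₃ x]
    simp only [State.setVar_var, if_true, Nat.sub_zero, State.setVar_arr, h1]
    split_ifs with hx
    · rfl
    · exact (bitAt_eq_zero (by omega)).symm

/-- Sorting by node separates the long sum over blocks from the powers. The scan treats N indices at
each level; the comparison with N in the summand silences those that are not blocks. -/
theorem bucketProg_runs {a : ℕ → ZMod P.p} {S : ℕ → ℕ} (h : Regs P σ) (ht : Tables P a σ)
    (h5 : HashTab P a S (σ.arr 5)) (h8 : ∀ x, σ.arr 8 x = 0) :
    ∃ τ, RunsU P bucketProg σ τ ∧ Regs P τ ∧ Only 8 σ τ ∧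
      ∀ j ≤ P.L, ∀ x < P.p, (τ.arr 8 (j * P.p + x) : ZMod P.p) =
        ∑ i ∈ Finset.range (2 ^ (P.L - j)), if σ.arr 6 (P.L * P.N + i) = x then
          windowHash a S j (i * 2 ^ j) else 0 := by
  have hN := P.N_pos
  obtain ⟨r, hr⟩ := h.scan (bnd := (eL + 1) * eN) (a := 8)
    (I := ec / eN * ep + .get 6 (eL * eN + ec % eN))
    (E := .get 8 (ec / eN * ep + .get 6 (eL * eN + ec % eN)) +
      (ec % eN * .get 3 (ec / eN)).ltE eN * .get 5 (ec / eN * eZ + ec % eN * .get 3 (ec / eN)))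
    (m := ep) (b := (P.L + 1) * P.N)
    (by simp [h.L, h.N]) (by rw [mul_comm]; exact P.N_mul_le)
    (by simp [h.p]) P.p_pos P.p_le_bound
  refine ⟨_, r, hr, only_scanSt .., fun j hj x hx => ?_⟩
  rw [scanSt_arr, if_pos rfl]
  set ι : ℕ → ℕ := fun k => k / P.N * P.p + σ.arr 6 (P.L * P.N + k % P.N)
  set v : ℕ → ℕ := fun k => (if k % P.N * σ.arr 3 (k / P.N) < P.N then 1 else 0) *
    σ.arr 5 (k / P.N * P.Z + k % P.N * σ.arr 3 (k / P.N))
  obtain ⟨-, e⟩ := scanF_acc (σ := σ) (a := 8)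
    (I := ec / eN * ep + .get 6 (eL * eN + ec % eN))
    (E := (.get 8 (ec / eN * ep + .get 6 (eL * eN + ec % eN)) +
      (ec % eN * .get 3 (ec / eN)).ltE eN * .get 5 (ec / eN * eZ + ec % eN * .get 3 (ec / eN))) % ep)
    (b := (P.L + 1) * P.N) P.p_pos ι v
    (fun k f _ => by simp [h.L, h.N, h.p, ι]) (fun k f _ => by simp [h.L, h.N, h.p, ι, v, Par.Z])
    (j * P.p + x) (by rw [h8]; exact P.p_pos)
  rw [e, h8, Nat.cast_zero, zero_add]
  -- Index hashes are reduced residues, so division by p recovers the level from a cell and rows do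
  -- not mix.
  have e1 : ∀ k, (if ι k = j * P.p + x then (v k : ZMod P.p) else 0) =
      if k / P.N = j then (if σ.arr 6 (P.L * P.N + k % P.N) = x then (v k : ZMod P.p) else 0)
        else 0 := fun k => by
    have hg := (ht.index (k % P.N) (Nat.mod_lt _ hN)).1
    by_cases h1 : k / P.N = j
    · simp [ι, h1]
    · rw [if_neg h1, if_neg]
      intro h2
      refine h1 ?_
      have := congrArg (· / P.p) h2
      simp only [ι] at this
      rwa [mul_add_div_of_lt hg, mul_add_div_of_lt hx] at this
  simp only [e1]
  rw [sum_block _ hN (by omega)]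
  have hpow : 2 ^ (P.L - j) * 2 ^ j = P.N := by
    rw [← pow_add, Nat.sub_add_cancel hj]; rfl
  have hsub : Finset.range (2 ^ (P.L - j)) ⊆ Finset.range P.N :=
    Finset.range_mono (Nat.pow_le_pow_right (by norm_num) (by omega))
  have e2 : ∀ u < P.N, v (j * P.N + u) = (if u * 2 ^ j < P.N then 1 else 0) *
      σ.arr 5 (j * P.Z + u * 2 ^ j) := fun u hu => by
    simp only [v]
    rw [mul_add_div_of_lt hu, mul_add_mod_of_lt hu, ht.pow j (by omega)]
  symm
  refine (Finset.sum_congr rfl fun i hi => ?_).trans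
    (Finset.sum_subset hsub fun i hi hi' => ?_)
  · have hi := Finset.mem_range.1 hi
    have hiN : i < P.N := hi.trans_le (Nat.pow_le_pow_right (by norm_num) (by omega))
    have hib : i * 2 ^ j < P.N := by
      rw [← hpow]; exact Nat.mul_lt_mul_of_pos_right hi (by positivity)
    rw [mul_add_mod_of_lt hiN, e2 i hiN, if_pos hib, one_mul,
      (h5 j hj _ (by unfold Par.Z; omega)).2]
  · have hi := Finset.mem_range.1 hi
    rw [Finset.mem_range, not_lt] at hi'
    have : ¬ i * 2 ^ j < P.N := by
      rw [← hpow]; exact not_lt.2 (Nat.mul_le_mul_right _ hi')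
    rw [e2 i hi, if_neg this]
    simp

theorem sum_buckets {p : ℕ} [NeZero p] (s : Finset ℕ) (g : ℕ → ℕ) (f : ℕ → ZMod p) (hg : ∀ i ∈ s, g i < p) (r : ℕ) :
    ∑ x ∈ Finset.range p, (∑ i ∈ s, if g i = x then f i else 0) * (x : ZMod p) ^ r =
      ∑ i ∈ s, f i * (g i : ZMod p) ^ r := by
  simp only [Finset.sum_mul]
  rw [Finset.sum_comm]
  refine Finset.sum_congr rfl fun i hi => ?_
  rw [Finset.sum_eq_single (g i)]
  · simp
  · intro x _ hx
    simp [hx.symm]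
  · intro h; exact absurd (Finset.mem_range.2 (hg i hi)) h

/-- By `sum_buckets`, summing over the p buckets with the powers of their residues equals summing
over the blocks with the powers of their index hashes. -/
theorem syndromeProg_runs {a : ℕ → ZMod P.p} {S : ℕ → ℕ} (h : Regs P σ) (ht : Tables P a σ)
    (h8 : ∀ j ≤ P.L, ∀ x < P.p, (σ.arr 8 (j * P.p + x) : ZMod P.p) =
        ∑ i ∈ Finset.range (2 ^ (P.L - j)), if σ.arr 6 (P.L * P.N + i) = x then
          windowHash a S j (i * 2 ^ j) else 0) (h9 : ∀ x, σ.arr 9 x = 0) :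
    ∃ τ, RunsU P syndromeProg σ τ ∧ Regs P τ ∧ Only 9 σ τ ∧
      ∀ j ≤ P.L, ∀ k < P.KK, τ.arr 9 (j * P.KK + k) < P.p ∧
        (τ.arr 9 (j * P.KK + k) : ZMod P.p) = syndrome a S P.L j k := by
  obtain ⟨r, hr⟩ := h.scan (bnd := (eL + 1) * eKK * ep) (a := 9) (I := ec / ep)
    (E := .get 9 (ec / ep) + .get 8 (ec / ep / eKK * ep + ec % ep) *
      .get 7 (ec / ep % eKK * ep + ec % ep))
    (m := ep) (b := (P.L + 1) * P.KK * P.p)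
    (by simp [h.L, h.K, h.p, Par.KK]) P.KKp_le (by simp [h.p]) P.p_pos P.p_le_bound
  refine ⟨_, r, hr, only_scanSt .., fun j hj k hk => ?_⟩
  rw [scanSt_arr, if_pos rfl]
  obtain ⟨e0, e⟩ := scanF_acc (σ := σ) (a := 9) (I := ec / ep)
    (E := (.get 9 (ec / ep) + .get 8 (ec / ep / eKK * ep + ec % ep) *
      .get 7 (ec / ep % eKK * ep + ec % ep)) % ep)
    (b := (P.L + 1) * P.KK * P.p) P.p_pos (fun c => c / P.p)
    (fun c => σ.arr 8 (c / P.p / P.KK * P.p + c % P.p) * σ.arr 7 (c / P.p % P.KK * P.p + c % P.p))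
    (fun k f _ => by simp [h.p]) (fun k f _ => by simp [h.K, h.p, Par.KK])
    (j * P.KK + k) (by rw [h9]; exact P.p_pos)
  refine ⟨e0, ?_⟩
  rw [e, h9, Nat.cast_zero, zero_add, sum_block _ P.p_pos (mul_add_lt (by omega) hk), syndrome]
  have hg : ∀ i ∈ Finset.range (2 ^ (P.L - j)), i < P.N := fun i hi =>
    (Finset.mem_range.1 hi).trans_le (Nat.pow_le_pow_right (by norm_num) (by omega))
  have : ∀ i ∈ Finset.range (2 ^ (P.L - j)), windowHash a S j (i * 2 ^ j) * indexHash a P.L i ^ k =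
      windowHash a S j (i * 2 ^ j) * (σ.arr 6 (P.L * P.N + i) : ZMod P.p) ^ k := fun i hi => by
    rw [(ht.index i (hg i hi)).2]
  rw [Finset.sum_congr rfl this, ← sum_buckets (p := P.p) _ (fun i => σ.arr 6 (P.L * P.N + i)) _
    (fun i hi => (ht.index i (hg i hi)).1)]
  refine Finset.sum_congr rfl fun x hx => ?_
  have hx := Finset.mem_range.1 hx
  rw [mul_add_div_of_lt hx, mul_add_mod_of_lt hx, mul_add_div_of_lt hk, mul_add_mod_of_lt hk]
  push_cast
  rw [h8 j hj x hx, ht.power k hk x hx]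

theorem Par.digits_le (P : Par d) : (P.L + 1) * P.KK * (P.w + 1) ≤ P.TB := by
  refine le_trans (Nat.mul_le_mul_left _ ?_) P.KKp_le
  have := P.w_lt_M; have := P.M_le_p; omega

theorem Par.w_pos (P : Par d) : 0 < P.w := Nat.size_pos.2 (by have := P.X_pos; omega)

theorem digitProg_runs (h : Regs P σ) (h3 : PowTab P (σ.arr 3)) :
    ∃ τ, RunsU P digitProg σ τ ∧ Regs P τ ∧ Only 1 σ τ ∧
      (∀ x < P.L * P.w, τ.arr 1 x = σ.arr 1 x) ∧
      ∀ y < (P.L + 1) * P.KK, ∀ u < P.w + 1,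
        τ.arr 1 (P.L * P.w + (y * (P.w + 1) + u)) = σ.arr 9 y / 2 ^ u % 2 := by
  obtain ⟨r, hr⟩ := h.scan (bnd := (eL + 1) * eKK * (ew + 1)) (a := 1) (I := eL * ew + ec)
    (E := .get 9 (ec / (ew + 1)) / .get 3 (ec % (ew + 1)))
    (m := 2) (b := (P.L + 1) * P.KK * (P.w + 1)) (μ := 2)
    (by simp [h.L, h.K, h.w, Par.KK]) P.digits_le (by simp) (by norm_num)
    (by have := P.N4_le; have := P.N_pos; omega)
  obtain ⟨hF', hF⟩ := scanF_fill (σ := σ) (a := 1) (I := eL * ew + ec)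
    (E := .get 9 (ec / (ew + 1)) / .get 3 (ec % (ew + 1)) % 2) (b := (P.L + 1) * P.KK * (P.w + 1))
    (o := P.L * P.w) (fun k f _ => by simp [h.L, h.w])
  refine ⟨_, r, hr, only_scanSt .., fun x hx => ?_, fun y hy u hu => ?_⟩ <;>
    rw [scanSt_arr, if_pos rfl]
  · exact hF' x fun k _ => by omega
  · obtain ⟨f, -, -, e⟩ := hF (y * (P.w + 1) + u) (mul_add_lt hy hu)
    rw [e]
    simp only [Expr.eval_mod, Expr.eval_div, Expr.eval_get, Expr.eval_add, Expr.eval_var,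
      Expr.eval_ofNat, scanSt_var, scanSt_arr]
    norm_num
    rw [h.w, mul_add_div_of_lt hu, mul_add_mod_of_lt hu, h3 u (by have := P.L_pos; omega)]

theorem Par.msgLen_lt (P : Par d) : P.msgLen < 2 ^ P.W := by
  refine P.lt_pow_W ?_
  have h1 := P.digits_le
  have h2 : P.L * P.w ≤ P.N * P.M := Nat.mul_le_mul P.L_lt_N.le P.w_lt_M.le
  have : 4 * P.N * P.M = 4 * (P.N * P.M) := by ring
  unfold msgLen; omega

theorem Par.pow_W_gt (P : Par d) : 1 < 2 ^ P.W := Nat.one_lt_two_pow (by have := P.W_pos; omega)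

theorem Par.n_lt_pow (P : Par d) : P.n < 2 ^ P.W := by
  have := P.N4_le; have := P.n_lt; have := P.TB_lt; omega

theorem bdd_aliceInit {s : List Bool} (hs : s.length = P.n) (r : List Bool) :
    Bdd P.W (aliceInit s P.K r) := by
  have h1 := P.pow_W_gt
  have h2 := P.n_lt_pow
  have h3 := P.K_le
  refine ⟨fun x => ?_, fun a i => ?_⟩
  · simp only [aliceInit]; split_ifs <;> omega
  · have := bitAt_le_one s i
    simp only [aliceInit]; split_ifs <;> omega

theorem alice_runs {s : List Bool} (hs : s.length = P.n) (r : Fin (P.L * P.w) → Bool) :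
    ∃ msg T, Encodes (alice d) s P.K (List.ofFn r) msg T ∧ T ≤ (alice d).wt * P.U ∧
      msg.length = P.msgLen ∧ IsMsg P (bitAt s) (coinSeq r) (bitAt msg) := by
  obtain ⟨σ₁, r₁, g₁, a₁, c₁, v₁⟩ := setup_runs P (bdd_aliceInit hs (List.ofFn r)) hs rfl
  obtain ⟨σ₂, r₂, g₂, v₂, a₂, m₂⟩ := flipProg_runs g₁ (by rw [c₁]; simp [aliceInit])
    (fun x => by rw [a₁]; rfl)
  have hm : σ₂.arr 1 = coinSeq r := by rw [m₂, c₁]; rfl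
  have hz : ∀ b, 2 ≤ b → ∀ x, σ₂.arr b x = 0 := fun b hb x => by
    rw [a₂ b (by omega), a₁]; simp [aliceInit]; omega
  have hz0 : σ₂.arr 0 = bitAt s := by rw [a₂ 0 (by norm_num), a₁]; rfl
  obtain ⟨σ₃, r₃, g₃, t₃, h₃, v₃, a₃, -⟩ := tables_runs g₂ (hz 4 (by norm_num))
    (by rw [hz0]; exact fun x hx => bitAt_eq_zero (by omega))
  rw [hm] at t₃ h₃
  rw [hz0] at h₃
  obtain ⟨σ₄, r₄, g₄, o₄, b₄⟩ := bucketProg_runs g₃ t₃ h₃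
    (by rw [a₃ 8 (by norm_num)]; exact hz 8 (by norm_num))
  have t₄ : Tables P (seedMod P.p P.w (coinSeq r)) σ₄ :=
    ⟨by rw [o₄.2.1 3 (by norm_num)]; exact t₃.pow, by rw [o₄.2.1 4 (by norm_num)]; exact t₃.seed,
      by rw [o₄.2.1 6 (by norm_num)]; exact t₃.index,
      by rw [o₄.2.1 7 (by norm_num)]; exact t₃.power⟩
  obtain ⟨σ₅, r₅, g₅, o₅, b₅⟩ := syndromeProg_runs (S := bitAt s) g₄ t₄
    (by rw [o₄.2.1 6 (by norm_num)]; exact b₄)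
    (by rw [o₄.2.1 9 (by norm_num), a₃ 9 (by norm_num)]; exact hz 9 (by norm_num))
  obtain ⟨σ₆, r₆, g₆, o₆, c₆, b₆⟩ := digitProg_runs g₅
    (by rw [o₅.2.1 3 (by norm_num)]; exact t₄.pow)
  obtain ⟨T, hT, he⟩ := r₁.seq (r₂.seq (r₃.seq (r₄.seq (r₅.seq (r₆.seq
    (RunsU.assign g₆.bdd 0 (eL * ew + (eL + 1) * eKK * (ew + 1))))))))
  have hcoin : ∀ x < P.L * P.w, σ₆.arr 1 x = coinSeq r x := fun x hx => by
    rw [c₆ x hx, o₅.2.1 1 (by norm_num), o₄.2.1 1 (by norm_num), a₃ 1 (by norm_num), hm]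
  have hsym : ∀ j ≤ P.L, ∀ k < P.KK, ∃ v < P.p,
      (v : ZMod P.p) = syndrome (seedMod P.p P.w (coinSeq r)) (bitAt s) P.L j k ∧
      ∀ u < P.w + 1, σ₆.arr 1 (P.L * P.w + ((j * P.KK + k) * (P.w + 1) + u)) = v / 2 ^ u % 2 :=
    fun j hj k hk => ⟨_, (b₅ j hj k hk).1, (b₅ j hj k hk).2,
      fun u hu => b₆ _ (mul_add_lt (by omega) hk) u hu⟩
  -- Reading a cell as the truth of "equals 1" loses nothing: the cells hold coins or binary digits.
  let msg : List Bool := List.ofFn fun i : Fin P.msgLen => decide (σ₆.arr 1 i = 1)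
  have hmsg : ∀ i < P.msgLen, σ₆.arr 1 i = bitAt msg i := by
    intro i hi
    have h1 : σ₆.arr 1 i ≤ 1 := by
      rcases Nat.lt_or_ge i (P.L * P.w) with h | h
      · rw [hcoin i h]; exact coinSeq_le_one _ _
      · obtain ⟨y, rfl⟩ : ∃ y, i = P.L * P.w + y := ⟨i - P.L * P.w, by omega⟩
        have hy : y < (P.L + 1) * P.KK * (P.w + 1) := by unfold Par.msgLen at hi; omega
        have := b₆ (y / (P.w + 1)) (Nat.div_lt_of_lt_mul (by rwa [mul_comm])) (y % (P.w + 1))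
          (Nat.mod_lt _ (Nat.succ_pos _))
        rw [Nat.div_add_mod'] at this
        rw [this]; omega
    simp only [msg, bitAt, List.getD_eq_getElem?_getD, List.getElem?_ofFn, hi, dite_true,
      Option.getD_some]
    interval_cases h : σ₆.arr 1 i <;> simp
  have hlen : msg.length = P.msgLen := by simp [msg]
  refine ⟨msg, T, ⟨_, he, ?_, ?_⟩, hT, hlen, ⟨fun x hx => ?_, fun j hj k hk => ?_⟩⟩
  · rw [hlen]
    simp [g₆.L, g₆.w, g₆.K, Par.msgLen, Par.KK]
  · intro i hi
    exact hmsg i (hlen ▸ hi)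
  · rw [← hmsg x (by unfold Par.msgLen; omega), hcoin x hx]
  · obtain ⟨v, h1, h2, h3⟩ := hsym j hj k hk
    refine ⟨v, h1, h2, fun u hu => ?_⟩
    rw [← hmsg, h3 u hu]
    have := mul_add_lt (w := P.w + 1) (mul_add_lt (show j < P.L + 1 by omega) hk) hu
    unfold Par.msgLen; omega

end

/-! ### Bob: one level -/

/-- The level. -/
abbrev ej : Expr := .var 10
/-- The block length. -/
abbrev eB : Expr := .var 11
/-- The number of blocks. -/
abbrev enb : Expr := .var 12
/-- The number of unknown blocks. -/
abbrev em : Expr := .var 13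
/-- The number of unknown blocks, or `0` if there are too many. -/
abbrev emm : Expr := .var 14

/-- Alice's syndromes, in array `10`. -/
def parseProg : Prog :=
  scan ((eL + 1) * eKK * (ew + 1)) 10 (ec / (ew + 1))
    ((.get 10 (ec / (ew + 1)) + .get 1 (eL * ew + ec) * .get 3 (ec % (ew + 1))) % ep)

/-- The positions of blocks that are parts of matched blocks, in array `11`. -/
def inheritProg : Prog :=
  scan enb 11 (ej * eN + ec) ((Expr.ltE 0 (.get 11 ((ej + 1) * eN + ec / 2)) *
    (.get 11 ((ej + 1) * eN + ec / 2) + ec % 2 * eB)) % (4 * eN))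

/-- Hashes of known blocks, summed over the blocks with the same index hash. -/
def knownProg : Prog :=
  scan enb 8 (ej * ep + .get 6 (eL * eN + ec)) ((.get 8 (ej * ep + .get 6 (eL * eN + ec)) +
    Expr.ltE 0 (.get 11 (ej * eN + ec)) * .get 5 (ej * eZ + (.get 11 (ej * eN + ec) - 1))) % ep)

/-- Counting unknown blocks. -/
def countProg : Prog :=
  scan enb 12 (ec + 1) ((.get 12 ec + (Expr.get 11 (ej * eN + ec)).eqE 0) % (4 * eN))

/-- Listing unknown blocks. -/
def listProg : Prog := scan enb 13 (.get 12 ec) (ec % (4 * eN))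

/-- The syndromes of the known blocks, in array `9`. -/
def knownSyndromeProg : Prog :=
  scan (eKK * ep) 9 (ej * eKK + ec / ep)
    ((.get 9 (ej * eKK + ec / ep) + .get 8 (ej * ep + ec % ep) * .get 7 ec) % ep)

/-- Eliminating unknown blocks from the syndromes, in array `14`. -/
def eliminateProg : Prog :=
  scan (eKK * eKK * eKK) 14 ec
    (((ec / eKK % eKK).eqE 0).sel
      (.get 10 (ej * eKK + ec % eKK) + (ep - .get 9 (ej * eKK + ec % eKK)))
      (((ec / eKK % eKK - 1).eqE (ec / eKK / eKK)).sel (.get 14 (ec - eKK))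
        (.get 14 (ec - eKK + 1) +
          (ep - .get 6 (eL * eN + .get 13 (ec / eKK % eKK - 1))) * .get 14 (ec - eKK))) % ep)

/-- Products of differences of index hashes, in array `15`. -/
def productProg : Prog :=
  scan (eKK * eKK) 15 ec
    (((ec % eKK).eqE 0).sel 1
      (((ec % eKK - 1).eqE (ec / eKK)).sel (.get 15 (ec - 1))
        (.get 15 (ec - 1) * (.get 6 (eL * eN + .get 13 (ec / eKK)) +
          (ep - .get 6 (eL * eN + .get 13 (ec % eKK - 1)))))) % ep)

/-- Looking for unknown blocks near their positions. -/
def searchProg : Prog :=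
  scan (emm * eKK) 11 (ej * eN + .get 13 (ec / eKK))
    ((eK.ltE (.get 13 (ec / eKK) * eB + ec % eKK + 1) *
      ((.get 15 (ec / eKK * eKK + em) *
        .get 5 (ej * eZ + (.get 13 (ec / eKK) * eB + ec % eKK - eK)) % ep).eqE
        (.get 14 ((ec / eKK * eKK + em) * eKK)))).sel
      (.get 13 (ec / eKK) * eB + ec % eKK + 1 - eK) (.get 11 (ej * eN + .get 13 (ec / eKK)))
      % (4 * eN))

/-- A scan that overwrites some cells. -/
theorem scanF_search {σ : State} {a : ℕ} {I E : Expr} {b μ : ℕ} (ι v : ℕ → ℕ) (C : ℕ → Prop)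
    [DecidablePred C] (hI : ∀ k h, k < b → I.eval (scanSt σ a k h) = ι k)
    (hE : ∀ k h, k < b → E.eval (scanSt σ a k h) = (if C k then v k else h (ι k)) % μ)
    (hv : ∀ k < b, C k → v k < μ) (y : ℕ) (hy : σ.arr a y < μ) :
    (∃ k < b, ι k = y ∧ C k ∧ scanF σ a I E b y = v k) ∨
      ((∀ k < b, ι k = y → ¬ C k) ∧ scanF σ a I E b y = σ.arr a y) := by
  induction b with
  | zero => exact Or.inr ⟨fun k hk => absurd hk (by omega), rfl⟩
  | succ b ih =>
    have ih := ih (fun k h hk => hI k h (by omega)) (fun k h hk => hE k h (by omega))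
      (fun k hk => hv k (by omega))
    rw [scanF, Function.update_apply, hI b _ (by omega), hE b _ (by omega)]
    by_cases hb : y = ι b
    · subst hb
      rw [if_pos rfl]
      by_cases hc : C b
      · exact Or.inl ⟨b, by omega, rfl, hc, by
          rw [if_pos hc, Nat.mod_eq_of_lt (hv b (by omega) hc)]⟩
      · rw [if_neg hc]
        rcases ih with ⟨k, hk, h1, h2, h3⟩ | ⟨h1, h2⟩
        · exact Or.inl ⟨k, by omega, h1, h2, by
            rw [h3, Nat.mod_eq_of_lt (hv k (by omega) h2)]⟩
        · refine Or.inr ⟨fun k hk he => ?_, by rw [h2, Nat.mod_eq_of_lt hy]⟩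
          rcases Nat.lt_succ_iff_lt_or_eq.1 hk with h | rfl
          · exact h1 k h he
          · exact hc
    · rw [if_neg hb]
      rcases ih with ⟨k, hk, h⟩ | ⟨h1, h2⟩
      · exact Or.inl ⟨k, by omega, h⟩
      · refine Or.inr ⟨fun k hk he => ?_, h2⟩
        rcases Nat.lt_succ_iff_lt_or_eq.1 hk with h | rfl
        · exact h1 k h he
        · exact absurd he.symm hb

/-! ### Correctness of the passes of one level. -/

section

variable {d : ℕ} {P : Par d} {σ : State} {j : ℕ}

theorem bits_sum {w v : ℕ} (hv : v < 2 ^ w) : ∑ u ∈ Finset.range w, v / 2 ^ u % 2 * 2 ^ u = v := by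
  induction w generalizing v with
  | zero => simp at hv; simp [hv]
  | succ w ih =>
    rw [Finset.sum_range_succ']
    have h := ih (v := v / 2) (by rw [pow_succ] at hv; omega)
    have : ∀ u, v / 2 ^ (u + 1) % 2 * 2 ^ (u + 1) = 2 * (v / 2 / 2 ^ u % 2 * 2 ^ u) := fun u => by
      rw [pow_succ', ← Nat.div_div_eq_div_mul]; ring
    simp only [this, ← Finset.mul_sum, h]
    simp
    omega

theorem parseProg_runs (h : Regs P σ) (h3 : PowTab P (σ.arr 3)) {S r : ℕ → ℕ}
    (hm : IsMsg P S r (σ.arr 1)) (h10 : ∀ x, σ.arr 10 x = 0) :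
    ∃ τ, RunsU P parseProg σ τ ∧ Regs P τ ∧ Only 10 σ τ ∧
      ∀ j ≤ P.L, ∀ k < P.KK, (τ.arr 10 (j * P.KK + k) : ZMod P.p) =
        syndrome (seedMod P.p P.w r) S P.L j k := by
  obtain ⟨r, hr⟩ := h.scan (bnd := (eL + 1) * eKK * (ew + 1)) (a := 10) (I := ec / (ew + 1))
    (E := .get 10 (ec / (ew + 1)) + .get 1 (eL * ew + ec) * .get 3 (ec % (ew + 1)))
    (m := ep) (b := (P.L + 1) * P.KK * (P.w + 1))
    (by simp [h.L, h.K, h.w, Par.KK]) P.digits_le (by simp [h.p]) P.p_pos P.p_le_bound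
  refine ⟨_, r, hr, only_scanSt .., fun j hj k hk => ?_⟩
  rw [scanSt_arr, if_pos rfl]
  obtain ⟨-, e⟩ := scanF_acc (σ := σ) (a := 10) (I := ec / (ew + 1))
    (E := (.get 10 (ec / (ew + 1)) + .get 1 (eL * ew + ec) * .get 3 (ec % (ew + 1))) % ep)
    (b := (P.L + 1) * P.KK * (P.w + 1)) P.p_pos (fun c => c / (P.w + 1))
    (fun c => σ.arr 1 (P.L * P.w + c) * σ.arr 3 (c % (P.w + 1)))
    (fun k f _ => by simp [h.w]) (fun k f _ => by simp [h.L, h.w, h.p])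
    (j * P.KK + k) (by rw [h10]; exact P.p_pos)
  obtain ⟨v, hv, hs, hd⟩ := hm.symbol j hj k hk
  -- The number of transmitted digits suffices because p ≤ 2M = 2^(w + 1).
  have hv' : v < 2 ^ (P.w + 1) := by
    have h1 := P.p_le
    have h2 : P.M = 2 ^ P.w := rfl
    rw [pow_succ]; omega
  rw [e, h10, Nat.cast_zero, zero_add, sum_block _ (by omega) (mul_add_lt (by omega) hk), ← hs]
  conv_rhs => rw [← bits_sum hv']
  push_cast
  refine Finset.sum_congr rfl fun u hu => ?_
  have hu := Finset.mem_range.1 hu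
  rw [hd u hu, mul_add_mod_of_lt hu, h3 u (by have := P.L_pos; omega)]
  push_cast
  rfl

/-- The registers in level `j`. -/
structure LevelRegs (P : Par d) (j : ℕ) (σ : State) : Prop where
  regs : Regs P σ
  le : j ≤ P.L
  lev : σ.var 10 = j
  B : σ.var 11 = 2 ^ j
  nb : σ.var 12 = 2 ^ (P.L - j)

theorem LevelRegs.only {a : ℕ} {τ : State} (h : LevelRegs P j σ) (hr : Regs P τ)
    (ho : Only a σ τ) : LevelRegs P j τ :=
  ⟨hr, h.le, (ho.1 10 (by norm_num)).trans h.lev, (ho.1 11 (by norm_num)).trans h.B,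
    (ho.1 12 (by norm_num)).trans h.nb⟩

theorem Par.nb_le (P : Par d) (j : ℕ) : 2 ^ (P.L - j) ≤ P.N :=
  Nat.pow_le_pow_right (by norm_num) (Nat.sub_le _ _)

theorem Par.nb_mul (P : Par d) (hj : j ≤ P.L) : 2 ^ (P.L - j) * 2 ^ j = P.N := by
  rw [← pow_add, Nat.sub_add_cancel hj]; rfl

theorem Par.nb_le_TB (P : Par d) (j : ℕ) : 2 ^ (P.L - j) ≤ P.TB := by
  have := P.nb_le j; have := P.N4_le; omega

theorem Par.N4_bound (P : Par d) : 4 * P.N ≤ 4 * P.N * P.M + P.TB := by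
  have := P.N4_le; omega

/-- Positions are stored increased by one, with 0 for "no occurrence", so a missing parent yields 0.
Levels occupy separate rows of length N, and the parent row is never overwritten by this scan. -/
theorem inheritProg_runs (h : LevelRegs P j σ) :
    ∃ τ, RunsU P inheritProg σ τ ∧ Regs P τ ∧ Only 11 σ τ ∧
      ∀ i < 2 ^ (P.L - j), τ.arr 11 (j * P.N + i) =
        (if 0 < σ.arr 11 ((j + 1) * P.N + i / 2) then 1 else 0) *
          (σ.arr 11 ((j + 1) * P.N + i / 2) + i % 2 * 2 ^ j) % (4 * P.N) := by
  have hg := h.regs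
  obtain ⟨r, hr⟩ := hg.scan (bnd := enb) (a := 11) (I := ej * eN + ec)
    (E := Expr.ltE 0 (.get 11 ((ej + 1) * eN + ec / 2)) *
      (.get 11 ((ej + 1) * eN + ec / 2) + ec % 2 * eB)) (m := 4 * eN) (b := 2 ^ (P.L - j))
    (by simp [h.nb]) (P.nb_le_TB j) (by simp [hg.N]) (by have := P.N_pos; omega) P.N4_bound
  refine ⟨_, r, hr, only_scanSt .., fun i hi => ?_⟩
  rw [scanSt_arr, if_pos rfl]
  obtain ⟨-, hF⟩ := scanF_fill (σ := σ) (a := 11) (I := ej * eN + ec)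
    (E := (Expr.ltE 0 (.get 11 ((ej + 1) * eN + ec / 2)) *
      (.get 11 ((ej + 1) * eN + ec / 2) + ec % 2 * eB)) % (4 * eN)) (b := 2 ^ (P.L - j))
    (o := j * P.N) (fun k f _ => by simp [h.lev, hg.N])
  obtain ⟨f, -, h2, e⟩ := hF i hi
  have hiN := hi.trans_le (P.nb_le j)
  rw [e]
  simp only [Expr.eval_mod, Expr.eval_add, Expr.eval_mul, Expr.eval_ltE, Expr.eval_get,
    Expr.eval_div, Expr.eval_ofNat, Expr.eval_var, scanSt_var, scanSt_arr]
  norm_num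
  rw [h.lev, h.B, hg.N, h2 _ (by rw [add_mul]; omega)]

/-- Levels are processed downwards and each has its own row of buckets, so instead of clearing the
array it is enough to know that the rows not yet reached are zero. -/
theorem knownProg_runs (h : LevelRegs P j σ)
    (h8 : ∀ y < (j + 1) * P.p, σ.arr 8 y = 0) :
    ∃ τ, RunsU P knownProg σ τ ∧ Regs P τ ∧ Only 8 σ τ ∧
      (∀ y < j * P.p, τ.arr 8 y = 0) ∧
      ∀ x < P.p, (τ.arr 8 (j * P.p + x) : ZMod P.p) = ∑ i ∈ Finset.range (2 ^ (P.L - j)),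
        if σ.arr 6 (P.L * P.N + i) = x then
          (((if 0 < σ.arr 11 (j * P.N + i) then 1 else 0) *
            σ.arr 5 (j * P.Z + (σ.arr 11 (j * P.N + i) - 1)) : ℕ) : ZMod P.p) else 0 := by
  have hg := h.regs
  obtain ⟨r, hr⟩ := hg.scan (bnd := enb) (a := 8) (I := ej * ep + .get 6 (eL * eN + ec))
    (E := .get 8 (ej * ep + .get 6 (eL * eN + ec)) +
    Expr.ltE 0 (.get 11 (ej * eN + ec)) * .get 5 (ej * eZ + (.get 11 (ej * eN + ec) - 1)))
    (m := ep) (b := 2 ^ (P.L - j))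
    (by simp [h.nb]) (P.nb_le_TB j) (by simp [hg.p]) P.p_pos P.p_le_bound
  have key := fun y hy => scanF_acc (σ := σ) (a := 8) (I := ej * ep + .get 6 (eL * eN + ec))
    (E := (.get 8 (ej * ep + .get 6 (eL * eN + ec)) +
    Expr.ltE 0 (.get 11 (ej * eN + ec)) * .get 5 (ej * eZ + (.get 11 (ej * eN + ec) - 1))) % ep)
    (b := 2 ^ (P.L - j)) P.p_pos (fun i => j * P.p + σ.arr 6 (P.L * P.N + i))
    (fun i => (if 0 < σ.arr 11 (j * P.N + i) then 1 else 0) *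
            σ.arr 5 (j * P.Z + (σ.arr 11 (j * P.N + i) - 1)))
    (fun k f _ => by simp [h.lev, hg.p, hg.L, hg.N])
    (fun k f _ => by simp [h.lev, hg.p, hg.L, hg.N, Par.Z]) y hy
  refine ⟨_, r, hr, only_scanSt .., fun y hy => ?_, fun x hx => ?_⟩ <;> rw [scanSt_arr, if_pos rfl]
  · have h0 := h8 y (by rw [add_mul]; omega)
    obtain ⟨e1, e2⟩ := key y (by rw [h0]; exact P.p_pos)
    rw [h0, Nat.cast_zero, zero_add, Finset.sum_eq_zero fun i _ => if_neg (by omega)] at e2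
    rw [ZMod.natCast_eq_zero_iff] at e2
    exact Nat.eq_zero_of_dvd_of_lt e2 e1
  · have h0 := h8 (j * P.p + x) (by rw [add_mul]; omega)
    obtain ⟨-, e⟩ := key (j * P.p + x) (by rw [h0]; exact P.p_pos)
    rw [e, h0, Nat.cast_zero, zero_add]
    exact Finset.sum_congr rfl fun i _ => if_congr (by omega) rfl rfl

theorem countProg_runs (h : LevelRegs P j σ) (h12 : σ.arr 12 0 = 0) :
    ∃ τ, RunsU P countProg σ τ ∧ Regs P τ ∧ Only 12 σ τ ∧
      ∀ i ≤ 2 ^ (P.L - j), τ.arr 12 i = Nat.count (fun i => σ.arr 11 (j * P.N + i) = 0) i := by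
  have hg := h.regs
  obtain ⟨r, hr⟩ := hg.scan (bnd := enb) (a := 12) (I := ec + 1)
    (E := .get 12 ec + (Expr.get 11 (ej * eN + ec)).eqE 0) (m := 4 * eN) (b := 2 ^ (P.L - j))
    (by simp [h.nb]) (P.nb_le_TB j) (by simp [hg.N]) (by have := P.N_pos; omega) P.N4_bound
  refine ⟨_, r, hr, only_scanSt .., fun i => ?_⟩
  rw [scanSt_arr, if_pos rfl]
  obtain ⟨hF', hF⟩ := scanF_fill (σ := σ) (a := 12) (I := ec + 1)
    (E := (.get 12 ec + (Expr.get 11 (ej * eN + ec)).eqE 0) % (4 * eN)) (b := 2 ^ (P.L - j))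
    (o := 1) (fun k f _ => by simp [add_comm])
  induction i with
  | zero => intro _; rw [hF' 0 fun k _ => by omega, h12]; simp
  | succ i ih =>
    intro hi
    obtain ⟨f, h1, -, e⟩ := hF i (by omega)
    rw [add_comm i 1, e]
    simp only [Expr.eval_mod, Expr.eval_add, Expr.eval_mul, Expr.eval_eqE, Expr.eval_get,
      Expr.eval_ofNat, Expr.eval_var, scanSt_var, scanSt_arr]
    norm_num
    rw [h.lev, hg.N, h1 i (by omega), ih (by omega), add_comm 1 i, Nat.count_succ]
    refine Nat.mod_eq_of_lt ?_
    have h2 : Nat.count (fun i => σ.arr 11 (j * P.N + i) = 0) i ≤ i := Nat.count_le _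
    have := P.nb_le j
    split_ifs <;> omega

/-- Every block writes its index at its rank, known or not. The last one to write at a given rank is
the unknown block of that rank, because the rank grows right after it. -/
theorem listProg_runs (h : LevelRegs P j σ) (h12 : ∀ i ≤ 2 ^ (P.L - j),
      σ.arr 12 i = Nat.count (fun i => σ.arr 11 (j * P.N + i) = 0) i) :
    ∃ τ, RunsU P listProg σ τ ∧ Regs P τ ∧ Only 13 σ τ ∧
      ∀ i < 2 ^ (P.L - j), σ.arr 11 (j * P.N + i) = 0 →
        τ.arr 13 (Nat.count (fun i => σ.arr 11 (j * P.N + i) = 0) i) = i := by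
  have hg := h.regs
  obtain ⟨r, hr⟩ := hg.scan (bnd := enb) (a := 13) (I := .get 12 ec)
    (E := ec) (m := 4 * eN) (b := 2 ^ (P.L - j))
    (by simp [h.nb]) (P.nb_le_TB j) (by simp [hg.N]) (by have := P.N_pos; omega) P.N4_bound
  refine ⟨_, r, hr, only_scanSt .., fun i hi h0 => ?_⟩
  rw [scanSt_arr, if_pos rfl, ← h12 i hi.le]
  refine scanF_last (σ := σ) (a := 13) (I := .get 12 ec) (E := ec % (4 * eN))
    (fun k => σ.arr 12 k) (fun k => k) (fun k f _ => by simp) (fun k f hk => ?_) hi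
    fun k h1 h2 => ?_
  · simp [hg.N]
    have := P.nb_le j
    exact Nat.mod_eq_of_lt (by omega)
  · rw [h12 k h2.le, h12 i hi.le]
    exact (Nat.count_strict_mono (p := fun i => σ.arr 11 (j * P.N + i) = 0) h0 h1).ne'

theorem knownSyndromeProg_runs {a : ℕ → ZMod P.p} (h : LevelRegs P j σ) (ht : Tables P a σ)
    (h9 : ∀ y < (j + 1) * P.KK, σ.arr 9 y = 0) :
    ∃ τ, RunsU P knownSyndromeProg σ τ ∧ Regs P τ ∧ Only 9 σ τ ∧
      (∀ y < j * P.KK, τ.arr 9 y = 0) ∧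
      ∀ r < P.KK, τ.arr 9 (j * P.KK + r) < P.p ∧ (τ.arr 9 (j * P.KK + r) : ZMod P.p) =
        ∑ x ∈ Finset.range P.p, (σ.arr 8 (j * P.p + x) : ZMod P.p) * (x : ZMod P.p) ^ r := by
  have hg := h.regs
  obtain ⟨r, hr⟩ := hg.scan (bnd := eKK * ep) (a := 9) (I := ej * eKK + ec / ep)
    (E := .get 9 (ej * eKK + ec / ep) + .get 8 (ej * ep + ec % ep) * .get 7 ec)
    (m := ep) (b := P.KK * P.p)
    (by simp [hg.K, hg.p, Par.KK])
    (le_trans (by rw [mul_assoc]; exact Nat.le_mul_of_pos_left _ (Nat.succ_pos _)) P.KKp_le)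
    (by simp [hg.p]) P.p_pos P.p_le_bound
  have key := fun y hy => scanF_acc (σ := σ) (a := 9) (I := ej * eKK + ec / ep)
    (E := (.get 9 (ej * eKK + ec / ep) + .get 8 (ej * ep + ec % ep) * .get 7 ec) % ep)
    (b := P.KK * P.p) P.p_pos (fun c => j * P.KK + c / P.p)
    (fun c => σ.arr 8 (j * P.p + c % P.p) * σ.arr 7 c)
    (fun k f _ => by simp [h.lev, hg.p, hg.K, Par.KK])
    (fun k f _ => by simp [h.lev, hg.p, hg.K, Par.KK]) y hy
  refine ⟨_, r, hr, only_scanSt .., fun y hy => ?_, fun r hr => ?_⟩ <;> rw [scanSt_arr, if_pos rfl]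
  · have h0 := h9 y (by rw [add_mul]; omega)
    obtain ⟨e1, e2⟩ := key y (by rw [h0]; exact P.p_pos)
    rw [h0, Nat.cast_zero, zero_add, Finset.sum_eq_zero fun i _ =>
      if_neg (hy.trans_le (Nat.le_add_right _ _)).ne'] at e2
    rw [ZMod.natCast_eq_zero_iff] at e2
    exact Nat.eq_zero_of_dvd_of_lt e2 e1
  · have h0 := h9 (j * P.KK + r) (by rw [add_mul]; omega)
    obtain ⟨e1, e⟩ := key (j * P.KK + r) (by rw [h0]; exact P.p_pos)
    refine ⟨e1, ?_⟩
    rw [e, h0, Nat.cast_zero, zero_add]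
    rw [Finset.sum_congr rfl fun c _ => if_congr (show j * P.KK + c / P.p = j * P.KK + r ↔
      c / P.p = r by omega) rfl rfl, sum_block _ P.p_pos hr]
    refine Finset.sum_congr rfl fun x hx => ?_
    have hx := Finset.mem_range.1 hx
    rw [mul_add_mod_of_lt hx]
    push_cast
    rw [ht.power r hr x hx]

theorem Par.KK_cube_le (P : Par d) : P.KK * P.KK * P.KK ≤ P.TB := by
  have h := P.KK_le
  calc P.KK * P.KK * P.KK ≤ P.Y * P.Y * P.Y := Nat.mul_le_mul (Nat.mul_le_mul h h) h
    _ = P.Y ^ 3 := by ring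
    _ ≤ _ := P.Y_pow_le (by omega)

theorem Par.KK_sq_le (P : Par d) : P.KK * P.KK ≤ P.TB :=
  (Nat.le_mul_of_pos_right _ (by have := P.KK_pos; omega)).trans P.KK_cube_le

/-- Subtraction on the machine is truncated, so a difference modulo p is formed by adding p - y. -/
theorem cast_add_sub {p x y : ℕ} (hy : y ≤ p) : ((x + (p - y) : ℕ) : ZMod p) = x - y := by
  push_cast [Nat.cast_sub hy]
  simp [sub_eq_add_neg]

/-- A table over (k, l, r): plane `k` isolates the k-th unknown hash, so its own node is skipped.
All cells are filled regardless of the number of unknown blocks; the recurrence is claimed only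
where exponent r + 1 exists and the list entry is an index. -/
theorem eliminateProg_runs {a : ℕ → ZMod P.p} (h : LevelRegs P j σ) (ht : Tables P a σ)
    (h9 : ∀ r < P.KK, σ.arr 9 (j * P.KK + r) < P.p) :
    ∃ τ, RunsU P eliminateProg σ τ ∧ Regs P τ ∧ Only 14 σ τ ∧
      ∀ k < P.KK, (∀ l < P.KK, ∀ r < P.KK, τ.arr 14 ((k * P.KK + l) * P.KK + r) < P.p) ∧
        (∀ r < P.KK, (τ.arr 14 (k * P.KK * P.KK + r) : ZMod P.p) =
          σ.arr 10 (j * P.KK + r) - σ.arr 9 (j * P.KK + r)) ∧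
        ∀ l r, l + 1 < P.KK → r + 1 < P.KK → σ.arr 13 l < P.N →
          (τ.arr 14 ((k * P.KK + (l + 1)) * P.KK + r) : ZMod P.p) =
            if l = k then (τ.arr 14 ((k * P.KK + l) * P.KK + r) : ZMod P.p) else
              τ.arr 14 ((k * P.KK + l) * P.KK + (r + 1)) -
                indexHash a P.L (σ.arr 13 l) * τ.arr 14 ((k * P.KK + l) * P.KK + r) := by
  have hg := h.regs
  have hKK := P.KK_pos
  obtain ⟨r, hr⟩ := hg.scan (bnd := eKK * eKK * eKK) (a := 14) (I := ec)
    (E := ((ec / eKK % eKK).eqE 0).sel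
      (.get 10 (ej * eKK + ec % eKK) + (ep - .get 9 (ej * eKK + ec % eKK)))
      (((ec / eKK % eKK - 1).eqE (ec / eKK / eKK)).sel (.get 14 (ec - eKK))
        (.get 14 (ec - eKK + 1) +
          (ep - .get 6 (eL * eN + .get 13 (ec / eKK % eKK - 1))) * .get 14 (ec - eKK))))
    (m := ep) (b := P.KK * P.KK * P.KK)
    (by simp [hg.K, Par.KK]) P.KK_cube_le (by simp [hg.p]) P.p_pos P.p_le_bound
  refine ⟨_, r, hr, only_scanSt .., ?_⟩
  rw [scanSt_arr, if_pos rfl]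
  obtain ⟨-, hF⟩ := scanF_fill (σ := σ) (a := 14) (I := ec)
    (E := ((ec / eKK % eKK).eqE 0).sel
      (.get 10 (ej * eKK + ec % eKK) + (ep - .get 9 (ej * eKK + ec % eKK)))
      (((ec / eKK % eKK - 1).eqE (ec / eKK / eKK)).sel (.get 14 (ec - eKK))
        (.get 14 (ec - eKK + 1) +
          (ep - .get 6 (eL * eN + .get 13 (ec / eKK % eKK - 1))) * .get 14 (ec - eKK))) % ep)
    (b := P.KK * P.KK * P.KK) (o := 0) (fun k f _ => by simp)
  set F := scanF σ 14 ec _ _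
  have key : ∀ k < P.KK, ∀ l < P.KK, ∀ r < P.KK, ∃ f : ℕ → ℕ,
      (∀ y < (k * P.KK + l) * P.KK + r, f y = F y) ∧ F ((k * P.KK + l) * P.KK + r) =
      (if l = 0 then σ.arr 10 (j * P.KK + r) + (P.p - σ.arr 9 (j * P.KK + r)) else
        if l - 1 = k then f ((k * P.KK + l) * P.KK + r - P.KK) else
          f ((k * P.KK + l) * P.KK + r - P.KK + 1) +
          (P.p - σ.arr 6 (P.L * P.N + σ.arr 13 (l - 1))) * f ((k * P.KK + l) * P.KK + r - P.KK))
        % P.p := by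
    intro k hk l hl r hr
    obtain ⟨f, h1, -, e⟩ := hF ((k * P.KK + l) * P.KK + r) (mul_add_lt (mul_add_lt hk hl) hr)
    rw [zero_add] at e h1
    refine ⟨f, h1, ?_⟩
    rw [e]
    have e5 : (2 * P.K + 1) = P.KK := rfl
    simp only [Expr.sel, Expr.eval_mod, Expr.eval_add, Expr.eval_mul, Expr.eval_sub,
      Expr.eval_div, Expr.eval_eqE, Expr.eval_get, Expr.eval_ofNat, Expr.eval_var, scanSt_var,
      scanSt_arr, sel_arith, if_true]
    norm_num
    rw [hg.p, hg.K, hg.L, hg.N, h.lev, e5, mul_add_div_of_lt hr, mul_add_mod_of_lt hr,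
      mul_add_mod_of_lt hl, mul_add_div_of_lt hl]
  intro k hk
  refine ⟨fun l hl r hr => ?_, fun r hr => ?_, fun l r hl hr hN => ?_⟩
  · obtain ⟨f, -, e⟩ := key k hk l hl r hr
    rw [e]; exact Nat.mod_lt _ P.p_pos
  · obtain ⟨f, -, e⟩ := key k hk 0 (by omega) r hr
    rw [add_zero, if_pos rfl] at e
    rw [e, ZMod.natCast_mod, cast_add_sub (h9 r hr).le]
  · obtain ⟨f, h1, e⟩ := key k hk (l + 1) hl r (by omega)
    have e6 : (k * P.KK + (l + 1)) * P.KK + r = (k * P.KK + l) * P.KK + r + P.KK := by ring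
    have e1 : (k * P.KK + (l + 1)) * P.KK + r - P.KK = (k * P.KK + l) * P.KK + r := by omega
    rw [if_neg (by omega), Nat.add_sub_cancel, e1, h1 _ (by omega), h1 _ (by omega), add_assoc _ r 1]
      at e
    rw [e, ZMod.natCast_mod]
    split_ifs with hlk
    · rfl
    · obtain ⟨g1, g2⟩ := ht.index _ hN
      have : ((P.p - σ.arr 6 (P.L * P.N + σ.arr 13 l) : ℕ) : ZMod P.p) =
          - indexHash a P.L (σ.arr 13 l) := by
        have := cast_add_sub (x := 0) g1.le
        rw [zero_add] at this
        rw [this, g2]; simp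
      push_cast
      rw [this]; ring

/-- These products make inverses unnecessary: a candidate hash is multiplied by the product and then
compared with the eliminated value. -/
theorem productProg_runs {a : ℕ → ZMod P.p} (h : LevelRegs P j σ) (ht : Tables P a σ) :
    ∃ τ, RunsU P productProg σ τ ∧ Regs P τ ∧ Only 15 σ τ ∧
      ∀ m < P.KK, (∀ k < m, σ.arr 13 k < P.N) → ∀ k < m, ∀ l ≤ m, τ.arr 15 (k * P.KK + l) < P.p ∧
        (τ.arr 15 (k * P.KK + l) : ZMod P.p) = ∏ l' ∈ Finset.range l, if l' = k then 1 else
          indexHash a P.L (σ.arr 13 k) - indexHash a P.L (σ.arr 13 l') := by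
  have hg := h.regs
  have hKK := P.KK_pos
  obtain ⟨r, hr⟩ := hg.scan (bnd := eKK * eKK) (a := 15) (I := ec)
    (E := ((ec % eKK).eqE 0).sel 1
      (((ec % eKK - 1).eqE (ec / eKK)).sel (.get 15 (ec - 1))
        (.get 15 (ec - 1) * (.get 6 (eL * eN + .get 13 (ec / eKK)) +
          (ep - .get 6 (eL * eN + .get 13 (ec % eKK - 1)))))))
    (m := ep) (b := P.KK * P.KK)
    (by simp [hg.K, Par.KK]) P.KK_sq_le (by simp [hg.p]) P.p_pos P.p_le_bound
  refine ⟨_, r, hr, only_scanSt .., ?_⟩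
  rw [scanSt_arr, if_pos rfl]
  obtain ⟨-, hF⟩ := scanF_fill (σ := σ) (a := 15) (I := ec)
    (E := ((ec % eKK).eqE 0).sel 1
      (((ec % eKK - 1).eqE (ec / eKK)).sel (.get 15 (ec - 1))
        (.get 15 (ec - 1) * (.get 6 (eL * eN + .get 13 (ec / eKK)) +
          (ep - .get 6 (eL * eN + .get 13 (ec % eKK - 1)))))) % ep)
    (b := P.KK * P.KK) (o := 0) (fun k f _ => by simp)
  set F := scanF σ 15 ec _ _
  have key : ∀ k < P.KK, ∀ l < P.KK, ∃ f : ℕ → ℕ,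
      (∀ y < k * P.KK + l, f y = F y) ∧ F (k * P.KK + l) =
      (if l = 0 then 1 else if l - 1 = k then f (k * P.KK + l - 1) else
          f (k * P.KK + l - 1) * (σ.arr 6 (P.L * P.N + σ.arr 13 k) +
            (P.p - σ.arr 6 (P.L * P.N + σ.arr 13 (l - 1))))) % P.p := by
    intro k hk l hl
    obtain ⟨f, h1, -, e⟩ := hF (k * P.KK + l) (mul_add_lt hk hl)
    rw [zero_add] at e h1
    refine ⟨f, h1, ?_⟩
    rw [e]
    have e5 : (2 * P.K + 1) = P.KK := rfl
    simp only [Expr.sel, Expr.eval_mod, Expr.eval_add, Expr.eval_mul, Expr.eval_sub,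
      Expr.eval_div, Expr.eval_eqE, Expr.eval_get, Expr.eval_ofNat, Expr.eval_var, scanSt_var,
      scanSt_arr, sel_arith, if_true]
    norm_num
    rw [hg.p, hg.K, hg.L, hg.N, e5, mul_add_mod_of_lt hl, mul_add_div_of_lt hl]
  intro m hm hN k hk l
  induction l with
  | zero =>
    intro _
    obtain ⟨f, -, e⟩ := key k (by omega) 0 (by omega)
    rw [if_pos rfl] at e
    rw [e]
    exact ⟨Nat.mod_lt _ P.p_pos, by simp⟩
  | succ l ih =>
    intro hl
    obtain ⟨f, h1, e⟩ := key k (by omega) (l + 1) (by omega)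
    rw [if_neg (by omega), Nat.add_sub_cancel, ← add_assoc, Nat.add_sub_cancel,
      h1 _ (by omega)] at e
    rw [← add_assoc, e]
    refine ⟨Nat.mod_lt _ P.p_pos, ?_⟩
    rw [ZMod.natCast_mod, Finset.prod_range_succ, ← (ih (by omega)).2]
    split_ifs with hlk
    · simp
    · rw [Nat.cast_mul, cast_add_sub (ht.index _ (hN l (by omega))).1.le,
        (ht.index _ (hN l (by omega))).2, (ht.index _ (hN k hk)).2]

/-- All 2K + 1 shifts are tried for every listed block, hence the dichotomy: a hit is recorded, or
there was no hit and the cell keeps its old value. -/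
theorem searchProg_runs (h : LevelRegs P j σ) (hmm : σ.var 14 < P.KK) :
    ∃ τ, RunsU P searchProg σ τ ∧ Regs P τ ∧ Only 11 σ τ ∧
      ((∀ k < σ.var 14, σ.arr 13 k < 2 ^ (P.L - j)) → ∀ y, σ.arr 11 y < 4 * P.N →
        (∃ k < σ.var 14, ∃ q, j * P.N + σ.arr 13 k = y ∧ σ.arr 13 k * 2 ^ j ≤ q + P.K ∧
          q ≤ σ.arr 13 k * 2 ^ j + P.K ∧
          σ.arr 15 (k * P.KK + σ.var 13) * σ.arr 5 (j * P.Z + q) % P.p =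
            σ.arr 14 ((k * P.KK + σ.var 13) * P.KK) ∧ τ.arr 11 y = q + 1) ∨
        ((∀ k < σ.var 14, ∀ q, j * P.N + σ.arr 13 k = y → σ.arr 13 k * 2 ^ j ≤ q + P.K →
          q ≤ σ.arr 13 k * 2 ^ j + P.K →
          σ.arr 15 (k * P.KK + σ.var 13) * σ.arr 5 (j * P.Z + q) % P.p ≠
            σ.arr 14 ((k * P.KK + σ.var 13) * P.KK)) ∧ τ.arr 11 y = σ.arr 11 y)) := by
  have hg := h.regs
  have hKK := P.KK_pos
  have e5 : (2 * P.K + 1) = P.KK := rfl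
  obtain ⟨r, hr⟩ := hg.scan (bnd := emm * eKK) (a := 11) (I := ej * eN + .get 13 (ec / eKK))
    (E := (eK.ltE (.get 13 (ec / eKK) * eB + ec % eKK + 1) *
      ((.get 15 (ec / eKK * eKK + em) *
        .get 5 (ej * eZ + (.get 13 (ec / eKK) * eB + ec % eKK - eK)) % ep).eqE
        (.get 14 ((ec / eKK * eKK + em) * eKK)))).sel
      (.get 13 (ec / eKK) * eB + ec % eKK + 1 - eK) (.get 11 (ej * eN + .get 13 (ec / eKK))))
    (m := 4 * eN) (b := σ.var 14 * P.KK)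
    (by simp [hg.K, Par.KK]) ((Nat.mul_le_mul_right _ hmm.le).trans P.KK_sq_le)
    (by simp [hg.N]) (by have := P.N_pos; omega) P.N4_bound
  refine ⟨_, r, hr, only_scanSt .., fun hU y hy => ?_⟩
  rw [scanSt_arr, if_pos rfl]
  rcases scanF_search (σ := σ) (a := 11) (I := ej * eN + .get 13 (ec / eKK))
    (E := (eK.ltE (.get 13 (ec / eKK) * eB + ec % eKK + 1) *
      ((.get 15 (ec / eKK * eKK + em) *
        .get 5 (ej * eZ + (.get 13 (ec / eKK) * eB + ec % eKK - eK)) % ep).eqE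
        (.get 14 ((ec / eKK * eKK + em) * eKK)))).sel
      (.get 13 (ec / eKK) * eB + ec % eKK + 1 - eK) (.get 11 (ej * eN + .get 13 (ec / eKK)))
      % (4 * eN))
    (b := σ.var 14 * P.KK) (μ := 4 * P.N) (fun c => j * P.N + σ.arr 13 (c / P.KK))
    (fun c => σ.arr 13 (c / P.KK) * 2 ^ j + c % P.KK + 1 - P.K)
    -- The shift is encoded as c mod KK, offset by K. The first condition excludes negative
    -- positions, which truncated subtraction would turn into 0.
    (fun c => P.K < σ.arr 13 (c / P.KK) * 2 ^ j + c % P.KK + 1 ∧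
      σ.arr 15 (c / P.KK * P.KK + σ.var 13) *
        σ.arr 5 (j * P.Z + (σ.arr 13 (c / P.KK) * 2 ^ j + c % P.KK - P.K)) % P.p =
        σ.arr 14 ((c / P.KK * P.KK + σ.var 13) * P.KK))
    (fun k f _ => by simp [h.lev, hg.N, hg.K, e5])
    (fun k f _ => by
      have eZ' : 2 * P.N = P.Z := rfl
      simp [Expr.sel, h.lev, h.B, hg.N, hg.K, hg.p, e5, eZ']
      congr 1
      split_ifs <;> simp_all)
    (fun c hc hC => by
      have h1 := hU (c / P.KK) (Nat.div_lt_of_lt_mul (by rwa [mul_comm]))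
      have h2 : σ.arr 13 (c / P.KK) * 2 ^ j < P.N := by
        rw [← P.nb_mul h.le]; exact Nat.mul_lt_mul_of_pos_right h1 (by positivity)
      have h3 : c % P.KK < P.KK := Nat.mod_lt _ (by omega)
      have h4 := P.K_le
      have h5 := P.n_lt
      omega) y hy with ⟨c, hc, h1, ⟨h2, h3⟩, h4⟩ | ⟨h1, h2⟩
  · refine Or.inl ⟨c / P.KK, Nat.div_lt_of_lt_mul (by rwa [mul_comm]),
      σ.arr 13 (c / P.KK) * 2 ^ j + c % P.KK - P.K, h1, by omega, ?_, h3, by rw [h4]; omega⟩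
    have h3 : c % P.KK < P.KK := Nat.mod_lt _ (by omega)
    omega
  · refine Or.inr ⟨fun k hk q e1 e2 e3 e4 => ?_, h2⟩
    have hlt : q + P.K - σ.arr 13 k * 2 ^ j < P.KK := by omega
    have d1 : (k * P.KK + (q + P.K - σ.arr 13 k * 2 ^ j)) / P.KK = k := mul_add_div_of_lt hlt
    have d2 := mul_add_mod_of_lt (j := k) hlt
    refine h1 (k * P.KK + (q + P.K - σ.arr 13 k * 2 ^ j)) (mul_add_lt hk hlt) (by rw [d1, e1])
      ⟨?_, ?_⟩
    · rw [d1, d2]; omega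
    · rw [d1, d2, show σ.arr 13 k * 2 ^ j + (q + P.K - σ.arr 13 k * 2 ^ j) - P.K = q by omega, e4]

end

/-- `τ` differs from `σ` only in the arrays `A` and the registers `V`. -/
def Keeps (A V : List ℕ) (σ τ : State) : Prop :=
  (∀ b ∉ A, τ.arr b = σ.arr b) ∧ ∀ y ∉ V, τ.var y = σ.var y

theorem Keeps.trans {A V A' V' : List ℕ} {σ τ υ : State} (h : Keeps A V σ τ)
    (h' : Keeps A' V' τ υ) : Keeps (A ++ A') (V ++ V') σ υ := by
  refine ⟨fun b hb => ?_, fun y hy => ?_⟩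
  · rw [List.mem_append, not_or] at hb
    rw [h'.1 b hb.2, h.1 b hb.1]
  · rw [List.mem_append, not_or] at hy
    rw [h'.2 y hy.2, h.2 y hy.1]

theorem Only.keeps {a : ℕ} {σ τ : State} (h : Only a σ τ) : Keeps [a] [9] σ τ :=
  ⟨fun b hb => h.2.1 b (by simpa using hb), fun y hy => h.1 y (by simpa using hy)⟩

theorem keeps_setVar (σ : State) (x k : ℕ) : Keeps [] [x] σ (σ.setVar x k) :=
  ⟨fun _ _ => rfl, fun y hy => by rw [State.setVar_var, if_neg (by simpa using hy)]⟩

/-! ### Assembling one level. -/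

section

variable {d : ℕ} {P : Par d} {σ τ : State} {j : ℕ}

theorem Tables.keeps {A V : List ℕ} {a : ℕ → ZMod P.p} (h : Tables P a σ) (hk : Keeps A V σ τ)
    (hA : ∀ b ∈ A, 8 ≤ b) : Tables P a τ := by
  have e : ∀ b < 8, τ.arr b = σ.arr b := fun b hb => hk.1 b fun hm => by have := hA b hm; omega
  exact ⟨e 3 (by norm_num) ▸ h.pow, e 4 (by norm_num) ▸ h.seed, e 6 (by norm_num) ▸ h.index,
    e 7 (by norm_num) ▸ h.power⟩

theorem LevelRegs.keeps {A V : List ℕ} (h : LevelRegs P j σ) (hr : Regs P τ)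
    (hk : Keeps A V σ τ) (hV : ∀ y ∈ V, y ≠ 10 ∧ y ≠ 11 ∧ y ≠ 12) : LevelRegs P j τ :=
  ⟨hr, h.le, (hk.2 10 fun hm => (hV _ hm).1 rfl).trans h.lev,
    (hk.2 11 fun hm => (hV _ hm).2.1 rfl).trans h.B,
    (hk.2 12 fun hm => (hV _ hm).2.2 rfl).trans h.nb⟩

/-- Entering the next level. -/
def enterProg : Prog :=
  .seq (.assign 10 (ej - 1)) (.seq (.assign 11 (.get 3 ej)) (.assign 12 (.get 3 (eL - ej))))

theorem enterProg_runs (h : Regs P σ) (h3 : PowTab P (σ.arr 3)) (hj : σ.var 10 = j + 1)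
    (hjL : j ≤ P.L) :
    ∃ τ, RunsU P enterProg σ τ ∧ LevelRegs P j τ ∧ Keeps [] [10, 11, 12] σ τ := by
  have e0 : (ej - 1).eval σ = j := by simp [hj]
  have b0 : j < 2 ^ P.W := lt_of_le_of_lt (by omega) (h.bdd.1 10)
  have g1 : Regs P (σ.setVar 10 j) := h.setVar (by norm_num) b0
  have r1 := RunsU.assign h.bdd 10 (ej - 1)
  rw [e0] at r1
  have r2 := RunsU.assign g1.bdd 11 (.get 3 ej)
  have e1 : (Expr.get 3 ej).eval (σ.setVar 10 j) = 2 ^ j := by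
    simp [h3 j (by omega)]
  rw [e1] at r2
  have g2 := g1.setVar (x := 11) (k := 2 ^ j) (by norm_num)
    (by rw [← h3 j (by omega)]; exact h.bdd.2 _ _)
  have r3 := RunsU.assign g2.bdd 12 (.get 3 (eL - ej))
  have e2 : (Expr.get 3 (eL - ej)).eval ((σ.setVar 10 j).setVar 11 (2 ^ j)) = 2 ^ (P.L - j) := by
    simp [h.L, h3 (P.L - j) (by omega)]
  rw [e2] at r3
  have g3 := g2.setVar (x := 12) (k := 2 ^ (P.L - j)) (by norm_num)
    (by rw [← h3 (P.L - j) (by omega)]; exact h.bdd.2 _ _)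
  exact ⟨_, r1.seq (r2.seq r3), ⟨g3, hjL, by simp, by simp, by simp⟩,
    (keeps_setVar _ 10 j).trans ((keeps_setVar _ 11 _).trans (keeps_setVar _ 12 _))⟩

/-- The number of unknown blocks, and whether there are too many of them. -/
def decideProg : Prog :=
  .seq (.assign 13 (.get 12 enb)) (.seq (.assign 15 (1 - (1 - .var 15) * em.ltE eKK))
    (.assign 14 (em * em.ltE eKK)))

/-- Register `15` is a failure flag that, once set, stays set. With too many unknown blocks the
count in register `14` becomes 0, which keeps the later loops within their bounds on every run. -/
theorem decideProg_runs (h : LevelRegs P j σ) :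
    ∃ τ, RunsU P decideProg σ τ ∧ LevelRegs P j τ ∧ Keeps [] [13, 15, 14] σ τ ∧
      τ.var 13 = σ.arr 12 (2 ^ (P.L - j)) ∧
      τ.var 15 = 1 - (1 - σ.var 15) * (if τ.var 13 < P.KK then 1 else 0) ∧
      τ.var 14 = τ.var 13 * (if τ.var 13 < P.KK then 1 else 0) := by
  have hg := h.regs
  have e5 : (2 * P.K + 1) = P.KK := rfl
  have b1 := P.pow_W_gt
  have r1 := RunsU.assign hg.bdd 13 (.get 12 enb)
  have e1 : (Expr.get 12 enb).eval σ = σ.arr 12 (2 ^ (P.L - j)) := by simp [h.nb]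
  rw [e1] at r1
  set m := σ.arr 12 (2 ^ (P.L - j)) with hm
  have g1 := hg.setVar (x := 13) (k := m) (by norm_num) (hg.bdd.2 _ _)
  have r2 := RunsU.assign g1.bdd 15 (1 - (1 - .var 15) * em.ltE eKK)
  have e2 : (1 - (1 - .var 15) * em.ltE eKK : Expr).eval (σ.setVar 13 m) =
      1 - (1 - σ.var 15) * (if m < P.KK then 1 else 0) := by
    simp [hg.K, e5]
  rw [e2] at r2
  set f := 1 - (1 - σ.var 15) * (if m < P.KK then 1 else 0) with hf
  have g2 := g1.setVar (x := 15) (k := f) (by norm_num) (lt_of_le_of_lt (by omega) b1)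
  have r3 := RunsU.assign g2.bdd 14 (em * em.ltE eKK)
  have e3 : (em * em.ltE eKK : Expr).eval ((σ.setVar 13 m).setVar 15 f) =
      m * (if m < P.KK then 1 else 0) := by
    simp [hg.K, e5]
  rw [e3] at r3
  have g3 := g2.setVar (x := 14) (k := m * (if m < P.KK then 1 else 0)) (by norm_num)
    (lt_of_le_of_lt (by rw [← hm]; split <;> simp) (hg.bdd.2 12 (2 ^ (P.L - j))))
  have k := (keeps_setVar σ 13 m).trans ((keeps_setVar _ 15 f).trans (keeps_setVar _ 14
    (m * (if m < P.KK then 1 else 0))))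
  exact ⟨_, r1.seq (r2.seq r3), h.keeps g3 k (by simp), k, by simp, by simp [hf], by simp⟩

/-- One level. -/
def levelProg : Prog :=
  .seq enterProg (.seq inheritProg (.seq knownProg (.seq countProg (.seq listProg (.seq decideProg
    (.seq knownSyndromeProg (.seq eliminateProg (.seq productProg searchProg))))))))

/-- What holds when Bob is done with level `j`, whatever the coins. -/
structure LevelInv (P : Par d) (a : ℕ → ZMod P.p) (S T : ℕ → ℕ) (j : ℕ) (σ : State) : Prop where
  regs : Regs P σ
  tables : Tables P a σ
  hash : HashTab P a T (σ.arr 5)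
  symbol : ∀ j ≤ P.L, ∀ k < P.KK, (σ.arr 10 (j * P.KK + k) : ZMod P.p) = syndrome a S P.L j k
  le : j ≤ P.L + 1
  lev : σ.var 10 = j
  bucket : ∀ y < j * P.p, σ.arr 8 y = 0
  known : ∀ y < j * P.KK, σ.arr 9 y = 0
  count : σ.arr 12 0 = 0
  out : ∀ x, σ.arr 2 x = 0
  few : σ.var 14 < P.KK
  list : j ≤ P.L → ∀ k < σ.var 14, σ.arr 13 k < 2 ^ (P.L - j)

/-- What one level does: `pos` are the positions of the known blocks. -/
structure LevelStep (P : Par d) (a : ℕ → ZMod P.p) (S : ℕ → ℕ) (j : ℕ) (pos : ℕ → ℕ)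
    (σ τ : State) : Prop where
  inherit : ∀ i < 2 ^ (P.L - j), pos i = (if 0 < σ.arr 11 ((j + 1) * P.N + i / 2) then 1 else 0) *
    (σ.arr 11 ((j + 1) * P.N + i / 2) + i % 2 * 2 ^ j) % (4 * P.N)
  count : τ.var 13 = Nat.count (fun i => pos i = 0) (2 ^ (P.L - j))
  fail : τ.var 15 = 1 - (1 - σ.var 15) * (if τ.var 13 < P.KK then 1 else 0)
  few : τ.var 14 = τ.var 13 * (if τ.var 13 < P.KK then 1 else 0)
  list : ∀ i < 2 ^ (P.L - j), pos i = 0 → τ.arr 13 (Nat.count (fun i => pos i = 0) i) = i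
  elim : ∀ k < P.KK, (∀ l < P.KK, ∀ r < P.KK, τ.arr 14 ((k * P.KK + l) * P.KK + r) < P.p) ∧
    (∀ r < P.KK, (τ.arr 14 (k * P.KK * P.KK + r) : ZMod P.p) = syndrome a S P.L j r -
      ∑ i ∈ Finset.range (2 ^ (P.L - j)), (((if 0 < pos i then 1 else 0) *
        σ.arr 5 (j * P.Z + (pos i - 1)) : ℕ) : ZMod P.p) * indexHash a P.L i ^ r) ∧
    ∀ l r, l + 1 < P.KK → r + 1 < P.KK → τ.arr 13 l < P.N →
      (τ.arr 14 ((k * P.KK + (l + 1)) * P.KK + r) : ZMod P.p) =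
        if l = k then (τ.arr 14 ((k * P.KK + l) * P.KK + r) : ZMod P.p) else
          τ.arr 14 ((k * P.KK + l) * P.KK + (r + 1)) -
            indexHash a P.L (τ.arr 13 l) * τ.arr 14 ((k * P.KK + l) * P.KK + r)
  prod : ∀ m < P.KK, (∀ k < m, τ.arr 13 k < P.N) → ∀ k < m, τ.arr 15 (k * P.KK + m) < P.p ∧
    (τ.arr 15 (k * P.KK + m) : ZMod P.p) = ∏ l' ∈ Finset.range m, if l' = k then 1 else
      indexHash a P.L (τ.arr 13 k) - indexHash a P.L (τ.arr 13 l')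
  search : ∀ i < 2 ^ (P.L - j),
    (∃ k < τ.var 14, ∃ q, τ.arr 13 k = i ∧ i * 2 ^ j ≤ q + P.K ∧ q ≤ i * 2 ^ j + P.K ∧
      τ.arr 15 (k * P.KK + τ.var 13) * σ.arr 5 (j * P.Z + q) % P.p =
        τ.arr 14 ((k * P.KK + τ.var 13) * P.KK) ∧ τ.arr 11 (j * P.N + i) = q + 1) ∨
    ((∀ k < τ.var 14, ∀ q, τ.arr 13 k = i → i * 2 ^ j ≤ q + P.K → q ≤ i * 2 ^ j + P.K →
      τ.arr 15 (k * P.KK + τ.var 13) * σ.arr 5 (j * P.Z + q) % P.p ≠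
        τ.arr 14 ((k * P.KK + τ.var 13) * P.KK)) ∧ τ.arr 11 (j * P.N + i) = pos i)

/-- Nothing about the quality of the hashes is assumed, so the conclusion holds for all coins and
gives time and ranges; `LevelStep` records what correctness needs. Each pass changes few cells and
registers, and `Keeps` carries all other facts along. -/
theorem levelProg_runs {a : ℕ → ZMod P.p} {S T : ℕ → ℕ} (h : LevelInv P a S T (j + 1) σ) :
    ∃ τ pos, RunsU P levelProg σ τ ∧ LevelInv P a S T j τ ∧ LevelStep P a S j pos σ τ := by
  have hjL : j ≤ P.L := by have := h.le; omega
  obtain ⟨σ₀, r₀, g₀, k₀⟩ := enterProg_runs h.regs h.tables.pow h.lev hjL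
  obtain ⟨σ₁, r₁, g₁, o₁, f₁⟩ := inheritProg_runs g₀
  have g₁ := g₀.only g₁ o₁
  have k₁ := k₀.trans o₁.keeps
  obtain ⟨σ₂, r₂, g₂, o₂, z₂, f₂⟩ := knownProg_runs g₁
    (by rw [k₁.1 8 (by decide)]; exact h.bucket)
  have g₂ := g₁.only g₂ o₂
  have k₂ := k₁.trans o₂.keeps
  obtain ⟨σ₃, r₃, g₃, o₃, f₃⟩ := countProg_runs g₂ (by rw [k₂.1 12 (by decide)]; exact h.count)
  have g₃ := g₂.only g₃ o₃
  have k₃ := k₂.trans o₃.keeps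
  have p₃ : σ₃.arr 11 = σ₂.arr 11 := o₃.keeps.1 11 (by decide)
  obtain ⟨σ₄, r₄, g₄, o₄, f₄⟩ := listProg_runs g₃ (by rw [p₃]; exact f₃)
  have g₄ := g₃.only g₄ o₄
  have k₄ := k₃.trans o₄.keeps
  obtain ⟨σ₅, r₅, g₅, o₅, m₅, x₅, y₅⟩ := decideProg_runs g₄
  have k₅ := k₄.trans o₅
  have t₅ : Tables P a σ₅ := h.tables.keeps k₅ (by decide)
  obtain ⟨σ₆, r₆, g₆, o₆, z₆, f₆⟩ := knownSyndromeProg_runs g₅ t₅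
    (by rw [k₅.1 9 (by decide)]; exact h.known)
  have g₆ := g₅.only g₆ o₆
  have k₆ := k₅.trans o₆.keeps
  have t₆ : Tables P a σ₆ := h.tables.keeps k₆ (by decide)
  obtain ⟨σ₇, r₇, g₇, o₇, f₇⟩ := eliminateProg_runs g₆ t₆ fun r hr => (f₆ r hr).1
  have g₇ := g₆.only g₇ o₇
  have k₇ := k₆.trans o₇.keeps
  obtain ⟨σ₈, r₈, g₈, o₈, f₈⟩ := productProg_runs g₇ (h.tables.keeps k₇ (by decide))
  have g₈ := g₇.only g₈ o₈
  have k₈ := k₇.trans o₈.keeps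
  have l₈ : Keeps _ _ σ₅ σ₈ := o₆.keeps.trans (o₇.keeps.trans o₈.keeps)
  have hmm : σ₈.var 14 < P.KK := by
    rw [l₈.2 14 (by decide), y₅]
    have := P.KK_pos
    split <;> omega
  obtain ⟨σ₉, r₉, g₉, o₉, f₉⟩ := searchProg_runs g₈ hmm
  have k₉ := k₈.trans o₉.keeps
  have l₉ := l₈.trans o₉.keeps
  have g₉ := g₈.only g₉ o₉
  have v13 : σ₉.var 13 = σ₅.var 13 := l₉.2 13 (by decide)
  have v14 : σ₉.var 14 = σ₅.var 14 := l₉.2 14 (by decide)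
  have v15 : σ₉.var 15 = σ₅.var 15 := l₉.2 15 (by decide)
  have w13 : σ₉.var 13 = σ₈.var 13 := o₉.keeps.2 13 (by decide)
  have w14 : σ₉.var 14 = σ₈.var 14 := o₉.keeps.2 14 (by decide)
  have a13 : σ₉.arr 13 = σ₄.arr 13 := (o₅.trans l₉).1 13 (by decide)
  have p13 : σ₉.arr 13 = σ₈.arr 13 := o₉.keeps.1 13 (by decide)
  have p14 : σ₉.arr 14 = σ₈.arr 14 := o₉.keeps.1 14 (by decide)
  have p15 : σ₉.arr 15 = σ₈.arr 15 := o₉.keeps.1 15 (by decide)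
  have q14 : σ₉.arr 14 = σ₇.arr 14 := (o₈.keeps.trans o₉.keeps).1 14 (by decide)
  have c13 : σ₆.arr 13 = σ₄.arr 13 := (o₅.trans o₆.keeps).1 13 (by decide)
  have d13 : σ₇.arr 13 = σ₄.arr 13 := ((o₅.trans o₆.keeps).trans o₇.keeps).1 13 (by decide)
  have e11 : σ₈.arr 11 = σ₁.arr 11 := (o₂.keeps.trans (o₃.keeps.trans (o₄.keeps.trans
    (o₅.trans l₈)))).1 11 (by decide)
  have e11' : σ₂.arr 11 = σ₁.arr 11 := o₂.keeps.1 11 (by decide)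
  have e12 : σ₄.arr 12 = σ₃.arr 12 := o₄.keeps.1 12 (by decide)
  have hm : σ₉.var 13 = Nat.count (fun i => σ₁.arr 11 (j * P.N + i) = 0) (2 ^ (P.L - j)) := by
    rw [v13, m₅, e12, f₃ _ le_rfl, e11']
  have hl : ∀ i < 2 ^ (P.L - j), σ₁.arr 11 (j * P.N + i) = 0 →
      σ₉.arr 13 (Nat.count (fun i => σ₁.arr 11 (j * P.N + i) = 0) i) = i := by
    intro i hi h0
    have := f₄ i hi (by rw [p₃, e11', h0])
    rwa [p₃, e11', ← a13] at this
  have hU : ∀ k < σ₉.var 13, σ₉.arr 13 k < 2 ^ (P.L - j) := fun k hk =>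
    (count_enum (P := fun i => σ₁.arr 11 (j * P.N + i) = 0) hl (by rwa [hm] at hk)).1
  have hle : σ₉.var 14 ≤ σ₉.var 13 := by
    rw [v14, v13, y₅]; split <;> simp
  refine ⟨σ₉, fun i => σ₁.arr 11 (j * P.N + i), r₀.seq (r₁.seq (r₂.seq (r₃.seq (r₄.seq (r₅.seq
    (r₆.seq (r₇.seq (r₈.seq r₉)))))))), ⟨g₉.regs, h.tables.keeps k₉ (by decide), ?_, ?_, by omega,
    g₉.lev, ?_, ?_, ?_, ?_, by rw [w14]; exact hmm, fun _ k hk => hU k (by omega)⟩,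
    ⟨?_, hm, ?_, ?_, hl, ?_, ?_, ?_⟩⟩
  · rw [k₉.1 5 (by decide)]; exact h.hash
  · rw [k₉.1 10 (by decide)]; exact h.symbol
  · intro y hy
    rw [(o₃.keeps.trans (o₄.keeps.trans (o₅.trans l₉))).1 8 (by decide)]
    exact z₂ y hy
  · intro y hy
    rw [(o₇.keeps.trans (o₈.keeps.trans o₉.keeps)).1 9 (by decide)]
    exact z₆ y hy
  · rw [(o₄.keeps.trans (o₅.trans l₉)).1 12 (by decide), f₃ 0 (Nat.zero_le _)]; simp
  · rw [k₉.1 2 (by decide)]; exact h.out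
  · intro i hi
    have e : σ₀.arr 11 = σ.arr 11 := k₀.1 11 (by decide)
    simp only [f₁ i hi, e]
  · rw [v15, v13, x₅, k₄.2 15 (by decide)]
  · rw [v14, v13, y₅]
  · intro k hk
    obtain ⟨E1, E2, E3⟩ := f₇ k hk
    rw [q14, a13, ← c13]
    refine ⟨E1, fun r hr => ?_, E3⟩
    have e10 : σ₆.arr 10 = σ.arr 10 := k₆.1 10 (by decide)
    have e8 : σ₅.arr 8 = σ₂.arr 8 := (o₃.keeps.trans (o₄.keeps.trans o₅)).1 8 (by decide)
    rw [E2 r hr, e10, h.symbol j hjL r hr, (f₆ r hr).2, e8]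
    congr 1
    have e6 : σ₁.arr 6 = σ.arr 6 := k₁.1 6 (by decide)
    have e5 : σ₁.arr 5 = σ.arr 5 := k₁.1 5 (by decide)
    have hiN : ∀ i ∈ Finset.range (2 ^ (P.L - j)), i < P.N := fun i hi =>
      (Finset.mem_range.1 hi).trans_le (P.nb_le j)
    -- The sums over buckets become sums over blocks, as on Alice's side, so her syndromes and Bob's
    -- can be subtracted term by term.
    rw [Finset.sum_congr rfl fun x hx => by rw [f₂ x (Finset.mem_range.1 hx), e6, e5],
      sum_buckets (p := P.p) _ (fun i => σ.arr 6 (P.L * P.N + i)) _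
      (fun i hi => (h.tables.index i (hiN i hi)).1)]
    exact Finset.sum_congr rfl fun i hi => by rw [(h.tables.index i (hiN i hi)).2]
  · intro m hm' hN k hk
    rw [p15, a13, ← d13]
    exact f₈ m hm' (by rw [d13, ← a13]; exact hN) k hk m le_rfl
  · intro i hi
    have e5 : σ₈.arr 5 = σ.arr 5 := k₈.1 5 (by decide)
    have hlt : σ₈.arr 11 (j * P.N + i) < 4 * P.N := by
      rw [e11, f₁ i hi]; exact Nat.mod_lt _ (by have := P.N_pos; omega)
    have := f₉ (fun k hk => by rw [← p13]; exact hU k (by omega)) (j * P.N + i) hlt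
    rw [e5, e11, ← p13, ← p14, ← p15, ← w13, ← w14] at this
    simp only [Nat.add_left_cancel_iff] at this
    rcases this with ⟨k, hk, q, rfl, h1⟩ | ⟨h1, h2⟩
    · exact Or.inl ⟨k, hk, q, rfl, h1⟩
    · refine Or.inr ⟨?_, h2⟩
      rintro k hk q rfl
      exact h1 k hk q rfl

end

/-- The positions found in level `j` are right. -/
structure LevelGood {d : ℕ} (P : Par d) (a : ℕ → ZMod P.p) (S T : ℕ → ℕ) (j : ℕ)
    (σ : State) : Prop where
  unmatched : j ≤ P.L → ∀ i < 2 ^ (P.L - j), σ.arr 11 (j * P.N + i) = 0 → Unmatched S T P.K j i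
  matched : ∀ i < 2 ^ (P.L - j), σ.arr 11 (j * P.N + i) ≠ 0 →
    j ≤ P.L ∧ BlockMatch S T P.K j i (σ.arr 11 (j * P.N + i) - 1)
  listed : j ≤ P.L → ∀ i < 2 ^ (P.L - j), σ.arr 11 (j * P.N + i) = 0 →
    ∃ k < σ.var 14, σ.arr 13 k = i
  value : j ≤ P.L → ∀ k < σ.var 14, σ.arr 15 (k * P.KK + σ.var 13) < P.p ∧
    σ.arr 14 ((k * P.KK + σ.var 13) * P.KK) < P.p ∧
    (σ.arr 15 (k * P.KK + σ.var 13) : ZMod P.p) ≠ 0 ∧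
    (σ.arr 14 ((k * P.KK + σ.var 13) * P.KK) : ZMod P.p) =
      windowHash a S j (σ.arr 13 k * 2 ^ j) * σ.arr 15 (k * P.KK + σ.var 13)

/-! ### The positions stay correct from level to level. -/

section

variable {d : ℕ} {P : Par d} {σ τ : State} {j : ℕ} {a : ℕ → ZMod P.p}

theorem natCast_eq_iff_of_lt {p x y : ℕ} (hx : x < p) (hy : y < p) : (x : ZMod p) = y ↔ x = y := by
  rw [ZMod.natCast_eq_natCast_iff', Nat.mod_eq_of_lt hx, Nat.mod_eq_of_lt hy]

theorem Par.block_lt (P : Par d) (hj : j ≤ P.L) {i : ℕ} (hi : i < 2 ^ (P.L - j)) :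
    i * 2 ^ j < P.N := by
  rw [← P.nb_mul hj]; exact Nat.mul_lt_mul_of_pos_right hi (by positivity)

theorem Par.K_lt_N (P : Par d) : P.K < P.N := P.K_le.trans_lt P.n_lt

/-- The positions of the known blocks are right. -/
theorem LevelStep.pos_spec {S T pos : ℕ → ℕ} (h : LevelStep P a S j pos σ τ) (hj : j ≤ P.L)
    (hg : LevelGood P a S T (j + 1) σ) {i : ℕ} (hi : i < 2 ^ (P.L - j)) :
    (pos i = 0 → Unknown S T P.K P.L j i) ∧
      (pos i ≠ 0 → ¬ Unknown S T P.K P.L j i ∧ BlockMatch S T P.K j i (pos i - 1)) := by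
  have hi2 : i / 2 < 2 ^ (P.L - (j + 1)) := by
    -- At the top, truncated subtraction provides one fictitious parent for the single block;
    -- `LevelGood` rules out a recorded position for it, so the top block is unknown.
    rcases hj.eq_or_lt with rfl | hlt
    · rw [Nat.sub_self, pow_zero] at hi
      have : i = 0 := by omega
      subst this; simp
    · rw [show P.L - j = P.L - (j + 1) + 1 by omega, pow_succ] at hi; omega
  have e := h.inherit i hi
  set q := σ.arr 11 ((j + 1) * P.N + i / 2) with hq
  by_cases h0 : q = 0
  · rw [if_neg (by omega), zero_mul, Nat.zero_mod] at e
    exact ⟨fun _ hlt => hg.unmatched hlt _ hi2 h0, fun h => absurd e h⟩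
  · obtain ⟨hjL, hb⟩ := hg.matched _ hi2 h0
    rw [← hq] at hb
    have h1 := P.block_lt hjL hi2
    have h2 := hb.2.1
    have h3 := P.K_lt_N
    have h4 : i % 2 * 2 ^ j ≤ P.N := by
      have : i % 2 * 2 ^ j ≤ 1 * 2 ^ j := Nat.mul_le_mul_right _ (by omega)
      have h5 : 2 ^ j ≤ P.N := Nat.pow_le_pow_right (by norm_num) hj
      omega
    rw [if_pos (by omega), one_mul, Nat.mod_eq_of_lt (by omega)] at e
    refine ⟨fun h => by omega, fun _ => ⟨fun hu => hu hjL _ hb, ?_⟩⟩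
    rw [e, show q + i % 2 * 2 ^ j - 1 = q - 1 + i % 2 * 2 ^ j by omega]
    exact hb.child

theorem count_congr_lt {p q : ℕ → Prop} [DecidablePred p] [DecidablePred q] {n : ℕ}
    (h : ∀ i < n, p i ↔ q i) : Nat.count p n = Nat.count q n := by
  rw [Nat.count_eq_card_filter_range, Nat.count_eq_card_filter_range]
  congr 1
  exact Finset.filter_congr fun i hi => h i (Finset.mem_range.1 hi)

/-- If the parents' positions are right, Bob's unknown blocks are the truly unknown ones, so `Good`
applies to his comparisons. Distinct unknown blocks have distinct nodes, so elimination yields each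
unknown hash times a nonzero product. A true occurrence passes the test since equal windows have
equal hashes; conversely, a window that passes is an occurrence by `Good.block`. -/
theorem LevelStep.good {S T pos : ℕ → ℕ} (h : LevelStep P a S j pos σ τ) (hj : j ≤ P.L)
    (hgood : Good S T P.n P.K P.L a) (hT : HashTab P a T (σ.arr 5)) (hf : σ.var 15 = 0)
    (hg : LevelGood P a S T (j + 1) σ) :
    (τ.var 15 = 0 → LevelGood P a S T j τ) ∧
      (τ.var 15 ≠ 0 → ¬ Nat.count (Unknown S T P.K P.L j) (2 ^ (P.L - j)) ≤ 2 * P.K) := by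
  have hpos : ∀ i < 2 ^ (P.L - j), (pos i = 0 ↔ Unknown S T P.K P.L j i) := fun i hi =>
    ⟨(h.pos_spec hj hg hi).1, fun hu => by_contra fun h0 => ((h.pos_spec hj hg hi).2 h0).1 hu⟩
  have hm := h.count
  rw [count_congr_lt hpos] at hm
  have e15 := h.fail
  have e14 := h.few
  rw [hf] at e15
  have hKK : P.KK = 2 * P.K + 1 := rfl
  by_cases hlt : τ.var 13 < P.KK
  swap
  · rw [if_neg hlt] at e15
    exact ⟨fun h => by omega, fun _ => by omega⟩
  rw [if_pos hlt] at e15 e14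
  rw [mul_one] at e14
  refine ⟨fun _ => ?_, fun h => by omega⟩
  have hcnt : Nat.count (Unknown S T P.K P.L j) (2 ^ (P.L - j)) ≤ 2 * P.K := by omega
  have hU : ∀ k < τ.var 13, τ.arr 13 k < 2 ^ (P.L - j) ∧ pos (τ.arr 13 k) = 0 ∧
      Nat.count (fun i => pos i = 0) (τ.arr 13 k) = k := fun k hk =>
    count_enum (P := fun i => pos i = 0) h.list (by rwa [h.count] at hk)
  have hUN : ∀ k < τ.var 13, τ.arr 13 k < P.N := fun k hk => (hU k hk).1.trans_le (P.nb_le j)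
  have hK3 := P.KK_pos
  have hKN := P.K_lt_N
  -- For a known block the hash that Bob reads from `t` is that of Alice's block, so its terms
  -- cancel and the unknown blocks remain.
  have hres : ∀ r, syndrome a S P.L j r -
      ∑ i ∈ Finset.range (2 ^ (P.L - j)), (((if 0 < pos i then 1 else 0) *
        σ.arr 5 (j * P.Z + (pos i - 1)) : ℕ) : ZMod P.p) * indexHash a P.L i ^ r =
      ∑ q ∈ Finset.range (τ.var 13), windowHash a S j (τ.arr 13 q * 2 ^ j) *
        indexHash a P.L (τ.arr 13 q) ^ r := fun r => by
    rw [syndrome, ← Finset.sum_sub_distrib, h.count, ← sum_enum (P := fun i => pos i = 0) h.list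
      fun i => windowHash a S j (i * 2 ^ j) * indexHash a P.L i ^ r]
    refine Finset.sum_congr rfl fun i hi => ?_
    have hi := Finset.mem_range.1 hi
    by_cases h0 : pos i = 0
    · simp [h0]
    · have hb := ((h.pos_spec hj hg hi).2 h0).2
      have h1 := P.block_lt hj hi
      have h2 := hb.2.1
      rw [if_neg h0, if_pos (by omega), one_mul, (hT j hj _ (by unfold Par.Z; omega)).2,
        windowHash_congr hb.2.2, sub_self]
  have hval : ∀ k < τ.var 13, τ.arr 15 (k * P.KK + τ.var 13) < P.p ∧
      τ.arr 14 ((k * P.KK + τ.var 13) * P.KK) < P.p ∧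
      (τ.arr 15 (k * P.KK + τ.var 13) : ZMod P.p) ≠ 0 ∧
      (τ.arr 14 ((k * P.KK + τ.var 13) * P.KK) : ZMod P.p) =
        windowHash a S j (τ.arr 13 k * 2 ^ j) * τ.arr 15 (k * P.KK + τ.var 13) := fun k hk => by
    obtain ⟨E1, E2, E3⟩ := h.elim k (by omega)
    obtain ⟨p1, p2⟩ := h.prod (τ.var 13) hlt hUN k hk
    refine ⟨p1, by simpa using E1 _ hlt 0 (by omega), ?_, ?_⟩
    -- Equal nodes would mean equal blocks by `Good.index`, and then equal ranks in the list.
    · rw [p2, Finset.prod_ne_zero_iff]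
      intro l hl
      have hl := Finset.mem_range.1 hl
      split_ifs with hlk
      · exact one_ne_zero
      · rw [sub_ne_zero]
        intro he
        obtain ⟨u1, u2, u3⟩ := hU k hk
        obtain ⟨v1, v2, v3⟩ := hU l hl
        have := hgood.index j hj hcnt _ u1 ((hpos _ u1).1 u2) _ v1 ((hpos _ v1).1 v2) he
        rw [this] at u3
        exact hlk (v3.symm.trans u3)
    -- Here at most 2K unknown blocks meet 2K + 1 power sums.
    · have := eliminate_all (F := ZMod P.p) hk (fun l => indexHash a P.L (τ.arr 13 l))
        (fun q => windowHash a S j (τ.arr 13 q * 2 ^ j))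
        (fun l r => (τ.arr 14 ((k * P.KK + l) * P.KK + r) : ZMod P.p)) (R := P.KK)
        (fun r hr => by
          simp only [add_zero]
          rw [E2 r hr, hres r])
        (fun l r hl hr => E3 l r (by omega) (by omega) (hUN l hl)) hlt
      simp only [add_zero] at this
      rw [this, p2]
  have hhash : ∀ i < 2 ^ (P.L - j), ∀ q, q ≤ i * 2 ^ j + P.K →
      (σ.arr 5 (j * P.Z + q) : ZMod P.p) = windowHash a T j q := fun i hi q hq =>
    (hT j hj q (by have := P.block_lt hj hi; unfold Par.Z; omega)).2
  have hcount : ∀ i < 2 ^ (P.L - j), pos i = 0 →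
      ∃ k < τ.var 14, τ.arr 13 k = i := fun i hi h0 => by
    refine ⟨Nat.count (fun i => pos i = 0) i, ?_, h.list i hi h0⟩
    rw [e14, h.count]
    exact Nat.count_strict_mono (p := fun i => pos i = 0) h0 hi
  refine ⟨fun _ i hi h0 => ?_, fun i hi h0 => ⟨hj, ?_⟩, fun _ i hi h0 => ?_, fun _ k hk =>
    hval k (by omega)⟩
  · rcases h.search i hi with ⟨k, -, q, -, -, -, -, e⟩ | ⟨h1, h2⟩
    · omega
    · obtain ⟨k, hk, rfl⟩ := hcount i hi (h2 ▸ h0)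
      rintro q ⟨b1, b2, b3⟩
      refine h1 k hk q rfl b1 b2 ?_
      obtain ⟨v1, v2, v3, v4⟩ := hval k (by omega)
      rw [← natCast_eq_iff_of_lt (Nat.mod_lt _ P.p_pos) v2, ZMod.natCast_mod, Nat.cast_mul, v4,
        hhash _ hi q b2, windowHash_congr b3, mul_comm]
  · rcases h.search i hi with ⟨k, hk, q, rfl, b1, b2, b3, e⟩ | ⟨h1, h2⟩
    · rw [e, Nat.add_sub_cancel]
      refine ⟨b1, b2, ?_⟩
      obtain ⟨v1, v2, v3, v4⟩ := hval k (by omega)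
      obtain ⟨u1, u2, u3⟩ := hU k (by omega)
      rw [← natCast_eq_iff_of_lt (Nat.mod_lt _ P.p_pos) v2, ZMod.natCast_mod, Nat.cast_mul, v4,
        hhash _ hi q b2, mul_comm] at b3
      -- Cancelling the nonzero product turns the passed test into equality of hashes.
      exact hgood.block j hj hcnt _ u1 ((hpos _ u1).1 u2) q b1 b2 (mul_right_cancel₀ v3 b3).symm
    · rw [h2] at h0 ⊢
      exact ((h.pos_spec hj hg hi).2 h0).2
  · rcases h.search i hi with ⟨k, -, q, -, -, -, -, e⟩ | ⟨h1, h2⟩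
    · omega
    · exact hcount i hi (h2 ▸ h0)

/-- All levels. -/
def levelsProg : Prog := .seq (.assign 10 (eL + 1)) (.loop ej levelProg)

/-- If no hash is misleading, all positions are right unless the strings are far apart. -/
def LevelsGood (P : Par d) (a : ℕ → ZMod P.p) (s t : List Bool) (j : ℕ) (σ : State) : Prop :=
  Good (bitAt s) (bitAt t) P.n P.K P.L a →
    (σ.var 15 = 0 → LevelGood P a (bitAt s) (bitAt t) j σ) ∧ (σ.var 15 ≠ 0 → P.K < editDist s t)

/-- The flag can only be raised at a level with more than 2K unknown blocks, which
`count_unknown_le` forbids at distance at most K. Once raised, nothing more is claimed about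
positions. -/
theorem LevelStep.levelsGood {s t : List Bool} {pos : ℕ → ℕ}
    (h : LevelStep P a (bitAt s) j pos σ τ) (hj : j ≤ P.L)
    (hT : HashTab P a (bitAt t) (σ.arr 5)) (hg : LevelsGood P a s t (j + 1) σ) :
    LevelsGood P a s t j τ := by
  intro hgood
  obtain ⟨g1, g2⟩ := hg hgood
  by_cases hf : σ.var 15 = 0
  · obtain ⟨h1, h2⟩ := h.good hj hgood hT hf (g1 hf)
    refine ⟨h1, fun h0 => ?_⟩
    by_contra hc
    exact h2 h0 (count_unknown_le P.one_le (by omega) hj)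
  · have e := h.fail
    rw [show 1 - σ.var 15 = 0 by omega, zero_mul] at e
    exact ⟨fun h => by omega, fun _ => g2 hf⟩

theorem levelsLoop_runs {s t : List Bool} (h : LevelInv P a (bitAt s) (bitAt t) j σ)
    (hg : LevelsGood P a s t j σ) :
    ∃ τ, Runs (.loop ej levelProg) σ τ ((j + 1) * ((levelProg.wt + 3) * P.U)) ∧
      LevelInv P a (bitAt s) (bitAt t) 0 τ ∧ LevelsGood P a s t 0 τ := by
  induction j generalizing σ with
  | zero =>
    have hc := ej.cost_le P.W_pos h.regs.bdd
    have e : ej.wt = 2 := rfl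
    rw [e] at hc
    refine ⟨σ, ⟨_, ?_, .loopFalse (by simp [h.lev])⟩, h, hg⟩
    have := P.W_le_U
    have := P.W_pos
    nlinarith
  | succ j ih =>
    have hc := ej.cost_le P.W_pos h.regs.bdd
    have e : ej.wt = 2 := rfl
    rw [e] at hc
    obtain ⟨τ, pos, ⟨T₁, hT₁, r⟩, hi, hs⟩ := levelProg_runs h
    obtain ⟨υ, ⟨T₂, hT₂, r'⟩, h'⟩ := ih hi (hs.levelsGood (by have := h.le; omega) h.hash hg)
    refine ⟨υ, ⟨_, ?_, .loopTrue (by simp [h.lev]) r r'⟩, h'⟩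
    have := P.W_le_U
    have := P.W_pos
    rw [show j + 1 + 1 = (j + 1) + 1 from rfl, add_mul (j + 1) 1]
    nlinarith

end

/-! ### Bob: the output -/

/-- Copying the known symbols, in array `2`. -/
def copyProg : Prog :=
  scan eN 2 ec (Expr.ltE 0 (.get 11 ec) * .get 5 (.get 11 ec - 1) % 2)

/-- Solving for the unknown symbols. -/
def solveProg : Prog :=
  scan emm 2 (.get 13 ec) ((Expr.get 14 ((ec * eKK + em) * eKK)).eqE (.get 15 (ec * eKK + em)) % 2)

/-- The larger value. -/
def Expr.maxE (a b : Expr) : Expr := a + (b - a)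

@[simp] theorem Expr.eval_maxE (σ : State) (a b : Expr) :
    (a.maxE b).eval σ = max (a.eval σ) (b.eval σ) := by
  simp only [maxE, eval_add, eval_sub]; omega

/-- The diagonal. -/
abbrev ek : Expr := ec / (eL + 1) % (2 * eK + 3)

/-- Where a slide starts. -/
def startExpr : Expr :=
  ((ec / (eL + 1) / (2 * eK + 3)).eqE 0).sel (ek.eqE (eK + 1))
    (Expr.ltE 0 ek * ek.ltE (2 * eK + 2) *
      ((Expr.ltE 0 (.get 17 (ec - (2 * eK + 3) * (eL + 1) + eL)) *
          (.get 17 (ec - (2 * eK + 3) * (eL + 1) + eL) + 1)).maxE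
        (Expr.ltE 0 (.get 17 (ec - (2 * eK + 3) * (eL + 1) + (eL + 1) + eL)) *
          (.get 17 (ec - (2 * eK + 3) * (eL + 1) + (eL + 1) + eL) + 1))).maxE
        (.get 17 (ec - (2 * eK + 3) * (eL + 1) - (eL + 1) + eL)))

/-- The length of a step of a slide. -/
abbrev eq2 : Expr := .get 3 (eL - ec % (eL + 1))

/-- The previous entry. -/
abbrev ev : Expr := .get 17 (ec - 1)

/-- A step of a slide. -/
def slideExpr : Expr :=
  ev + Expr.ltE 0 ev * (ev - 1 + eq2).ltE (.var 0 + 1) *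
    (ev - 1 + ek - (eK + 1) + eq2).ltE (.var 0 + 1) *
    (Expr.get 16 ((eL - ec % (eL + 1)) * eZ + (ev - 1))).eqE
      (.get 5 ((eL - ec % (eL + 1)) * eZ + (ev - 1 + ek - (eK + 1)))) * eq2

/-- The edit distance by diagonals, in array `17`. -/
def distProg : Prog :=
  scan ((eK + 1) * (2 * eK + 3) * (eL + 1)) 17 ec
    (((ec % (eL + 1)).eqE 0).sel startExpr slideExpr % (4 * eN))

/-- Whether there is an output. -/
def verdictProg : Prog :=
  .assign 0 ((Expr.var 15).eqE 0 *
    (Expr.var 0).ltE (.get 17 ((eK * (2 * eK + 3) + (eK + 1)) * (eL + 1) + eL)))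

/-! ### Correctness of the output passes. -/

section

variable {d : ℕ} {P : Par d} {σ τ : State} {a : ℕ → ZMod P.p}

theorem copyProg_runs (h : Regs P σ) (h2 : ∀ x, σ.arr 2 x = 0) :
    ∃ τ, RunsU P copyProg σ τ ∧ Regs P τ ∧ Only 2 σ τ ∧ (∀ x, P.N ≤ x → τ.arr 2 x = 0) ∧
      ∀ x < P.N, τ.arr 2 x = (if 0 < σ.arr 11 x then 1 else 0) * σ.arr 5 (σ.arr 11 x - 1) % 2 := by
  obtain ⟨r, hr⟩ := h.scan (bnd := eN) (a := 2) (I := ec)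
    (E := Expr.ltE 0 (.get 11 ec) * .get 5 (.get 11 ec - 1)) (m := 2) (b := P.N) (μ := 2)
    (by simp [h.N]) (by have := P.N4_le; omega) (by simp) (by norm_num)
    (by have := P.N4_le; have := P.N_pos; omega)
  obtain ⟨hF', hF⟩ := scanF_fill (σ := σ) (a := 2) (I := ec)
    (E := Expr.ltE 0 (.get 11 ec) * .get 5 (.get 11 ec - 1) % 2) (b := P.N) (o := 0)
    (fun k f _ => by simp)
  refine ⟨_, r, hr, only_scanSt .., fun x hx => ?_, fun x hx => ?_⟩ <;>
    rw [scanSt_arr, if_pos rfl]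
  · rw [hF' x fun k _ => by omega, h2]
  · obtain ⟨f, -, -, e⟩ := hF x hx
    rw [zero_add] at e
    rw [e]
    simp

/-- A hash of a single symbol is the symbol, so the eliminated value is the symbol times the
product, and comparing the two decides the symbol. That the output consists of bits and vanishes
from N on does not depend on the hashes. -/
theorem solveProg_runs (h : Regs P σ) (hm : σ.var 14 < P.KK) (h13 : ∀ k < σ.var 14, σ.arr 13 k < P.N)
    (h2 : ∀ x, P.N ≤ x → σ.arr 2 x = 0) (h2' : ∀ x, σ.arr 2 x ≤ 1) :
    ∃ τ, RunsU P solveProg σ τ ∧ Regs P τ ∧ Only 2 σ τ ∧ (∀ x, P.N ≤ x → τ.arr 2 x = 0) ∧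
      (∀ x, τ.arr 2 x ≤ 1) ∧
      ∀ x, (∃ k < σ.var 14, σ.arr 13 k = x ∧ τ.arr 2 x =
          if σ.arr 14 ((k * P.KK + σ.var 13) * P.KK) = σ.arr 15 (k * P.KK + σ.var 13)
            then 1 else 0) ∨
        ((∀ k < σ.var 14, σ.arr 13 k ≠ x) ∧ τ.arr 2 x = σ.arr 2 x) := by
  have e5 : (2 * P.K + 1) = P.KK := rfl
  obtain ⟨r, hr⟩ := h.scan (bnd := emm) (a := 2) (I := .get 13 ec)
    (E := (Expr.get 14 ((ec * eKK + em) * eKK)).eqE (.get 15 (ec * eKK + em))) (m := 2)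
    (b := σ.var 14) (μ := 2)
    (by simp) (hm.le.trans ((Nat.le_mul_of_pos_left _ (by have := P.KK_pos; omega)).trans
      P.KK_sq_le)) (by simp) (by norm_num) (by have := P.N4_le; have := P.N_pos; omega)
  have key := fun x => scanF_search (σ := σ) (a := 2) (I := .get 13 ec)
    (E := (Expr.get 14 ((ec * eKK + em) * eKK)).eqE (.get 15 (ec * eKK + em)) % 2)
    (b := σ.var 14) (μ := 2) (fun k => σ.arr 13 k)
    (fun k => if σ.arr 14 ((k * P.KK + σ.var 13) * P.KK) = σ.arr 15 (k * P.KK + σ.var 13)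
            then 1 else 0) (fun _ => True) (fun k f _ => by simp)
    (fun k f _ => by simp [h.K, e5]) (fun k _ _ => by split <;> omega) x
    (by have := h2' x; omega)
  refine ⟨_, r, hr, only_scanSt .., fun x hx => ?_, fun x => ?_, fun x => ?_⟩ <;>
    rw [scanSt_arr, if_pos rfl]
  · rcases key x with ⟨k, hk, rfl, -, -⟩ | ⟨-, e⟩
    · exact absurd (h13 k hk) (by omega)
    · rw [e, h2 x hx]
  · rcases key x with ⟨k, hk, -, -, e⟩ | ⟨-, e⟩
    · rw [e]; split <;> omega
    · rw [e]; exact h2' x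
  · rcases key x with ⟨k, hk, h1, -, e⟩ | ⟨h1, e⟩
    · exact Or.inl ⟨k, hk, h1, e⟩
    · exact Or.inr ⟨fun k hk h => h1 k hk h trivial, e⟩

theorem Par.dist_le (P : Par d) : (P.K + 1) * (2 * P.K + 3) * (P.L + 1) ≤ P.TB := by
  have h1 := P.Y_ge
  have h2 := P.Y_ge'
  have h3 := P.one_le
  calc (P.K + 1) * (2 * P.K + 3) * (P.L + 1) ≤ P.Y * P.Y * P.Y :=
        Nat.mul_le_mul (Nat.mul_le_mul (by omega) (by omega)) (by omega)
    _ = P.Y ^ 3 := by ring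
    _ ≤ _ := P.Y_pow_le (by omega)

/-- The machine computes the table for the comparison "the hashes agree", whatever these hashes are;
relating it to the exact table is left to `lv_congr`. -/
theorem distProg_runs (h : Regs P σ) (h3 : PowTab P (σ.arr 3)) :
    ∃ τ, RunsU P distProg σ τ ∧ Regs P τ ∧ Only 17 σ τ ∧
      ∀ e ≤ P.K, ∀ k < 2 * P.K + 3, ∀ b ≤ P.L,
        τ.arr 17 ((e * (2 * P.K + 3) + k) * (P.L + 1) + b) = lv P.n P.K P.L
          (fun l x y => σ.arr 16 (l * P.Z + x) = σ.arr 5 (l * P.Z + y)) e k b := by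
  obtain ⟨r, hr⟩ := h.scan (bnd := (eK + 1) * (2 * eK + 3) * (eL + 1)) (a := 17) (I := ec)
    (E := ((ec % (eL + 1)).eqE 0).sel startExpr slideExpr)
    (m := 4 * eN) (b := (P.K + 1) * (2 * P.K + 3) * (P.L + 1))
    (by simp [h.K, h.L]) P.dist_le (by simp [h.N]) (by have := P.N_pos; omega) P.N4_bound
  obtain ⟨-, hF⟩ := scanF_fill (σ := σ) (a := 17) (I := ec)
    (E := ((ec % (eL + 1)).eqE 0).sel startExpr slideExpr % (4 * eN))
    (b := (P.K + 1) * (2 * P.K + 3) * (P.L + 1)) (o := 0) (fun k f _ => by simp)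
  refine ⟨_, r, hr, only_scanSt .., ?_⟩
  rw [scanSt_arr, if_pos rfl]
  set F := scanF σ 17 ec _ _
  set cmp : ℕ → ℕ → ℕ → Prop := fun l x y => σ.arr 16 (l * P.Z + x) = σ.arr 5 (l * P.Z + y)
    with hcmp
  have hmod : ∀ e ≤ P.K, ∀ k b, lv P.n P.K P.L cmp e k b % (4 * P.N) =
      lv P.n P.K P.L cmp e k b := fun e he k b => Nat.mod_eq_of_lt (by
    have h1 := lv_le (n := P.n) (K := P.K) (L := P.L) (cmp := cmp) e k b
    have := P.n_lt; have := P.K_lt_N; omega)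
  have start : ∀ e ≤ P.K, ∀ k < 2 * P.K + 3, ∃ f : ℕ → ℕ,
      (∀ y < (e * (2 * P.K + 3) + k) * (P.L + 1), f y = F y) ∧
      F ((e * (2 * P.K + 3) + k) * (P.L + 1)) =
        (if e = 0 then if k = P.K + 1 then 1 else 0 else
          (if 0 < k ∧ k < 2 * P.K + 2 then 1 else 0) *
          max (max
            ((if 0 < f ((e * (2 * P.K + 3) + k) * (P.L + 1) - (2 * P.K + 3) * (P.L + 1) + P.L)
              then 1 else 0) *
              (f ((e * (2 * P.K + 3) + k) * (P.L + 1) - (2 * P.K + 3) * (P.L + 1) + P.L) + 1))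
            ((if 0 < f ((e * (2 * P.K + 3) + k) * (P.L + 1) - (2 * P.K + 3) * (P.L + 1) +
              (P.L + 1) + P.L) then 1 else 0) *
              (f ((e * (2 * P.K + 3) + k) * (P.L + 1) - (2 * P.K + 3) * (P.L + 1) + (P.L + 1) +
                P.L) + 1)))
            (f ((e * (2 * P.K + 3) + k) * (P.L + 1) - (2 * P.K + 3) * (P.L + 1) - (P.L + 1) +
                P.L))) % (4 * P.N) := by
    intro e he k hk
    have hk0 : 0 < P.L + 1 := Nat.succ_pos _
    obtain ⟨f, h1, -, e1⟩ := hF ((e * (2 * P.K + 3) + k) * (P.L + 1) + 0)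
      (mul_add_lt (mul_add_lt (by omega) hk) hk0)
    rw [zero_add] at e1 h1
    have d1 := mul_add_div_of_lt (j := e * (2 * P.K + 3) + k) hk0
    have d2 := mul_add_mod_of_lt (j := e * (2 * P.K + 3) + k) hk0
    have d3 := mul_add_div_of_lt (j := e) hk
    have d4 := mul_add_mod_of_lt (j := e) hk
    rw [add_zero] at e1 h1 d1 d2
    refine ⟨f, h1, ?_⟩
    rw [e1]
    simp only [startExpr, Expr.sel, Expr.eval_mod, Expr.eval_add, Expr.eval_mul, Expr.eval_sub,
      Expr.eval_div, Expr.eval_eqE, Expr.eval_ltE, Expr.eval_maxE, Expr.eval_get, Expr.eval_ofNat,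
      Expr.eval_var, scanSt_var, scanSt_arr, sel_arith, ite_mul_ite_one, if_true]
    norm_num only [if_true, if_false]
    rw [h.K, h.L, h.N, d1, d2, d3, d4]
    by_cases h0 : e = 0 <;> simp [h0]
  have step : ∀ e ≤ P.K, ∀ k < 2 * P.K + 3, ∀ b < P.L,
      F ((e * (2 * P.K + 3) + k) * (P.L + 1) + (b + 1)) =
        (F ((e * (2 * P.K + 3) + k) * (P.L + 1) + b) +
          (if 0 < F ((e * (2 * P.K + 3) + k) * (P.L + 1) + b) ∧
            F ((e * (2 * P.K + 3) + k) * (P.L + 1) + b) - 1 + 2 ^ (P.L - (b + 1)) ≤ P.n ∧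
            F ((e * (2 * P.K + 3) + k) * (P.L + 1) + b) - 1 + k - (P.K + 1) + 2 ^ (P.L - (b + 1))
              ≤ P.n ∧ cmp (P.L - (b + 1)) (F ((e * (2 * P.K + 3) + k) * (P.L + 1) + b) - 1)
                (F ((e * (2 * P.K + 3) + k) * (P.L + 1) + b) - 1 + k - (P.K + 1)) then 1 else 0) *
            2 ^ (P.L - (b + 1))) % (4 * P.N) := by
    intro e he k hk b hb
    have hk0 : b + 1 < P.L + 1 := by omega
    obtain ⟨f, h1, -, e1⟩ := hF ((e * (2 * P.K + 3) + k) * (P.L + 1) + (b + 1))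
      (mul_add_lt (mul_add_lt (by omega) hk) hk0)
    rw [zero_add] at e1 h1
    have d1 := mul_add_div_of_lt (j := e * (2 * P.K + 3) + k) hk0
    have d2 := mul_add_mod_of_lt (j := e * (2 * P.K + 3) + k) hk0
    have d4 := mul_add_mod_of_lt (j := e) hk
    have d5 : (e * (2 * P.K + 3) + k) * (P.L + 1) + (b + 1) - 1 =
      (e * (2 * P.K + 3) + k) * (P.L + 1) + b := by omega
    have e5 : (2 * P.N) = P.Z := rfl
    rw [e1]
    simp only [slideExpr, Expr.sel, Expr.eval_mod, Expr.eval_add, Expr.eval_mul, Expr.eval_sub,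
      Expr.eval_div, Expr.eval_eqE, Expr.eval_ltE, Expr.eval_get, Expr.eval_ofNat,
      Expr.eval_var, scanSt_var, scanSt_arr, sel_arith, ite_mul_ite_one, if_true]
    norm_num only [if_true, if_false]
    rw [h.n, h.K, h.L, h.N, d1, d2, d4, d5, h1 _ (by omega), h3 _ (by omega), e5,
      if_neg (Nat.succ_ne_zero b)]
    simp only [Nat.lt_succ_iff, and_assoc, hcmp]
  intro e
  induction e with
  | zero =>
    intro he k hk b
    induction b with
    | zero =>
      intro _
      obtain ⟨f, -, e1⟩ := start 0 he k hk
      rw [add_zero, e1, ← hmod 0 he, lv_zero, lvStart, if_pos rfl]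
    | succ b ih =>
      intro hb
      rw [step 0 he k hk b (by omega), ih (by omega), ← hmod 0 he k (b + 1)]
      congr 1
      rw [lv, lv, slide]
      simp only [hcmp]
      split_ifs with hc <;> simp
  | succ e ihe =>
    intro he k hk b
    induction b with
    | zero =>
      intro _
      obtain ⟨f, hf, e1⟩ := start (e + 1) he k hk
      rw [add_zero, e1, ← hmod _ he, lv_zero, lvStart_succ, lvNext, if_neg (by omega)]
      congr 1
      have i1 : ((e + 1) * (2 * P.K + 3) + k) * (P.L + 1) - (2 * P.K + 3) * (P.L + 1) =
          (e * (2 * P.K + 3) + k) * (P.L + 1) := by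
        rw [← Nat.sub_mul]
        congr 1
        rw [add_mul]; omega
      have i2 : ((e + 1) * (2 * P.K + 3) + k) * (P.L + 1) =
          (e * (2 * P.K + 3) + k) * (P.L + 1) + (2 * P.K + 3) * (P.L + 1) := by ring
      have i3 : 3 * (P.L + 1) ≤ (2 * P.K + 3) * (P.L + 1) := Nat.mul_le_mul_right _ (by omega)
      rw [i1]
      -- Within the band, all three predecessors lie in the previous row of the table and have been
      -- written. Outside, the factor 0 makes the cells that are read irrelevant.
      by_cases hc : 1 ≤ k ∧ k < 2 * P.K + 2
      · have i4 : (e * (2 * P.K + 3) + k) * (P.L + 1) - (P.L + 1) =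
            (e * (2 * P.K + 3) + (k - 1)) * (P.L + 1) := by
          obtain ⟨k, rfl⟩ : ∃ k', k = k' + 1 := ⟨k - 1, by omega⟩
          rw [Nat.add_sub_cancel, ← add_assoc, add_mul _ 1, one_mul, Nat.add_sub_cancel]
        have i5 : (e * (2 * P.K + 3) + k) * (P.L + 1) + (P.L + 1) =
            (e * (2 * P.K + 3) + (k + 1)) * (P.L + 1) := by ring
        rw [if_pos (show 0 < k ∧ k < 2 * P.K + 2 from hc), if_pos hc, one_mul, i4, hf _ (by omega), i5, hf _ (by rw [← i5]; omega),
          hf _ (by rw [← i4]; omega), ihe (by omega) k hk P.L le_rfl,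
          ihe (by omega) (k + 1) (by omega) P.L le_rfl, ihe (by omega) (k - 1) (by omega) P.L le_rfl]
        simp only [ite_mul, one_mul, zero_mul, hcmp]
      · rw [if_neg (show ¬ (0 < k ∧ k < 2 * P.K + 2) from hc), if_neg hc, zero_mul]
    | succ b ih =>
      intro hb
      rw [step _ he k hk b (by omega), ih (by omega), ← hmod _ he k (b + 1)]
      congr 1
      rw [lv, lv, slide]
      simp only [hcmp]
      split_ifs with hc <;> simp

end

/-! ### Correctness of Bob's program. -/

section

variable {d : ℕ} {P : Par d} {σ τ : State} {a a' : ℕ → ZMod P.p}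

/-- Bob forms his seeds from the whole message, which agrees with Alice's coins only on its first
part. The tables depend only on the first L seeds, and these agree. -/
theorem Tables.congr (h : Tables P a σ) (ha : ∀ b < P.L, a b = a' b) : Tables P a' σ :=
  ⟨h.pow, fun b hb => (h.seed b hb).trans (ha b hb), fun i hi => ⟨(h.index i hi).1,
    (h.index i hi).2.trans (Finset.sum_congr rfl fun u hu => by rw [ha u (Finset.mem_range.1 hu)])⟩,
    h.power⟩

theorem HashTab.congr {S f : ℕ → ℕ} (h : HashTab P a S f) (ha : ∀ b < P.L, a b = a' b) :
    HashTab P a' S f :=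
  fun j hj i hi => ⟨(h j hj i hi).1, (h j hj i hi).2.trans
    (windowHash_congr_seed (fun b hb => ha b (by omega)) i)⟩

theorem IsMsg.seedMod_eq {S r m : ℕ → ℕ} (h : IsMsg P S r m) {b : ℕ} (hb : b < P.L) :
    seedMod P.p P.w m b = seedMod P.p P.w r b := by
  rw [seedMod, seedMod]
  congr 1
  refine seed_congr fun x hx => h.coin x ?_
  by_contra hc
  have : P.L ≤ x / P.w := (Nat.le_div_iff_mul_le P.w_pos).2 (by omega)
  omega

/-- When the positions are right, the recovered string is right. -/
theorem LevelGood.recover {S T f g : ℕ → ℕ} (h : LevelGood P a S T 0 σ)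
    (hT : HashTab P a T (σ.arr 5)) (hS1 : ∀ x, S x ≤ 1) (hT1 : ∀ x, T x ≤ 1)
    (hS : ∀ x, P.N ≤ x → S x = 0)
    (hf : ∀ x < P.N, f x = (if 0 < σ.arr 11 x then 1 else 0) * σ.arr 5 (σ.arr 11 x - 1) % 2)
    (hg0 : ∀ x, P.N ≤ x → g x = 0)
    (hg : ∀ x, (∃ k < σ.var 14, σ.arr 13 k = x ∧ g x =
          if σ.arr 14 ((k * P.KK + σ.var 13) * P.KK) = σ.arr 15 (k * P.KK + σ.var 13)
            then 1 else 0) ∨ ((∀ k < σ.var 14, σ.arr 13 k ≠ x) ∧ g x = f x)) : g = S := by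
  funext x
  rcases Nat.lt_or_ge x P.N with hx | hx
  swap
  · rw [hg0 x hx, hS x hx]
  have hx' : x < 2 ^ (P.L - 0) := hx
  rcases hg x with ⟨k, hk, rfl, e⟩ | ⟨h1, e⟩
  · obtain ⟨v1, v2, v3, v4⟩ := h.value (Nat.zero_le _) k hk
    rw [e]
    simp only [pow_zero, mul_one, windowHash] at v4
    have h2 := hS1 (σ.arr 13 k)
    -- For symbol 0 the eliminated value is zero in the field, unlike the product; for symbol 1 the
    -- two are equal residues.
    interval_cases hv : S (σ.arr 13 k)
    · rw [if_neg]
      intro hc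
      rw [hc, Nat.cast_zero, zero_mul] at v4
      exact v3 v4
    · rw [if_pos]
      rw [Nat.cast_one, one_mul] at v4
      exact (natCast_eq_iff_of_lt v2 v1).1 v4
  · have hne : σ.arr 11 x ≠ 0 := fun h0 => by
      obtain ⟨k, hk, hkx⟩ := h.listed (Nat.zero_le _) x hx' (by simpa using h0)
      exact h1 k hk hkx
    obtain ⟨-, b1, b2, b3⟩ := h.matched x hx' (by simpa using hne)
    simp only [zero_mul, zero_add, pow_zero, mul_one] at b1 b2 b3
    have hZ : σ.arr 11 x - 1 < P.Z := by have := P.K_lt_N; unfold Par.Z; omega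
    obtain ⟨c1, c2⟩ := hT 0 (Nat.zero_le _) _ hZ
    rw [zero_mul, zero_add] at c1 c2
    have hp : 1 < P.p := P.p_prime.one_lt
    -- At level 0 the stored hash is the symbol of `t` as a number and not merely modulo p, since
    -- both are below p.
    have c3 : σ.arr 5 (σ.arr 11 x - 1) = T (σ.arr 11 x - 1) :=
      (natCast_eq_iff_of_lt c1 ((hT1 _).trans_lt hp)).1 c2
    have b4 := b3 0 (by norm_num)
    rw [add_zero, add_zero] at b4
    rw [e, hf x hx, if_pos (by omega), one_mul, c3, ← b4]
    have := hS1 x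
    omega

/-- Bob's program. -/
def bob (d : ℕ) : Prog :=
  .seq (setup d) (.seq tables (.seq parseProg (.seq levelsProg (.seq copyProg (.seq solveProg
    (.seq (hashProg 2 16) (.seq distProg verdictProg)))))))

theorem bdd_bobInit {t msg : List Bool} (ht : t.length = P.n) (hm : msg.length = P.msgLen)
    (r : List Bool) : Bdd P.W (bobInit t P.K msg r) := by
  have h1 := P.pow_W_gt
  have h2 := P.n_lt_pow
  have h3 := P.K_le
  have h4 := P.msgLen_lt
  refine ⟨fun x => ?_, fun a i => ?_⟩
  · simp only [bobInit]; split_ifs <;> omega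
  · have := bitAt_le_one t i
    have := bitAt_le_one msg i
    simp only [bobInit]; split_ifs <;> omega

/-- The bounds on time and output range hold for every message of the stated form. If no hash
misleads, either the flag is up and the strings are far apart, or the recovered string is `s` and
the distance table decides. -/
theorem bob_runs {s t msg : List Bool} (hs : s.length = P.n) (ht : t.length = P.n)
    (hmsg : msg.length = P.msgLen) {r : ℕ → ℕ} (hm : IsMsg P (bitAt s) r (bitAt msg))
    (rB : List Bool) :
    ∃ τ, Runs (bob d) (bobInit t P.K msg rB) τ ((P.L + 2) * ((bob d).wt * P.U)) ∧
      τ.var 0 ≤ 1 ∧ (∀ x, τ.arr 2 x ≤ 1) ∧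
      (Good (bitAt s) (bitAt t) P.n P.K P.L (seedMod P.p P.w r) →
        if editDist s t ≤ P.K then τ.var 0 = 1 ∧ τ.arr 2 = bitAt s else τ.var 0 = 0) := by
  obtain ⟨σ₁, r₁, g₁, a₁, -, v₁⟩ := setup_runs P (bdd_bobInit ht hmsg rB) ht rfl
  have hz : ∀ b, 2 ≤ b → ∀ x, σ₁.arr b x = 0 := fun b hb x => by
    rw [a₁]; simp only [bobInit]; rw [if_neg (by omega), if_neg (by omega)]
  have hz0 : σ₁.arr 0 = bitAt t := by rw [a₁]; rfl
  have hz1 : σ₁.arr 1 = bitAt msg := by rw [a₁]; rfl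
  have hv : ∀ y, 9 ≤ y → σ₁.var y = 0 := fun y hy => by
    rw [v₁ y (Or.inr hy)]; simp only [bobInit]
    rw [if_neg (by omega), if_neg (by omega), if_neg (by omega)]
  obtain ⟨σ₂, r₂, g₂, t₂, h₂, v₂, a₂, -⟩ := tables_runs g₁ (hz 4 (by norm_num))
    (by rw [hz0]; exact fun x hx => bitAt_eq_zero (by omega))
  rw [hz1] at t₂ h₂
  rw [hz0] at h₂
  have ha : ∀ b < P.L, seedMod P.p P.w (bitAt msg) b = seedMod P.p P.w r b :=
    fun b hb => hm.seedMod_eq hb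
  have t₂ := t₂.congr ha
  have h₂ := h₂.congr ha
  obtain ⟨σ₃, r₃, g₃, o₃, f₃⟩ := parseProg_runs (S := bitAt s) (r := r) g₂ t₂.pow
    (by rw [a₂ 1 (by norm_num), hz1]; exact hm)
    (by rw [a₂ 10 (by norm_num)]; exact hz 10 (by norm_num))
  have r₄ := RunsU.assign g₃.bdd 10 (eL + 1)
  have e₄ : (eL + 1).eval σ₃ = P.L + 1 := by simp [g₃.L]
  rw [e₄] at r₄
  set σ₄ := σ₃.setVar 10 (P.L + 1)
  have g₄ : Regs P σ₄ := g₃.setVar (by norm_num) (by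
    have := P.L_lt_N; have := P.N4_le; have := P.TB_lt; have := P.N_pos; omega)
  have z₄ : ∀ b, b ≠ 10 → 8 ≤ b ∨ b = 2 → ∀ x, σ₄.arr b x = 0 := fun b hb hb' x => by
    change σ₃.arr b x = 0
    rw [o₃.keeps.1 b (by simpa using hb), a₂ b (by omega)]
    exact hz b (by omega) x
  have zv : ∀ y, 11 ≤ y → σ₄.var y = 0 := fun y hy => by
    rw [State.setVar_var, if_neg (by omega), o₃.keeps.2 y (by simp; omega), v₂ y (by omega)]
    exact hv y (by omega)
  have i₄ : LevelInv P (seedMod P.p P.w r) (bitAt s) (bitAt t) (P.L + 1) σ₄ := by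
    refine ⟨g₄, t₂.keeps (o₃.keeps.trans (keeps_setVar _ 10 _)) (by decide), ?_, f₃, le_rfl,
      by simp [σ₄], fun y _ => z₄ 8 (by norm_num) (by norm_num) y,
      fun y _ => z₄ 9 (by norm_num) (by norm_num) y, z₄ 12 (by norm_num) (by norm_num) 0,
      z₄ 2 (by norm_num) (by norm_num),
      by rw [zv 14 (by norm_num)]; have := P.KK_pos; omega, fun h => by omega⟩
    change HashTab P _ _ (σ₃.arr 5)
    rw [o₃.keeps.1 5 (by decide)]; exact h₂
  -- At the fictitious level L + 1 nothing is stored and nothing is claimed, so the induction starts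
  -- for free.
  have l₄ : LevelsGood P (seedMod P.p P.w r) s t (P.L + 1) σ₄ := fun _ => by
    have e : ∀ x, σ₄.arr 11 x = 0 := z₄ 11 (by norm_num) (by norm_num)
    exact ⟨fun _ => ⟨fun h => by omega, fun i _ h => absurd (e _) h, fun h => by omega,
      fun h => by omega⟩, fun h => absurd (zv 15 (by norm_num)) h⟩
  obtain ⟨σ₅, r₅, i₅, l₅⟩ := levelsLoop_runs i₄ l₄
  obtain ⟨σ₆, r₆, g₆, o₆, c₆, f₆⟩ := copyProg_runs i₅.regs i₅.out
  have a₆ : ∀ b ≠ 2, σ₆.arr b = σ₅.arr b := fun b hb => o₆.keeps.1 b (by simpa using hb)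
  have w₆ : ∀ y ≠ 9, σ₆.var y = σ₅.var y := fun y hy => o₆.keeps.2 y (by simpa using hy)
  obtain ⟨σ₇, r₇, g₇, o₇, c₇, d₇, f₇⟩ := solveProg_runs g₆
    (by rw [w₆ 14 (by norm_num)]; exact i₅.few)
    (by
      rw [w₆ 14 (by norm_num), a₆ 13 (by norm_num)]
      exact i₅.list (Nat.zero_le _)) c₆
    (fun x => by
      rcases Nat.lt_or_ge x P.N with h | h
      · rw [f₆ x h]; omega
      · rw [c₆ x h]; omega)
  rw [w₆ 13 (by norm_num), w₆ 14 (by norm_num), a₆ 13 (by norm_num), a₆ 14 (by norm_num),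
    a₆ 15 (by norm_num)] at f₇
  have k₇ := o₆.keeps.trans o₇.keeps
  obtain ⟨σ₈, r₈, g₈, o₈, f₈⟩ := hashProg_runs (src := 2) (dst := 16) g₇
    (a := seedMod P.p P.w r)
    (by rw [k₇.1 3 (by decide)]; exact i₅.tables.pow)
    (by rw [k₇.1 4 (by decide)]; exact i₅.tables.seed) (by norm_num) (by norm_num) (by norm_num)
    (fun x hx => c₇ x (by unfold Par.Z at hx; omega))
  have k₈ := k₇.trans o₈.keeps
  obtain ⟨σ₉, r₉, g₉, o₉, f₉⟩ := distProg_runs g₈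
    (by rw [k₈.1 3 (by decide)]; exact i₅.tables.pow)
  have k₉ := k₈.trans o₉.keeps
  have r₁₀ := RunsU.assign g₉.bdd 0 ((Expr.var 15).eqE 0 *
    (Expr.var 0).ltE (.get 17 ((eK * (2 * eK + 3) + (eK + 1)) * (eL + 1) + eL)))
  have e₁₀ : ((Expr.var 15).eqE 0 * (Expr.var 0).ltE
      (.get 17 ((eK * (2 * eK + 3) + (eK + 1)) * (eL + 1) + eL)) : Expr).eval σ₉ =
      if σ₅.var 15 = 0 ∧ P.n < lv P.n P.K P.L
        (fun l x y => σ₈.arr 16 (l * P.Z + x) = σ₈.arr 5 (l * P.Z + y)) P.K (P.K + 1) P.L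
      then 1 else 0 := by
    rw [← f₉ P.K le_rfl (P.K + 1) (by omega) P.L le_rfl, ← k₉.2 15 (by decide)]
    simp only [Expr.eval_mul, Expr.eval_eqE, Expr.eval_ltE, Expr.eval_get, Expr.eval_add,
      Expr.eval_var, Expr.eval_ofNat, g₉.n, g₉.K, g₉.L]
    exact ite_mul_ite_one
  rw [e₁₀] at r₁₀
  have a2 : σ₉.arr 2 = σ₇.arr 2 := (o₈.keeps.trans o₉.keeps).1 2 (by decide)
  refine ⟨_, (Runs.seq r₁ (Runs.seq r₂ (Runs.seq r₃ (Runs.seq (Runs.seq r₄ r₅) (Runs.seq r₆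
    (Runs.seq r₇ (Runs.seq r₈ (Runs.seq r₉ r₁₀)))))))).mono ?_, ?_, fun x => ?_, fun hgood => ?_⟩
  · have e1 : (bob d).wt = (setup d).wt + (tables.wt + (parseProg.wt + ((Prog.assign 10 (eL + 1)).wt +
      (3 + levelProg.wt + 20) + (copyProg.wt + (solveProg.wt + ((hashProg 2 16).wt +
      (distProg.wt + verdictProg.wt))))))) := rfl
    rw [e1]
    have e2 : verdictProg.wt = (Prog.assign 0 ((Expr.var 15).eqE 0 *
      (Expr.var 0).ltE (.get 17 ((eK * (2 * eK + 3) + (eK + 1)) * (eL + 1) + eL)))).wt := rfl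
    rw [← e2]
    generalize (setup d).wt = n1
    generalize tables.wt = n2
    generalize parseProg.wt = n3
    generalize (Prog.assign 10 (eL + 1)).wt = n4
    generalize levelProg.wt = n5
    generalize copyProg.wt = n6
    generalize solveProg.wt = n7
    generalize (hashProg 2 16).wt = n8
    generalize distProg.wt = n9
    generalize verdictProg.wt = n10
    generalize P.U = u
    generalize P.L = l
    have : (n1 + n2 + n3 + n4 + n6 + n7 + n8 + n9 + n10) * u ≤
        (l + 2) * ((n1 + n2 + n3 + n4 + n6 + n7 + n8 + n9 + n10) * u) :=
      Nat.le_mul_of_pos_left _ (by omega)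
    have h2 : (l + 1 + 1) * ((n5 + 3) * u) ≤ (l + 2) * ((n5 + 23) * u) :=
      Nat.mul_le_mul le_rfl (Nat.mul_le_mul_right _ (by omega))
    calc _ = (n1 + n2 + n3 + n4 + n6 + n7 + n8 + n9 + n10) * u + (l + 1 + 1) * ((n5 + 3) * u) := by
          ring
      _ ≤ _ := Nat.add_le_add this h2
      _ = _ := by ring
  · rw [State.setVar_var, if_pos rfl]; split <;> omega
  · rw [State.setVar_arr, a2]; exact d₇ x
  · rw [State.setVar_var, if_pos rfl, State.setVar_arr, a2]
    obtain ⟨q1, q2⟩ := l₅ hgood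
    by_cases hf : σ₅.var 15 = 0
    swap
    · rw [if_neg (by have := q2 hf; omega), if_neg fun h => hf h.1]
    have hX : σ₇.arr 2 = bitAt s := (q1 hf).recover i₅.hash (bitAt_le_one s) (bitAt_le_one t)
      (fun x hx => bitAt_eq_zero (by have := P.n_lt; omega)) f₆ c₇ f₇
    have h5 : σ₈.arr 5 = σ₅.arr 5 := k₈.1 5 (by decide)
    rw [hX] at f₈
    rw [h5]
    have hlv : lv P.n P.K P.L (fun l x y => σ₈.arr 16 (l * P.Z + x) = σ₅.arr 5 (l * P.Z + y))
        P.K (P.K + 1) P.L = lv P.n P.K P.L (WinEq (bitAt s) (bitAt t)) P.K (P.K + 1) P.L := by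
      -- At the pairs visited by the exact computation, equal hashes mean equal windows by
      -- `Good.lv`; the converse always holds. The entries stay inside the hash tables because the
      -- tested windows end by position n.
      refine lv_congr (fun e he k hk b hb h1 h2 h3 => ?_) le_rfl (by omega) le_rfl
      have hn := P.n_lt
      have hp : 0 < 2 ^ (P.L - (b + 1)) := by positivity
      obtain ⟨u1, u2⟩ := f₈ (P.L - (b + 1)) (by omega) _
        (show lv P.n P.K P.L (WinEq (bitAt s) (bitAt t)) e k b - 1 < P.Z by unfold Par.Z; omega)
      obtain ⟨w1, w2⟩ := i₅.hash (P.L - (b + 1)) (by omega) _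
        (show lv P.n P.K P.L (WinEq (bitAt s) (bitAt t)) e k b - 1 + k - (P.K + 1) < P.Z by
          unfold Par.Z; omega)
      rw [← natCast_eq_iff_of_lt u1 w1, u2, w2]
      exact ⟨hgood.lv e he k hk b hb, windowHash_congr⟩
    rw [hlv]
    have := lt_lv_iff (K := P.K) hs ht P.n_lt
    by_cases hd : editDist s t ≤ P.K
    · rw [if_pos hd, if_pos ⟨hf, this.2 hd⟩]; exact ⟨rfl, hX⟩
    · rw [if_neg hd, if_neg fun h => hd (this.1 h.2)]

end

section

variable {d : ℕ} (P : Par d)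

/-! ### Numerical bounds -/

theorem Par.pow_pred_le : 2 ^ (P.L - 1) ≤ P.n :=
  Nat.lt_size.1 (show P.L - 1 < P.n.size from by have := P.L_pos; unfold Par.L at *; omega)

/-- The logarithm of the length. -/
noncomputable def Par.ℓ : ℝ := Real.logb 2 P.n

theorem Par.ℓ_lt : P.ℓ < P.L := by
  rw [ℓ, Real.logb_lt_iff_lt_rpow one_lt_two (by have := P.three_le; positivity), Real.rpow_natCast]
  exact_mod_cast P.n_lt

theorem Par.three_halves_lt : 3 / 2 < P.ℓ := by
  rw [ℓ, Real.lt_logb_iff_rpow_lt one_lt_two (by have := P.three_le; positivity)]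
  have h3 : (3 : ℝ) ≤ P.n := by exact_mod_cast P.three_le
  refine lt_of_lt_of_le ?_ h3
  refine lt_of_pow_lt_pow_left₀ 2 (by norm_num) ?_
  rw [← Real.rpow_natCast ((2 : ℝ) ^ _), ← Real.rpow_mul (by norm_num)]
  norm_num

/-- L - 1 ≤ log n because L is the bit length of n, and the remaining 2 is absorbed since log n > 1.
-/
theorem Par.L_le : (P.L : ℝ) + 1 ≤ 3 * P.ℓ := by
  have h1 : ((P.L - 1 : ℕ) : ℝ) ≤ P.ℓ := by
    rw [ℓ, Real.le_logb_iff_rpow_le one_lt_two (by have := P.three_le; positivity),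
      Real.rpow_natCast]
    exact_mod_cast P.pow_pred_le
  have h2 := P.three_halves_lt
  rw [Nat.cast_sub (by have := P.L_pos; omega), Nat.cast_one] at h1
  linarith

/-- This uses log n > 3/2 ≥ √2. It keeps log K + log log n away from 0 even for K = 1, so that
constants can be absorbed into it. -/
theorem Par.half_le : 1 / 2 ≤ Real.logb 2 P.ℓ := by
  have h2 := P.three_halves_lt
  rw [Real.le_logb_iff_rpow_le one_lt_two (by linarith)]
  refine le_trans ?_ h2.le
  refine le_of_sq_le_sq ?_ (by norm_num)
  rw [← Real.rpow_natCast ((2 : ℝ) ^ _), ← Real.rpow_mul (by norm_num)]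
  norm_num

theorem Par.logb_K_nonneg : 0 ≤ Real.logb 2 P.K :=
  Real.logb_nonneg one_lt_two (by exact_mod_cast P.one_le)

theorem Par.w_le : (P.w : ℝ) + 1 ≤ (13 * d + 30) * (Real.logb 2 P.K + Real.logb 2 P.ℓ) := by
  have hK : (1 : ℝ) ≤ P.K := by exact_mod_cast P.one_le
  have hl := P.three_halves_lt
  have hY0 : (0 : ℝ) < P.Y := by have := P.Y_pos; positivity
  have hX : ((P.w - 1 : ℕ) : ℝ) ≤ (d + 2) * Real.logb 2 P.Y := by
    have h : 2 ^ (P.w - 1) ≤ P.X :=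
      Nat.lt_size.1 (show P.w - 1 < P.X.size from by have := P.w_pos; unfold Par.w at *; omega)
    have h' : ((P.w - 1 : ℕ) : ℝ) ≤ Real.logb 2 P.X := by
      rw [Real.le_logb_iff_rpow_le one_lt_two (by have := P.X_pos; positivity), Real.rpow_natCast]
      exact_mod_cast h
    rw [Par.X, Nat.cast_pow, Real.logb_pow] at h'
    push_cast at h'
    exact h'
  have hY : Real.logb 2 P.Y ≤ 6 + (Real.logb 2 P.K + Real.logb 2 P.ℓ) := by
    -- Y ≤ 20 K · 3 log n, and 60 is rounded up to a power of two.
    have h64 : Real.logb 2 64 = 6 := by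
      rw [show (64 : ℝ) = 2 ^ (6 : ℕ) by norm_num, Real.logb_pow, Real.logb_self_eq_one one_lt_two]
      norm_num
    rw [← Real.logb_mul (by positivity) (by positivity), ← h64,
      ← Real.logb_mul (by norm_num) (by positivity)]
    refine Real.logb_le_logb_of_le one_lt_two hY0 ?_
    have h1 := P.L_le
    have : (P.Y : ℝ) = 20 * P.K * (P.L + 1) := by unfold Par.Y; push_cast; ring
    rw [this]
    have h2 : 20 * (P.K : ℝ) * (P.L + 1) ≤ 20 * P.K * (3 * P.ℓ) := by gcongr
    nlinarith [mul_pos (lt_of_lt_of_le one_pos hK) (show 0 < P.ℓ by linarith)]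
  have h1 := P.half_le
  have h2 := P.logb_K_nonneg
  rw [Nat.cast_sub P.w_pos, Nat.cast_one] at hX
  set x := Real.logb 2 P.K + Real.logb 2 P.ℓ
  have hx : 1 / 2 ≤ x := by linarith
  -- From x ≥ 1/2 one gets 6 + x ≤ 13x, and passing from w - 1 to w + 1 costs 2 ≤ 4x; together (d +
  -- 2) · 13 + 4 = 13d + 30.
  have h3 : ((d : ℝ) + 2) * Real.logb 2 P.Y ≤ (d + 2) * (13 * x) := by
    gcongr; linarith
  nlinarith

theorem Par.msgLen_le : (P.msgLen : ℝ) ≤ 12 * (13 * d + 30) *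
    (P.K * (Real.logb 2 P.K + Real.logb 2 P.ℓ) * P.ℓ) := by
  have h : P.msgLen ≤ (P.L + 1) * (4 * P.K) * (P.w + 1) := by
    have := P.one_le
    calc P.msgLen ≤ (P.L + 1) * (P.w + 1) + (P.L + 1) * P.KK * (P.w + 1) :=
          Nat.add_le_add_right (Nat.mul_le_mul (by omega) (by omega)) _
      _ = (P.L + 1) * (1 + P.KK) * (P.w + 1) := by ring
      _ ≤ _ := Nat.mul_le_mul_right _ (Nat.mul_le_mul_left _ (by unfold Par.KK; omega))
  have h1 := P.L_le
  have h2 := P.w_le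
  have h3 := P.three_halves_lt
  calc (P.msgLen : ℝ) ≤ ((P.L : ℝ) + 1) * (4 * P.K) * (P.w + 1) := by exact_mod_cast h
    _ ≤ (3 * P.ℓ) * (4 * P.K) * ((13 * d + 30) * (Real.logb 2 P.K + Real.logb 2 P.ℓ)) := by
      gcongr
    _ = _ := by ring

/-- The hypothesis on K enters here: in the power of Y = 20 K (L + 1) the factor K^(2d+8) is
replaced by n, which leaves n times a power of log n. -/
theorem Par.TB_le (hc : P.K ^ (2 * d + 8) ≤ P.n) :
    P.TB ≤ 2 * 20 ^ (2 * d + 8) * (P.n * (P.L + 1) ^ (2 * d + 8)) := by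
  have hN : P.N ≤ 2 * P.n := by
    have h := P.pow_pred_le
    unfold Par.N
    rw [show P.L = P.L - 1 + 1 by have := P.L_pos; omega, pow_succ]; omega
  have h1 : P.Y ^ (2 * d + 8) ≤ 20 ^ (2 * d + 8) * (P.n * (P.L + 1) ^ (2 * d + 8)) := by
    unfold Par.Y
    rw [mul_pow, mul_pow, mul_assoc]
    exact Nat.mul_le_mul_left _ (Nat.mul_le_mul_right _ hc)
  have h2 : 4 * P.N * (P.L + 1) ≤ 20 ^ (2 * d + 8) * (P.n * (P.L + 1) ^ (2 * d + 8)) := by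
    calc 4 * P.N * (P.L + 1) ≤ 8 * P.n * (P.L + 1) := Nat.mul_le_mul_right _ (by omega)
      _ = 8 * (P.n * (P.L + 1)) := by ring
      _ ≤ _ := by
        refine Nat.mul_le_mul ?_ (Nat.mul_le_mul_left _ ?_)
        · exact (by norm_num : 8 ≤ 20 ^ 1).trans (Nat.pow_le_pow_right (by norm_num) (by omega))
        · exact Nat.le_self_pow (by omega) _
  unfold Par.TB
  linarith

/-- All loop bounds and stored numbers are polynomial in n, so words have O(log n) bits and
logarithmic cost adds only one logarithmic factor. -/
theorem Par.W_le (hc : P.K ^ (2 * d + 8) ≤ P.n) :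
    P.W ≤ (12 * (2 * d + 8) + 5) * (P.L + 1) := by
  have h := P.TB_le hc
  generalize 2 * d + 8 = c at *
  have hTB : P.TB < 2 ^ (1 + 5 * c + P.L + P.L * c) := by
    refine lt_of_le_of_lt h ?_
    have h1 : 2 * 20 ^ c ≤ 2 ^ (1 + 5 * c) := by
      rw [pow_add, pow_mul, pow_one]
      exact Nat.mul_le_mul_left _ (Nat.pow_le_pow_left (by norm_num) _)
    have h2 : (P.L + 1) ^ c ≤ 2 ^ (P.L * c) := by
      rw [pow_mul]
      exact Nat.pow_le_pow_left Nat.lt_two_pow_self _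
    have h3 : P.n * (P.L + 1) ^ c < 2 ^ P.L * 2 ^ (P.L * c) :=
      Nat.mul_lt_mul_of_lt_of_le P.n_lt h2 (by positivity)
    calc _ < 2 ^ (1 + 5 * c) * (2 ^ P.L * 2 ^ (P.L * c)) :=
          Nat.mul_lt_mul_of_le_of_lt h1 h3 (by positivity)
      _ = _ := by ring
  have hW : P.W ≤ 1 + 2 * (1 + 5 * c + P.L + P.L * c) := by
    refine Nat.size_le.2 ?_
    have h1 : 4 * P.N * P.M ≤ P.TB * P.TB := Nat.mul_le_mul P.N4_le P.M_le_TB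
    have h2 : 1 ≤ P.TB := by have := P.N4_le; have := P.N_pos; omega
    rw [pow_add, pow_one, two_mul (1 + 5 * c + P.L + P.L * c), pow_add]
    nlinarith
  nlinarith

/-- A bound for the running times. -/
theorem Par.time_le (hc : P.K ^ (2 * d + 8) ≤ P.n) (v : ℕ) :
    (((P.L + 2) * (v * P.U) : ℕ) : ℝ) ≤
      v * (6 * 20 ^ (2 * d + 8) * (12 * (2 * d + 8) + 5)) * 3 ^ (2 * d + 10) *
        (P.n * P.ℓ ^ (2 * d + 10)) := by
  have h1 := P.TB_le hc
  have h2 := P.W_le hc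
  have h3 := P.L_le
  have h0 : 1 ≤ 20 ^ (2 * d + 8) * (P.n * (P.L + 1) ^ (2 * d + 8)) := by
    have := P.three_le
    exact Nat.one_le_iff_ne_zero.2 (by positivity)
  have hU : P.U ≤ 3 * 20 ^ (2 * d + 8) * (P.n * (P.L + 1) ^ (2 * d + 8)) *
      ((12 * (2 * d + 8) + 5) * (P.L + 1)) := Nat.mul_le_mul (by linarith) h2
  have hN : (P.L + 2) * (v * P.U) ≤ v * (6 * 20 ^ (2 * d + 8) * (12 * (2 * d + 8) + 5)) *
      (P.n * (P.L + 1) ^ (2 * d + 10)) := by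
    calc (P.L + 2) * (v * P.U) ≤ (2 * (P.L + 1)) * (v * (3 * 20 ^ (2 * d + 8) *
          (P.n * (P.L + 1) ^ (2 * d + 8)) * ((12 * (2 * d + 8) + 5) * (P.L + 1)))) :=
          Nat.mul_le_mul (by omega) (Nat.mul_le_mul_left _ hU)
      _ = _ := by ring
  calc (((P.L + 2) * (v * P.U) : ℕ) : ℝ) ≤ v * (6 * 20 ^ (2 * d + 8) * (12 * (2 * d + 8) + 5)) *
      (P.n * ((P.L : ℝ) + 1) ^ (2 * d + 10)) := by exact_mod_cast hN
    _ ≤ v * (6 * 20 ^ (2 * d + 8) * (12 * (2 * d + 8) + 5)) *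
      (P.n * (3 * P.ℓ) ^ (2 * d + 10)) := by gcongr
    _ = _ := by rw [mul_pow]; ring

/-- Misleading hashes are unlikely. -/
theorem Par.bad_le (s t : List Bool) :
    ({r : Fin (P.L * P.w) → Bool | ¬ Good (bitAt s) (bitAt t) P.n P.K P.L
      (seedMod P.p P.w (coinSeq r))}.ncard : ℝ) * (P.K * P.ℓ) ^ d ≤ 2 ^ (P.L * P.w) := by
  have h := ncard_not_good_mul_le (n := P.n) (L := P.L) P.M_le_p P.one_le (bitAt_le_one s)
    (bitAt_le_one t)
  set b := {r : Fin (P.L * P.w) → Bool | ¬ Good (bitAt s) (bitAt t) P.n P.K P.L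
      (seedMod P.p P.w (coinSeq r))}.ncard
  -- This explains the exponent in X = Y^(d+2): two factors Y pay for the number of tests in the
  -- union bound, and the other d give the required failure probability.
  have hX : 20 * P.K ^ 2 * (P.L + 1) ^ 2 * (P.K * (P.L + 1)) ^ d ≤ 2 ^ P.w := by
    refine le_trans ?_ P.X_lt_M.le
    unfold Par.X Par.Y
    calc _ = 20 * ((P.K * (P.L + 1)) ^ (d + 2)) := by ring
      _ ≤ 20 ^ (d + 2) * ((P.K * (P.L + 1)) ^ (d + 2)) :=
        Nat.mul_le_mul_right _ (Nat.le_self_pow (by omega) _)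
      _ = _ := by rw [← mul_pow, mul_assoc]
  have hn : b * (P.K * (P.L + 1)) ^ d ≤ 2 ^ (P.L * P.w) := by
    have hpos : 0 < 20 * P.K ^ 2 * (P.L + 1) ^ 2 := by have := P.one_le; positivity
    refine Nat.le_of_mul_le_mul_left ?_ hpos
    calc _ = b * (20 * P.K ^ 2 * (P.L + 1) ^ 2 * (P.K * (P.L + 1)) ^ d) := by ring
      _ ≤ b * 2 ^ P.w := Nat.mul_le_mul_left _ hX
      _ ≤ _ := h
  have h1 := P.ℓ_lt
  have h2 := P.three_halves_lt
  calc (b : ℝ) * (P.K * P.ℓ) ^ d ≤ b * (P.K * (P.L + 1)) ^ d := by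
        gcongr; linarith
    _ ≤ _ := by exact_mod_cast hn

end

/-! ### The theorem -/

/-- A final state always encodes an output once register `0` is 0 or 1 and array `2` holds bits,
whether or not the output is right. -/
theorem exists_decodes {B : Prog} {t msg rB : List Bool} {K T : ℕ} {τ : State}
    (h : Runs B (bobInit t K msg rB) τ T) (h0 : τ.var 0 ≤ 1) (h2 : ∀ x, τ.arr 2 x ≤ 1) :
    ∃ (o : Option (List Bool)) (U : ℕ), Decodes B t K msg rB o U ∧ U ≤ T := by
  obtain ⟨U, hU, he⟩ := h
  by_cases h1 : τ.var 0 = 0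
  · exact ⟨none, U, ⟨τ, he, h1⟩, hU⟩
  · refine ⟨some (List.ofFn fun i : Fin t.length => decide (τ.arr 2 i = 1)), U,
      ⟨τ, he, by omega, by simp, fun i hi => ?_⟩, hU⟩
    simp only [bitAt, List.getD_eq_getElem?_getD, List.getElem?_ofFn, hi, dite_true,
      Option.getD_some]
    have := h2 i
    interval_cases h : τ.arr 2 i <;> simp

theorem protocol_runsWithin {d : ℕ} (P : Par d) {s t : List Bool}
    (hs : s.length = P.n) (ht : t.length = P.n) {comm time : ℝ} (hcomm : (P.msgLen : ℝ) ≤ comm)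
    (htime : (((P.L + 2) * (((alice d).wt + (bob d).wt) * P.U) : ℕ) : ℝ) ≤ time) :
    RunsWithin (alice d) (bob d) P.K (P.L * P.w) s t comm time := by
  intro rA
  obtain ⟨msg, T, hE, hT, hl, hm⟩ := alice_runs hs rA
  refine ⟨msg, T, hE, by rwa [hl], le_trans ?_ htime, fun rB => ?_⟩
  · rw [Nat.cast_le]
    refine hT.trans (le_trans (Nat.mul_le_mul_right _ (Nat.le_add_right _ (bob d).wt)) ?_)
    exact Nat.le_mul_of_pos_left _ (by omega)
  · obtain ⟨τ, hr, h0, h2, -⟩ := bob_runs hs ht hl hm (List.ofFn rB)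
    obtain ⟨o, U, hD, hU⟩ := exists_decodes hr h0 h2
    refine ⟨o, U, hD, le_trans ?_ htime⟩
    rw [Nat.cast_le]
    exact hU.trans (Nat.mul_le_mul_left _ (Nat.mul_le_mul_right _ (Nat.le_add_left _ _)))

theorem protocol_succeeds {d : ℕ} (P : Par d) {s t : List Bool} (hs : s.length = P.n)
    (ht : t.length = P.n) (rA rB : Fin (P.L * P.w) → Bool)
    (hgood : Good (bitAt s) (bitAt t) P.n P.K P.L (seedMod P.p P.w (coinSeq rA))) :
    Succeeds (alice d) (bob d) P.K s t (List.ofFn rA) (List.ofFn rB) := by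
  obtain ⟨msg, T, hE, -, hl, hm⟩ := alice_runs hs rA
  obtain ⟨τ, ⟨U, -, he⟩, -, -, h⟩ := bob_runs hs ht hl hm (List.ofFn rB)
  refine ⟨msg, T, U, hE, τ, he, ?_⟩
  have h := h hgood
  rw [answer]
  split_ifs at h ⊢
  · exact ⟨h.1, hs.trans ht.symm, fun i _ => by rw [h.2]⟩
  · exact h

theorem protocol_successProb {d : ℕ} (P : Par d) {s t : List Bool} (hs : s.length = P.n)
    (ht : t.length = P.n) :
    1 - 1 / (P.K * P.ℓ) ^ d ≤ successProb (alice d) (bob d) P.K (P.L * P.w) s t := by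
  set R := P.L * P.w with hR
  set G := {r : Fin R → Bool | Good (bitAt s) (bitAt t) P.n P.K P.L
      (seedMod P.p P.w (coinSeq r))}
  have h1 : G.ncard + Gᶜ.ncard = 2 ^ R := by
    rw [Set.ncard_add_ncard_compl]; simp
  have h2 := P.bad_le s t
  have h3 : (Gᶜ.ncard : ℝ) * (P.K * P.ℓ) ^ d ≤ 2 ^ R := h2
  have h4 : G.ncard * 2 ^ R ≤ {r : (Fin R → Bool) × (Fin R → Bool) |
      Succeeds (alice d) (bob d) P.K s t (List.ofFn r.1) (List.ofFn r.2)}.ncard := by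
    have e : (G ×ˢ (Set.univ : Set (Fin R → Bool))).ncard = G.ncard * 2 ^ R := by
      rw [Set.ncard_prod, Set.ncard_univ]; simp
    rw [← e]
    -- Success depends only on Alice's coins: Bob tosses none and reads the seeds from the message.
    exact Set.ncard_le_ncard fun r hr => protocol_succeeds P hs ht r.1 r.2 hr.1
  have hl := P.three_halves_lt
  have hK : (1 : ℝ) ≤ P.K := by exact_mod_cast P.one_le
  have hpos : 0 < ((P.K : ℝ) * P.ℓ) ^ d := by
    have : 0 < P.ℓ := by linarith
    positivity
  have hR' : (0 : ℝ) < 2 ^ R := by positivity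
  have h5 : ((G.ncard : ℝ) * 2 ^ R) ≤ ({r : (Fin R → Bool) × (Fin R → Bool) |
      Succeeds (alice d) (bob d) P.K s t (List.ofFn r.1) (List.ofFn r.2)}.ncard : ℝ) := by
    exact_mod_cast h4
  rw [successProb, le_div_iff₀ (by positivity)]
  refine le_trans ?_ h5
  have h6 : (G.ncard : ℝ) = 2 ^ R - Gᶜ.ncard := by
    rw [eq_sub_iff_add_eq]; exact_mod_cast h1
  have h7 : (Gᶜ.ncard : ℝ) ≤ 1 / (P.K * P.ℓ) ^ d * 2 ^ R := by
    rw [div_mul_eq_mul_div, one_mul, le_div_iff₀ hpos]; exact h3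
  rw [h6, ← mul_assoc]
  refine mul_le_mul_of_nonneg_right ?_ hR'.le
  linarith

end DocExchange

theorem mainTheorem6 :
    ∀ d : ℕ, ∃ (c : ℕ) (A B : DocExchange.Prog) (C : ℝ) (e : ℕ),
      ∀ n K : ℕ, 3 ≤ n → 1 ≤ K → K ^ c ≤ n →
        ∃ R : ℕ, ∀ s t : List Bool, s.length = n → t.length = n →
          DocExchange.RunsWithin A B K R s t
            (C * (K * (Real.logb 2 K + Real.logb 2 (Real.logb 2 n)) * Real.logb 2 n))
            (C * (n * Real.logb 2 n ^ e)) ∧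
          1 - 1 / (K * Real.logb 2 n) ^ d ≤ DocExchange.successProb A B K R s t := by
  intro d
  let D : ℝ := (((DocExchange.alice d).wt + (DocExchange.bob d).wt : ℕ) : ℝ) *
    (6 * 20 ^ (2 * d + 8) * (12 * (2 * d + 8) + 5)) * 3 ^ (2 * d + 10)
  have hD : 0 ≤ D := by positivity
  -- The exponent c is that of Y in `TB`. One constant serves both bounds, being the sum of the
  -- constants for communication and time.
  refine ⟨2 * d + 8, DocExchange.alice d, DocExchange.bob d, 12 * (13 * d + 30) + D, 2 * d + 10,
    fun n K hn hK hc => ?_⟩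
  let P : DocExchange.Par d := ⟨n, K, hn, hK, (Nat.le_self_pow (by omega) K).trans hc⟩
  -- The number of coins is exactly what Alice tosses: L seeds of w bits.
  refine ⟨P.L * P.w, fun s t hs ht => ⟨?_, DocExchange.protocol_successProb P hs ht⟩⟩
  have hl : 0 ≤ P.ℓ := by have := P.three_halves_lt; linarith
  have hx : 0 ≤ Real.logb 2 P.K + Real.logb 2 P.ℓ := by
    have := P.half_le; have := P.logb_K_nonneg; linarith
  refine DocExchange.protocol_runsWithin P hs ht (P.msgLen_le.trans ?_)
    ((P.time_le hc _).trans ?_)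
  · exact mul_le_mul_of_nonneg_right (by linarith) (by positivity)
  · exact mul_le_mul_of_nonneg_right (show D ≤ 12 * (13 * d + 30) + D by
      have : (0 : ℝ) ≤ 12 * (13 * d + 30) := by positivity
      linarith) (by positivity)
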